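/- Let $d,m\ge 1$ be integers and consider, for functions $f=(f_1,\dots,f_m)$ on $\mathbb{R}^d$, the differential expression $$(\mathcal{L}f)_i=\mathrm{div}(Q\nabla f_i)-\sum_{j=1}^m F_{ij}\cdot\nabla f_j-\sum_{j=1}^m v_{ij}f_j,\qquad 1\le i\le m.$$ Assume Hypotheses (H1): - $Q:\mathbb{R}^d\to\mathbb{R}^{d\times d}$ is measurable, $Q(x)$ is symmetric for every $x$, and there are $\eta_1,\eta_2>0$ with $\eta_1|\xi|^2\le\langle Q(x)\xi,\xi\rangle\le\eta_2|\xi|^2$ for all $x,\xi\in\mathbb{R}^d$; - $F_{ij}\in L^\infty(\mathbb{R}^d,\mathbb{R}^d)$ for all $i,j\in\{1,\dots,m\}$; - $V=(v_{ij})_{1\le i,j\le m}$ with $v_{ij}\in L^1_{\mathrm{loc}}(\mathbb{R}^d)$ real-valued, and there is $M>0$ with $|\mathrm{Im}\langle V(x)\xi,\xi\rangle|\le M\,\mathrm{Re}\langle V(x)\xi,\xi\rangle$ for all $x\in\mathbb{R}^d$, $\xi\in\mathbb{C}^m$. Let $V_s=\frac12(V+V^*)$ and let $\mathrm{a}$ be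 the sesquilinear form $$\mathrm{a}(f,g)=\sum_{i=1}^m\int_{\mathbb{R}^d}\langle Q\nabla f_i,\nabla g_i\rangle\,dx+\sum_{i,j=1}^m\int_{\mathbb{R}^d}(F_{ij}\cdot\nabla f_j)\,\overline{g_i}\,dx+\int_{\mathbb{R}^d}\langle Vf,g\rangle\,dx$$ with domain $D(\mathrm{a})=\{f\in H^1(\mathbb{R}^d,\mathbb{C}^m):\int_{\mathbb{R}^d}\langle V_sf,f\rangle\,dx<\infty\}$. Let $L$ be the realization of $\mathcal{L}$ in $L^2(\mathbb{R}^d,\mathbb{C}^m)$ given by this form: $f\in D(L)$ and $Lf=h$ if and only if $f\in D(\mathrm{a})$ and $\mathrm{a}(f,g)=-\langle h,g\rangle_{2}$ for all $g\in D(\mathrm{a})$. Then $L$ generates a unique $C_0$-semigroup $\{S_2(t)\}_{t\ge0}$ on $L^2(\mathbb{R}^d,\mathbb{C}^m)$, and $\{S_2(t)\}_{t\ge 0}$ is positive (that is, $S_2(t)f\ge0$ a.e. for every $t\ge0$ and every $f\in L^2(\mathbb{R}^d,\mathbb{R}^m)$ with $f\ge0$ a.e., where $y\ge0$ for $y\in\mathbb{R}^m$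 means that all components are nonnegative) if and only if $$F_{ij}=0\ \text{ a.e.}\quad\text{and}\quad v_{ij}\le0\ \text{ a.e.}\qquad\text{for all } i\ne j\in\{1,\dots,m\}.$$ Moreover, for every $p\in[1,\infty)$ and every family $\{S_p(t)\}_{t\ge0}$ of bounded linear operators on $L^p(\mathbb{R}^d,\mathbb{C}^m)$ that is consistent with $\{S_2(t)\}_{t\ge0}$ (that is, $S_p(t)f=S_2(t)f$ for all $t\ge0$ and $f\in L^p\cap L^2$), $\{S_p(t)\}_{t\ge0}$ is positive if and only if the same condition holds. -/

import Mathlib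

open MeasureTheory Filter Topology
open scoped NNReal ENNReal ContDiff ComplexConjugate

noncomputable section

namespace EllipticSystem

/-- The physical space `ℝ^d`. -/
abbrev Space (d : ℕ) := EuclideanSpace ℝ (Fin d)

/-- The space `L^p(ℝ^d, ℂ^m)` with respect to Lebesgue measure; `ℂ^m` has its Euclidean norm. -/
abbrev VLp (d m : ℕ) (p : ℝ≥0∞) :=
  Lp (EuclideanSpace ℂ (Fin m)) p (volume : Measure (Space d))

/-- For a real matrix `A` and `ξ, ζ ∈ ℂ^m`, the number `⟨A ξ, ζ⟩ = ∑ i j, A i j * ξ j * conj (ζ i)`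
(linear in `ξ`, conjugate-linear in `ζ`). -/
def sesq {n : ℕ} (A : Matrix (Fin n) (Fin n) ℝ) (ξ ζ : EuclideanSpace ℂ (Fin n)) : ℂ :=
  ∑ i, ∑ j, (A i j : ℂ) * ξ j * conj (ζ i)

/-- The standing hypotheses (with `C = 0`) on the coefficients of
`𝓛 f = div (Q ∇f) - F · ∇f - V f`. -/
structure HypH1 {d m : ℕ} (Q : Space d → Matrix (Fin d) (Fin d) ℝ)
    (F : Fin m → Fin m → Space d → Space d)
    (V : Space d → Matrix (Fin m) (Fin m) ℝ) : Prop where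
  Q_measurable : ∀ k l, Measurable fun x => Q x k l
  Q_symm : ∀ x, (Q x).IsSymm
  Q_elliptic : ∃ η₁ η₂ : ℝ, 0 < η₁ ∧ 0 < η₂ ∧ ∀ x ξ : Space d,
    η₁ * ‖ξ‖ ^ 2 ≤ ∑ k, ∑ l, Q x k l * ξ l * ξ k ∧
      ∑ k, ∑ l, Q x k l * ξ l * ξ k ≤ η₂ * ‖ξ‖ ^ 2
  F_bounded : ∀ i j, MemLp (F i j) ∞ volume
  V_locInt : ∀ i j, LocallyIntegrable (fun x => V x i j) volume
  V_sectorial : ∃ M : ℝ, 0 < M ∧ ∀ (x : Space d) (ξ : EuclideanSpace ℂ (Fin m)),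
    |(sesq (V x) ξ ξ).im| ≤ M * (sesq (V x) ξ ξ).re

/-- `g ∈ L²` is the weak (distributional) partial derivative `∂_k f` of `f ∈ L²`. The integrals are
`ℂ^m`-valued, so this says `g_i = ∂_k f_i` for every component. -/
def IsWeakPartial {d m : ℕ} (k : Fin d) (f g : VLp d m 2) : Prop :=
  ∀ φ : Space d → ℝ, ContDiff ℝ ∞ φ → HasCompactSupport φ →
    ∫ x, fderiv ℝ φ x (EuclideanSpace.single k 1) • f x = -∫ x, φ x • g x

/-- The Sobolev space `H¹(ℝ^d, ℂ^m)`. -/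
def IsH1 {d m : ℕ} (f : VLp d m 2) : Prop :=
  ∀ k : Fin d, ∃ g : VLp d m 2, IsWeakPartial k f g

theorem IsWeakPartial.unique {d m : ℕ} {k : Fin d} {f g g' : VLp d m 2}
    (h : IsWeakPartial k f g) (h' : IsWeakPartial k f g') : g = g' := by
  have hl : ∀ u : VLp d m 2, LocallyIntegrable u volume := fun u =>
    (Lp.memLp u).locallyIntegrable (by norm_num)
  refine Lp.ext (ae_eq_of_integral_contDiff_smul_eq (hl g) (hl g') fun φ h1 h2 => ?_)
  exact neg_injective ((h φ h1 h2).symm.trans (h' φ h1 h2))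

open Classical in
/-- The weak partial derivative `∂_k f ∈ L²` (and `0` if there is none). -/
def weakPartial {d m : ℕ} (k : Fin d) (f : VLp d m 2) : VLp d m 2 :=
  if h : ∃ g, IsWeakPartial k f g then h.choose else 0

theorem IsWeakPartial.weakPartial_eq {d m : ℕ} {k : Fin d} {f g : VLp d m 2}
    (h : IsWeakPartial k f g) : weakPartial k f = g := by
  have hex : ∃ g, IsWeakPartial k f g := ⟨g, h⟩
  rw [weakPartial, dif_pos hex]
  exact hex.choose_spec.unique h

/-- The symmetric part `V_s = (V + V*) / 2` of a real matrix. -/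
def symmPart {m : ℕ} (A : Matrix (Fin m) (Fin m) ℝ) : Matrix (Fin m) (Fin m) ℝ :=
  (1 / 2 : ℝ) • (A + A.transpose)

/-- The form domain `D(a) = {f ∈ H¹(ℝ^d, ℂ^m) : ∫ ⟨V_s f, f⟩ < ∞}` (the integrand is nonnegative
and measurable under the standing hypotheses). -/
def formDomain {d m : ℕ} (V : Space d → Matrix (Fin m) (Fin m) ℝ) : Set (VLp d m 2) :=
  {f | IsH1 f ∧ Integrable (fun x => sesq (symmPart (V x)) (f x) (f x)) volume}

/-- The sesquilinear form
`a(f, g) = ∑ i, ∫ ⟨Q ∇f_i, ∇g_i⟩ + ∑ i j, ∫ (F i j · ∇f_j) conj (g_i) + ∫ ⟨V f, g⟩`,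
to be used for `f, g ∈ D(a)`. -/
def form {d m : ℕ} (Q : Space d → Matrix (Fin d) (Fin d) ℝ)
    (F : Fin m → Fin m → Space d → Space d)
    (V : Space d → Matrix (Fin m) (Fin m) ℝ) (f g : VLp d m 2) : ℂ :=
  (∑ i, ∫ x, ∑ k, ∑ l, (Q x k l : ℂ) * weakPartial l f x i * conj (weakPartial k g x i))
    + (∑ i, ∑ j, ∫ x, (∑ k, (F i j x k : ℂ) * weakPartial k f x j) * conj (g x i))
    + ∫ x, sesq (V x) (f x) (g x)

/-- The graph of the realization `L` of `𝓛` in `L²(ℝ^d, ℂ^m)`, that is, of minus the operator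
associated with the form `a`: `f ∈ D(L)` and `L f = h` iff `f ∈ D(a)` and
`a(f, g) = - ⟨h, g⟩_{L²}` for all `g ∈ D(a)`. (Mathlib's `inner ℂ g h` is conjugate-linear
in `g`.) -/
def realization {d m : ℕ} (Q : Space d → Matrix (Fin d) (Fin d) ℝ)
    (F : Fin m → Fin m → Space d → Space d)
    (V : Space d → Matrix (Fin m) (Fin m) ℝ) : Set (VLp d m 2 × VLp d m 2) :=
  {fh | fh.1 ∈ formDomain V ∧
    ∀ g ∈ formDomain V, form Q F V fh.1 g = -inner ℂ g fh.2}

/-- A strongly continuous (`C_0`-) semigroup of bounded operators on `X`. -/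
structure IsC0Semigroup {X : Type*} [NormedAddCommGroup X] [NormedSpace ℂ X]
    (S : ℝ≥0 → X →L[ℂ] X) : Prop where
  map_zero : S 0 = ContinuousLinearMap.id ℂ X
  map_add : ∀ s t, S (s + t) = (S s).comp (S t)
  tendsto_zero : ∀ f, Tendsto (fun t => S t f) (𝓝 0) (𝓝 f)

/-- The graph of the generator of `S`: pairs `(f, h)` with `h = lim_{t → 0+} (S t f - f) / t`. -/
def generatorGraph {X : Type*} [NormedAddCommGroup X] [NormedSpace ℂ X]
    (S : ℝ≥0 → X →L[ℂ] X) : Set (X × X) :=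
  {fh | Tendsto (fun t : ℝ≥0 => ((t : ℝ)⁻¹ : ℂ) • (S t fh.1 - fh.1)) (𝓝[>] 0) (𝓝 fh.2)}

/-- `S` is the `C_0`-semigroup generated by the operator with graph `L`. -/
def IsGeneratedBy {X : Type*} [NormedAddCommGroup X] [NormedSpace ℂ X]
    (S : ℝ≥0 → X →L[ℂ] X) (L : Set (X × X)) : Prop :=
  IsC0Semigroup S ∧ generatorGraph S = L

/-- `f` takes values in `[0, ∞)^m ⊆ ℝ^m ⊆ ℂ^m` almost everywhere. -/
def Nonneg {d m : ℕ} {p : ℝ≥0∞} (f : VLp d m p) : Prop :=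
  ∀ᵐ x, ∀ i, 0 ≤ (f x i).re ∧ (f x i).im = 0

/-- A family of operators is positive if each member maps functions with `f ≥ 0` a.e. to functions
of the same kind. -/
def IsPositiveFamily {d m : ℕ} {p : ℝ≥0∞} [Fact (1 ≤ p)]
    (S : ℝ≥0 → VLp d m p →L[ℂ] VLp d m p) : Prop :=
  ∀ t f, Nonneg f → Nonneg (S t f)

/-- `S` on `L^p` and `T` on `L^q` are consistent: they agree on `L^p ∩ L^q`. -/
def Consistent {d m : ℕ} {p q : ℝ≥0∞} [Fact (1 ≤ p)] [Fact (1 ≤ q)]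
    (S : ℝ≥0 → VLp d m p →L[ℂ] VLp d m p) (T : ℝ≥0 → VLp d m q →L[ℂ] VLp d m q) : Prop :=
  ∀ t (f : VLp d m p) (g : VLp d m q), f =ᵐ[volume] g → S t f =ᵐ[volume] T t g

/-- `𝓛` is coupled only through the potential, with nonpositive off-diagonal entries:
`F i j = 0` and `v i j ≤ 0` a.e. for `i ≠ j`. -/
def CoupledOnlyByNonposPotential {d m : ℕ} (F : Fin m → Fin m → Space d → Space d)
    (V : Space d → Matrix (Fin m) (Fin m) ℝ) : Prop :=
  ∀ i j, i ≠ j → (∀ᵐ x, F i j x = 0) ∧ (∀ᵐ x, V x i j ≤ 0)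

end EllipticSystem

end

/-!
# Positivity of the semigroup of a second order elliptic system

The form `a` is elliptic on its domain, which is a Hilbert space for the norm
`‖f‖² + ‖∇f‖² + ∫ ⟨V_s f, f⟩`. Its realization `L` therefore has a resolvent `R r` with
`‖R r‖ ≤ 1 / (r - κ)` for all large real `r`, given by the Riesz representation of the coercive form
`a + r`. The Hille–Yosida theorem produces the semigroup `S` as the limit of the exponentials of the
Yosida approximations (`exists_semigroup_of_resolvent`), and the construction shows that a closed
convex cone invariant under the resolvent is invariant under `S`. Uniqueness is Grönwall's
inequality for the squared norm of the difference of two orbits (`IsGeneratedBy.unique`).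

*Sufficiency.* Let `P u` be the coordinatewise positive part of `Re u`. It is a contraction applied
to `u`, so it belongs to `H¹` by the characterization of `H¹` through difference quotients. The
gradients of `P u` and of `u - P u` vanish where these functions do, so the second order terms and
the diagonal terms of `a(P u, u - P u)` vanish, and under the coupling condition what is left is a
nonnegative potential term. Testing the resolvent equation for `u` with `u - P u` gives `u = P u`
when the right hand side is nonnegative (`nonneg_formSolution`). Hence the resolvent, and with it
`S`, preserves the cone of nonnegative functions.

*Necessity.* If `f` and `g` are nonnegative functions of the form domain with `⟨f, g⟩ = 0`, then
positivity of `⟨S t f, g⟩` for all `t` forces `Re a(f, g) ≤ 0` (`IsElliptic.re_form_nonpos`). With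
`f = φ e_j` and `g = ψ e_i` for `i ≠ j` this reads `∫ (F i j · ∇φ + v i j φ) ψ ≤ 0`, so
`F i j · ∇φ + v i j φ ≤ 0` almost everywhere for every test function `φ ≥ 0`. The choice
`φ = e^{⟨a, x⟩}` on a large ball gives `F i j · a + v i j ≤ 0` almost everywhere for every vector
`a`, and letting `a` run through the multiples of the coordinate vectors yields `F i j = 0` and
`v i j ≤ 0`.

*Lebesgue spaces.* Truncations of a nonnegative function are nonnegative, lie in all spaces `L^p`
and converge to it if `p < ∞`, and the cone of nonnegative functions is closed. So positivity passes
from a family to every family consistent with it (`IsPositiveFamily.of_consistent`).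
-/

set_option linter.unusedSectionVars false

namespace EllipticSystem

section Semigroup

variable {X : Type*} [NormedAddCommGroup X] [InnerProductSpace ℂ X] [CompleteSpace X]

/-! ### Bounded generators and the Yosida approximation -/

theorem exp_add_of_commute_clm {C D : X →L[ℂ] X} (h : Commute C D) :
    NormedSpace.exp (C + D) = NormedSpace.exp C * NormedSpace.exp D := by
  let _ : NormedAlgebra ℚ (X →L[ℂ] X) := NormedAlgebra.restrictScalars ℚ ℂ _
  exact NormedSpace.exp_add_of_commute h

theorem hasDerivAt_exp_smul_apply (C : X →L[ℂ] X) (f : X) (s : ℝ) :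
    HasDerivAt (fun s : ℝ => NormedSpace.exp ((s : ℂ) • C) f)
      (NormedSpace.exp ((s : ℂ) • C) (C f)) s := by
  have h1 : HasDerivAt (fun z : ℂ => NormedSpace.exp (z • C))
      (NormedSpace.exp ((s : ℂ) • C) * C) (s : ℂ) := hasDerivAt_exp_smul_const (𝕂 := ℂ) C (s : ℂ)
  have h2 := (ContinuousLinearMap.apply ℂ X f).hasFDerivAt.comp_hasDerivAt (s : ℂ) h1
  have h3 := h2.scomp s Complex.ofRealCLM.hasDerivAt
  simpa using! h3

/-- Two commuting bounded generators of contraction semigroups: the semigroups differ on a vector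
by at most the time times the difference of the generators on that vector. -/
theorem norm_exp_smul_sub_exp_smul_le {C D : X →L[ℂ] X} (hCD : Commute C D)
    (hC : ∀ t : ℝ, 0 ≤ t → ‖NormedSpace.exp ((t : ℂ) • C)‖ ≤ 1)
    (hD : ∀ t : ℝ, 0 ≤ t → ‖NormedSpace.exp ((t : ℂ) • D)‖ ≤ 1) {t : ℝ} (ht : 0 ≤ t) (f : X) :
    ‖NormedSpace.exp ((t : ℂ) • C) f - NormedSpace.exp ((t : ℂ) • D) f‖ ≤ t * ‖C f - D f‖ := by
  -- interpolate by `s ↦ exp (t D) exp (s (C - D)) f`, whose derivative is controlled on `[0, t]`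
  have hcomm : ∀ s : ℝ, NormedSpace.exp ((t : ℂ) • D) * NormedSpace.exp ((s : ℂ) • (C - D))
      = NormedSpace.exp ((s : ℂ) • C) * NormedSpace.exp (((t - s : ℝ) : ℂ) • D) := by
    intro s
    rw [← exp_add_of_commute_clm, ← exp_add_of_commute_clm]
    · congr 1
      push_cast
      module
    · exact (hCD.smul_left _).smul_right _
    · exact ((hCD.symm.sub_right (Commute.refl D)).smul_left _).smul_right _
  have hder : ∀ s : ℝ, HasDerivAt
      (fun s : ℝ => NormedSpace.exp ((t : ℂ) • D) (NormedSpace.exp ((s : ℂ) • (C - D)) f))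
      (NormedSpace.exp ((t : ℂ) • D) (NormedSpace.exp ((s : ℂ) • (C - D)) ((C - D) f))) s := by
    intro s
    exact ((NormedSpace.exp ((t : ℂ) • D)).hasFDerivAt.restrictScalars ℝ).comp_hasDerivAt s
      (hasDerivAt_exp_smul_apply (C - D) f s)
  have key := norm_image_sub_le_of_norm_deriv_le_segment' (a := 0) (b := t)
    (C := ‖C f - D f‖) (fun s _ => (hder s).hasDerivWithinAt) (fun s hs => by
      have : NormedSpace.exp ((t : ℂ) • D) (NormedSpace.exp ((s : ℂ) • (C - D)) ((C - D) f))
          = NormedSpace.exp ((s : ℂ) • C) (NormedSpace.exp (((t - s : ℝ) : ℂ) • D) ((C - D) f)) :=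
        congrArg (fun T : X →L[ℂ] X => T ((C - D) f)) (hcomm s)
      rw [this]
      refine (ContinuousLinearMap.le_of_opNorm_le _ (hC s hs.1) _).trans ?_
      rw [one_mul]
      refine (ContinuousLinearMap.le_of_opNorm_le _ (hD _ (by linarith [hs.2])) _).trans ?_
      simp) t ⟨ht, le_rfl⟩
  have e1 : NormedSpace.exp ((t : ℂ) • D) (NormedSpace.exp ((t : ℂ) • (C - D)) f)
      = NormedSpace.exp ((t : ℂ) • C) f := by
    have := congrArg (fun T : X →L[ℂ] X => T f) (hcomm t)
    simpa using this
  have e0 : NormedSpace.exp ((t : ℂ) • D) (NormedSpace.exp (((0 : ℝ) : ℂ) • (C - D)) f)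
      = NormedSpace.exp ((t : ℂ) • D) f := by simp
  rw [e1, e0] at key
  simpa [mul_comm] using key

theorem norm_exp_smul_sub_self_le {C : X →L[ℂ] X}
    (hC : ∀ t : ℝ, 0 ≤ t → ‖NormedSpace.exp ((t : ℂ) • C)‖ ≤ 1) {t : ℝ} (ht : 0 ≤ t) (f : X) :
    ‖NormedSpace.exp ((t : ℂ) • C) f - f‖ ≤ t * ‖C f‖ := by
  have := norm_exp_smul_sub_exp_smul_le (C := C) (D := 0) (Commute.zero_right C) hC
    (fun s _ => by
      simp only [smul_zero, NormedSpace.exp_zero]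
      exact ContinuousLinearMap.norm_id_le) ht f
  simpa using this

/-- First order expansion of a contractive exponential, with a remainder that survives the passage
to an unbounded limit of the generators: the vector `g` is to be taken close to `C f`. -/
theorem norm_exp_smul_sub_self_sub_le {C : X →L[ℂ] X}
    (hC : ∀ t : ℝ, 0 ≤ t → ‖NormedSpace.exp ((t : ℂ) • C)‖ ≤ 1) {t : ℝ} (ht : 0 ≤ t) (f g : X) :
    ‖NormedSpace.exp ((t : ℂ) • C) f - f - (t : ℂ) • C f‖
      ≤ t * (2 * ‖C f - g‖ + t * ‖C g‖) := by
  have hder : ∀ s : ℝ, HasDerivAt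
      (fun s : ℝ => NormedSpace.exp ((s : ℂ) • C) f - (s : ℂ) • C f)
      (NormedSpace.exp ((s : ℂ) • C) (C f) - C f) s := by
    intro s
    refine (hasDerivAt_exp_smul_apply C f s).sub ?_
    have := (Complex.ofRealCLM.hasDerivAt (x := s)).smul_const (C f)
    simpa using! this
  have key := norm_image_sub_le_of_norm_deriv_le_segment' (a := 0) (b := t)
    (C := 2 * ‖C f - g‖ + t * ‖C g‖) (fun s _ => (hder s).hasDerivWithinAt) (fun s hs => by
      have e : NormedSpace.exp ((s : ℂ) • C) (C f) - C f
          = NormedSpace.exp ((s : ℂ) • C) (C f - g) + (NormedSpace.exp ((s : ℂ) • C) g - g)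
            - (C f - g) := by
        rw [map_sub]; abel
      have h1 : ‖NormedSpace.exp ((s : ℂ) • C) (C f - g)‖ ≤ ‖C f - g‖ := by
        simpa using ContinuousLinearMap.le_of_opNorm_le _ (hC s hs.1) (C f - g)
      have h2 := norm_exp_smul_sub_self_le hC hs.1 g
      have h3 : s * ‖C g‖ ≤ t * ‖C g‖ := by
        have := hs.2.le
        gcongr
      rw [e]
      calc _ ≤ ‖NormedSpace.exp ((s : ℂ) • C) (C f - g)‖
            + ‖NormedSpace.exp ((s : ℂ) • C) g - g‖ + ‖C f - g‖ :=
            (norm_sub_le _ _).trans (by gcongr; exact norm_add_le _ _)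
        _ ≤ _ := by linarith) t ⟨ht, le_rfl⟩
  have e : NormedSpace.exp ((t : ℂ) • C) f - f - (t : ℂ) • C f
      = NormedSpace.exp ((t : ℂ) • C) f - (t : ℂ) • C f
        - (NormedSpace.exp (((0 : ℝ) : ℂ) • C) f - ((0 : ℝ) : ℂ) • C f) := by
    simp; abel
  rw [e]
  simpa [mul_comm] using key

theorem norm_exp_le_exp_norm (C : X →L[ℂ] X) : ‖NormedSpace.exp C‖ ≤ Real.exp ‖C‖ := by
  rw [NormedSpace.exp_eq_tsum ℂ, Real.exp_eq_exp_ℝ, NormedSpace.exp_eq_tsum ℝ]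
  have hs : Summable fun n : ℕ => ((n.factorial : ℝ))⁻¹ • ‖C‖ ^ n :=
    NormedSpace.expSeries_summable' (𝕂 := ℝ) ‖C‖
  refine tsum_of_norm_bounded hs.hasSum fun n => ?_
  rw [norm_smul, norm_inv, smul_eq_mul]
  have h1 : ‖(n.factorial : ℂ)‖ = n.factorial := by simp
  rw [h1]
  gcongr
  rcases n with _ | n
  · simpa using! (ContinuousLinearMap.norm_id_le (𝕜 := ℂ) (E := X))
  · exact norm_pow_le' C n.succ_pos

/-- `e^{t r (r R - 1)}` is a contraction when `‖R‖ ≤ 1 / r`. -/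
theorem norm_exp_yosida_le {R : X →L[ℂ] X} {r : ℝ} (hr : 0 < r) (hR : ‖R‖ ≤ r⁻¹) {t : ℝ}
    (ht : 0 ≤ t) :
    ‖NormedSpace.exp ((t : ℂ) • ((r : ℂ) • ((r : ℂ) • R - 1)))‖ ≤ 1 := by
  have e : (t : ℂ) • ((r : ℂ) • ((r : ℂ) • R - (1 : X →L[ℂ] X)))
      = ((t * r * r : ℝ) : ℂ) • R + (-(t * r : ℝ) : ℂ) • 1 := by
    push_cast
    module
  have h1 : NormedSpace.exp ((-(t * r : ℝ) : ℂ) • (1 : X →L[ℂ] X))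
      = (Complex.exp (-(t * r : ℝ) : ℂ)) • (1 : X →L[ℂ] X) := by
    have := NormedSpace.algebraMap_exp_comm (𝕂 := ℂ) (𝔸 := X →L[ℂ] X) (-(t * r : ℝ) : ℂ)
    rw [Algebra.algebraMap_eq_smul_one, Algebra.algebraMap_eq_smul_one] at this
    rw [← this, Complex.exp_eq_exp_ℂ]
  rw [e, exp_add_of_commute_clm ((Commute.one_right _).smul_right _), h1]
  rw [mul_smul_comm, mul_one, norm_smul, Complex.norm_exp]
  have h2 : ‖NormedSpace.exp (((t * r * r : ℝ) : ℂ) • R)‖ ≤ Real.exp (t * r) := by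
    refine (norm_exp_le_exp_norm _).trans (Real.exp_le_exp.mpr ?_)
    rw [norm_smul, Complex.norm_real, Real.norm_of_nonneg (by positivity)]
    calc t * r * r * ‖R‖ ≤ t * r * r * r⁻¹ := by gcongr
      _ = t * r := by field_simp
  calc _ ≤ Real.exp ((-(t * r : ℝ) : ℂ)).re * Real.exp (t * r) := by gcongr
    _ = 1 := by
      rw [← Real.exp_add]
      simp

/-- A closed convex cone preserved by `R` is preserved by `e^{t r (r R - 1)}`. -/
theorem exp_yosida_mem {R : X →L[ℂ] X} {r : ℝ} (hr : 0 < r) {K : Set X} (hK : IsClosed K)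
    (h0 : (0 : X) ∈ K) (hadd : ∀ f ∈ K, ∀ g ∈ K, f + g ∈ K)
    (hsmul : ∀ c : ℝ, 0 ≤ c → ∀ f ∈ K, (c : ℂ) • f ∈ K) (hRK : ∀ f ∈ K, R f ∈ K) {t : ℝ}
    (ht : 0 ≤ t) {f : X} (hf : f ∈ K) :
    NormedSpace.exp ((t : ℂ) • ((r : ℂ) • ((r : ℂ) • R - 1))) f ∈ K := by
  have e : (t : ℂ) • ((r : ℂ) • ((r : ℂ) • R - (1 : X →L[ℂ] X)))
      = ((t * r * r : ℝ) : ℂ) • R + (-(t * r : ℝ) : ℂ) • 1 := by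
    push_cast
    module
  have h1 : NormedSpace.exp ((-(t * r : ℝ) : ℂ) • (1 : X →L[ℂ] X))
      = ((Real.exp (-(t * r)) : ℝ) : ℂ) • (1 : X →L[ℂ] X) := by
    have := NormedSpace.algebraMap_exp_comm (𝕂 := ℂ) (𝔸 := X →L[ℂ] X) (-(t * r : ℝ) : ℂ)
    rw [Algebra.algebraMap_eq_smul_one, Algebra.algebraMap_eq_smul_one] at this
    rw [← this, ← Complex.exp_eq_exp_ℂ]
    push_cast
    rfl
  rw [e, exp_add_of_commute_clm ((Commute.one_right _).smul_right _), h1,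
    mul_smul_comm, mul_one]
  refine hsmul _ (Real.exp_pos _).le _ ?_
  have hpow : ∀ n : ℕ, (R ^ n) f ∈ K := by
    intro n
    induction n with
    | zero => simpa using hf
    | succ n ih =>
      rw [pow_succ']
      exact hRK _ ih
  have hsum := NormedSpace.exp_series_hasSum_exp' (𝕂 := ℂ) (((t * r * r : ℝ) : ℂ) • R)
  have hsum' := hsum.mapL (ContinuousLinearMap.apply ℂ X f)
  refine hK.mem_of_tendsto hsum' (Eventually.of_forall fun s => ?_)
  refine Finset.sum_induction _ (· ∈ K) (fun a b ha hb => hadd a ha b hb) h0 fun n _ => ?_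
  have : (ContinuousLinearMap.apply ℂ X f) ((n.factorial : ℂ)⁻¹ • (((t * r * r : ℝ) : ℂ) • R) ^ n)
      = (((n.factorial : ℝ)⁻¹ * (t * r * r) ^ n : ℝ) : ℂ) • (R ^ n) f := by
    simp [smul_pow, smul_smul]
  rw [this]
  exact hsmul _ (by positivity) _ (hpow n)

end Semigroup

section HilleYosida

variable {X : Type*} [NormedAddCommGroup X] [InnerProductSpace ℂ X] [CompleteSpace X]

/-! ### The Hille–Yosida theorem in a Hilbert space -/

/-- `R r` is the resolvent `(r - L)⁻¹` of the operator with graph `L`, for every real `r > κ`. -/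
def IsResolventOn (L : Set (X × X)) (κ : ℝ) (R : ℝ → X →L[ℂ] X) : Prop :=
  ∀ r > κ, ∀ f h, (f, h) ∈ L ↔ R r ((r : ℂ) • f - h) = f

/-- Strong convergence of an eventually bounded family of operators may be tested on a dense set. -/
theorem tendsto_apply_of_dense {Y Z ι : Type*} [NormedAddCommGroup Y] [NormedSpace ℂ Y]
    [NormedAddCommGroup Z] [NormedSpace ℂ Z] {l : Filter ι} {T : ι → Y →L[ℂ] Z} {U : Y →L[ℂ] Z}
    {C : ℝ} (hT : ∀ᶠ i in l, ‖T i‖ ≤ C) {D : Set Y} (hD : Dense D)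
    (h : ∀ f ∈ D, Tendsto (fun i => T i f) l (𝓝 (U f))) (f : Y) :
    Tendsto (fun i => T i f) l (𝓝 (U f)) := by
  rw [Metric.tendsto_nhds]
  intro ε hε
  have hC : 0 < |C| + ‖U‖ + 1 := by positivity
  obtain ⟨g, hg, hfg⟩ := Metric.dense_iff.1 hD f (ε / (2 * (|C| + ‖U‖ + 1))) (by positivity)
  rw [Metric.mem_ball, dist_comm, dist_eq_norm] at hg
  have h2 := (Metric.tendsto_nhds.1 (h g hfg)) (ε / 2) (by positivity)
  filter_upwards [hT, h2] with i hi hi2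
  rw [dist_eq_norm] at hi2 ⊢
  have e : T i f - U f = T i (f - g) - U (f - g) + (T i g - U g) := by
    simp only [map_sub]; abel
  have h3 : ‖T i (f - g)‖ ≤ |C| * ‖f - g‖ :=
    ContinuousLinearMap.le_of_opNorm_le _ (hi.trans (le_abs_self C)) _
  have h4 : ‖U (f - g)‖ ≤ ‖U‖ * ‖f - g‖ := U.le_opNorm _
  have h5 : (|C| + ‖U‖ + 1) * ‖f - g‖ < ε / 2 := by
    rw [lt_div_iff₀ (by positivity)] at hg
    linarith
  rw [e]
  calc _ ≤ ‖T i (f - g)‖ + ‖U (f - g)‖ + ‖T i g - U g‖ :=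
        (norm_add_le _ _).trans (by gcongr; exact norm_sub_le _ _)
    _ < ε := by nlinarith [norm_nonneg (f - g)]

namespace IsResolventOn

variable {L : Set (X × X)} {κ : ℝ} {R : ℝ → X →L[ℂ] X}

theorem mem (hR : IsResolventOn L κ R) {r : ℝ} (hr : κ < r) (k : X) :
    (R r k, (r : ℂ) • R r k - k) ∈ L := by
  rw [hR r hr]
  congr 1
  abel

theorem resolvent_identity (hR : IsResolventOn L κ R) {r s : ℝ} (hr : κ < r) (hs : κ < s)
    (k : X) : R r k = R s k + ((s : ℂ) - r) • R s (R r k) := by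
  have h := (hR s hs _ _).1 (hR.mem hr k)
  refine h.symm.trans ?_
  rw [← (R s).map_smul, ← (R s).map_add]
  congr 1
  module

theorem commute (hR : IsResolventOn L κ R) {r s : ℝ} (hr : κ < r) (hs : κ < s) :
    Commute (R r) (R s) := by
  by_cases hrs : r = s
  · rw [hrs]
  ext k
  change R r (R s k) = R s (R r k)
  have h1 := hR.resolvent_identity hr hs k
  have h2 := hR.resolvent_identity hs hr k
  have h3 : ((s : ℂ) - r) • (R r (R s k) - R s (R r k)) = 0 := by
    have : ((s : ℂ) - r) • (R r (R s k) - R s (R r k))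
      = -(((r : ℂ) - s) • R r (R s k)) - ((s : ℂ) - r) • R s (R r k) := by module
    rw [this, ← sub_eq_iff_eq_add'.2 h1, ← sub_eq_iff_eq_add'.2 h2]
    abel
  have h4 : (s : ℂ) - r ≠ 0 := by
    rw [sub_ne_zero]
    exact_mod_cast Ne.symm hrs
  exact sub_eq_zero.1 ((smul_eq_zero.1 h3).resolve_left h4)

end IsResolventOn

/-- The Yosida approximation `r (r R - 1)` of the operator whose resolvent at `r` is `R`. -/
def yosida (R : ℝ → X →L[ℂ] X) (r : ℝ) : X →L[ℂ] X :=
  (r : ℂ) • ((r : ℂ) • R r - 1)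

section Contraction

variable {L : Set (X × X)} {R : ℝ → X →L[ℂ] X}

theorem yosida_apply_of_mem (hR : IsResolventOn L 0 R) {r : ℝ} (hr : 0 < r) {f h : X}
    (hf : (f, h) ∈ L) : yosida R r f = (r : ℂ) • R r h := by
  have h1 := (hR r hr f h).1 hf
  rw [map_sub, map_smul] at h1
  change (r : ℂ) • ((r : ℂ) • R r f - f) = _
  congr 1
  rw [sub_eq_iff_eq_add] at h1 ⊢
  rw [h1]
  abel

theorem norm_smul_resolvent_le (hb : ∀ r > 0, ‖R r‖ ≤ r⁻¹) {r : ℝ} (hr : 0 < r) :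
    ‖(r : ℂ) • R r‖ ≤ 1 := by
  rw [norm_smul, Complex.norm_real, Real.norm_of_nonneg hr.le]
  calc r * ‖R r‖ ≤ r * r⁻¹ := by gcongr; exact hb r hr
    _ = 1 := mul_inv_cancel₀ hr.ne'

/-- `r R r` tends strongly to the identity: on the domain, `r R r g - g = R r (L g)` is of order
`1 / r`. -/
theorem tendsto_smul_resolvent (hR : IsResolventOn L 0 R) (hb : ∀ r > 0, ‖R r‖ ≤ r⁻¹)
    (hd : Dense (Prod.fst '' L)) (f : X) :
    Tendsto (fun r : ℝ => (r : ℂ) • R r f) atTop (𝓝 f) := by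
  have := tendsto_apply_of_dense (T := fun r : ℝ => (r : ℂ) • R r) (U := ContinuousLinearMap.id ℂ X)
    (l := atTop) (C := 1)
    (by filter_upwards [eventually_gt_atTop 0] with r hr using norm_smul_resolvent_le hb hr) hd ?_ f
  · simpa using this
  rintro _ ⟨⟨g, k⟩, hg, rfl⟩
  have h0 : Tendsto (fun r : ℝ => r⁻¹ * ‖k‖) atTop (𝓝 0) := by
    simpa using tendsto_inv_atTop_zero.mul_const ‖k‖
  rw [tendsto_iff_norm_sub_tendsto_zero]
  refine squeeze_zero' (Eventually.of_forall fun _ => norm_nonneg _) ?_ h0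
  filter_upwards [eventually_gt_atTop 0] with r hr
  have h1 := (hR r hr g k).1 hg
  have h2 : (r : ℂ) • R r g - g = R r k := by
    rw [map_sub, map_smul] at h1
    rw [sub_eq_iff_eq_add] at h1 ⊢
    rw [h1]; abel
  simp only [smul_apply, ContinuousLinearMap.id_apply, h2]
  exact ContinuousLinearMap.le_of_opNorm_le _ (hb r hr) _

theorem tendsto_yosida (hR : IsResolventOn L 0 R) (hb : ∀ r > 0, ‖R r‖ ≤ r⁻¹)
    (hd : Dense (Prod.fst '' L)) {f h : X} (hf : (f, h) ∈ L) :
    Tendsto (fun r : ℝ => yosida R r f) atTop (𝓝 h) := by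
  refine (tendsto_smul_resolvent hR hb hd h).congr' ?_
  filter_upwards [eventually_gt_atTop 0] with r hr
  rw [yosida_apply_of_mem hR hr hf]

theorem commute_yosida (hR : IsResolventOn L 0 R) {r s : ℝ} (hr : 0 < r) (hs : 0 < s) :
    Commute (yosida R r) (yosida R s) := by
  have := hR.commute hr hs
  unfold yosida
  refine Commute.smul_left (Commute.smul_right (Commute.sub_left (Commute.sub_right ?_ ?_) ?_) _) _
  · exact (this.smul_left _).smul_right _
  · exact Commute.one_right _
  · exact Commute.one_left _

/-- The exponentials of the Yosida approximations converge strongly: on the domain of `L` they form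
a Cauchy net because the approximations themselves converge there. -/
theorem exists_tendsto_exp_yosida (hR : IsResolventOn L 0 R) (hb : ∀ r > 0, ‖R r‖ ≤ r⁻¹)
    (hd : Dense (Prod.fst '' L)) (t : ℝ≥0) :
    ∃ S : X →L[ℂ] X, ∀ f, Tendsto
      (fun r : ℝ => NormedSpace.exp (((t : ℝ) : ℂ) • yosida R r) f) atTop (𝓝 (S f)) := by
  have hc : ∀ r : ℝ, 0 < r → ‖NormedSpace.exp (((t : ℝ) : ℂ) • yosida R r)‖ ≤ 1 :=
    fun r hr => norm_exp_yosida_le hr (hb r hr) t.2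
  have hcauchy : ∀ f, CauchySeq
      (fun r : ℝ => NormedSpace.exp (((t : ℝ) : ℂ) • yosida R r) f) := by
    intro f
    rw [cauchySeq_iff_tendsto_dist_atTop_0]
    simp_rw [dist_eq_norm]
    have hev : ∀ᶠ p : ℝ × ℝ in atTop, 0 < p.1 ∧ 0 < p.2 := by
      rw [← prod_atTop_atTop_eq]
      exact (eventually_gt_atTop 0).prod_mk (eventually_gt_atTop 0)
    have := tendsto_apply_of_dense (l := (atTop : Filter (ℝ × ℝ))) (C := 2) (U := 0)
      (T := fun p => NormedSpace.exp (((t : ℝ) : ℂ) • yosida R p.1)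
        - NormedSpace.exp (((t : ℝ) : ℂ) • yosida R p.2))
      (by
        filter_upwards [hev] with p hp
        exact (norm_sub_le _ _).trans (by linarith [hc _ hp.1, hc _ hp.2])) hd ?_ f
    · simpa using this.norm
    rintro _ ⟨⟨g, k⟩, hg, rfl⟩
    have h1 := (cauchySeq_iff_tendsto_dist_atTop_0.1
      (tendsto_yosida hR hb hd hg).cauchySeq).const_mul (t : ℝ)
    rw [mul_zero] at h1
    simp_rw [dist_eq_norm] at h1
    refine squeeze_zero_norm' ?_ h1
    filter_upwards [hev] with p hp
    exact norm_exp_smul_sub_exp_smul_le (commute_yosida hR hp.1 hp.2)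
      (fun s hs => norm_exp_yosida_le hp.1 (hb _ hp.1) hs)
      (fun s hs => norm_exp_yosida_le hp.2 (hb _ hp.2) hs) t.2 g
  choose S hS using fun f => cauchySeq_tendsto_of_complete (hcauchy f)
  let S' : X →ₗ[ℂ] X :=
    { toFun := S
      map_add' := fun f g => tendsto_nhds_unique (hS (f + g))
        (by simpa only [map_add] using (hS f).add (hS g))
      map_smul' := fun c f => tendsto_nhds_unique (hS (c • f))
        (by simpa only [map_smul, RingHom.id_apply] using (hS f).const_smul c) }
  refine ⟨S'.mkContinuous 1 fun f => ?_, fun f => hS f⟩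
  refine le_of_tendsto (hS f).norm ?_
  filter_upwards [eventually_gt_atTop 0] with r hr
  exact ContinuousLinearMap.le_of_opNorm_le _ (hc r hr) f

/-- The Hille–Yosida theorem for contractions. The semigroup is the strong limit of the exponentials
of the Yosida approximations, hence preserves the closed convex cones preserved by the resolvent. -/
theorem exists_contraction_semigroup (hR : IsResolventOn L 0 R) (hb : ∀ r > 0, ‖R r‖ ≤ r⁻¹)
    (hd : Dense (Prod.fst '' L)) :
    ∃ S : ℝ≥0 → X →L[ℂ] X, IsGeneratedBy S L ∧ (∀ t, ‖S t‖ ≤ 1) ∧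
      ∀ K : Set X, IsClosed K → (0 : X) ∈ K → (∀ f ∈ K, ∀ g ∈ K, f + g ∈ K) →
        (∀ c : ℝ, 0 ≤ c → ∀ f ∈ K, (c : ℂ) • f ∈ K) → (∀ r > 0, ∀ f ∈ K, R r f ∈ K) →
        ∀ t, ∀ f ∈ K, S t f ∈ K := by
  choose S hS using exists_tendsto_exp_yosida hR hb hd
  have hc : ∀ r : ℝ, 0 < r → ∀ t : ℝ, 0 ≤ t → ‖NormedSpace.exp ((t : ℂ) • yosida R r)‖ ≤ 1 :=
    fun r hr t ht => norm_exp_yosida_le hr (hb r hr) ht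
  have hpos : ∀ᶠ r : ℝ in atTop, 0 < r := eventually_gt_atTop 0
  have hS1f : ∀ t f, ‖S t f‖ ≤ ‖f‖ := by
    intro t f
    refine le_of_tendsto (hS t f).norm ?_
    filter_upwards [hpos] with r hr
    simpa using ContinuousLinearMap.le_of_opNorm_le _ (hc r hr t t.2) f
  have hS1 : ∀ t, ‖S t‖ ≤ 1 := fun t =>
    ContinuousLinearMap.opNorm_le_bound _ zero_le_one fun f => by simpa using hS1f t f
  -- the first order expansion of the exponentials passes to the limit for `f` in the domain; the
  -- vector `g` of the domain approximates `L f`, which need not belong to it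
  have hexp : ∀ {f h g k : X}, (f, h) ∈ L → (g, k) ∈ L → ∀ t : ℝ≥0,
      ‖S t f - f - ((t : ℝ) : ℂ) • h‖ ≤ t * (2 * ‖h - g‖ + t * ‖k‖) := by
    intro f h g k hf hg t
    have hA := tendsto_yosida hR hb hd hf
    have hB := tendsto_yosida hR hb hd hg
    have l1 := (((hS t f).sub_const f).sub (hA.const_smul ((t : ℝ) : ℂ))).norm
    have l2 := (((hA.sub_const g).norm.const_mul 2).add
      (hB.norm.const_mul (t : ℝ))).const_mul (t : ℝ)
    refine le_of_tendsto_of_tendsto l1 l2 ?_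
    filter_upwards [hpos] with r hr
    exact norm_exp_smul_sub_self_sub_le (hc r hr) t.2 f g
  have hC0 : IsC0Semigroup S := by
    refine ⟨?_, ?_, ?_⟩
    · ext f
      refine tendsto_nhds_unique (hS 0 f) ?_
      simp
    · intro s t
      ext f
      refine tendsto_nhds_unique (hS (s + t) f) ?_
      have h1 : ∀ r, NormedSpace.exp ((((s + t : ℝ≥0) : ℝ) : ℂ) • yosida R r) f
          = NormedSpace.exp (((s : ℝ) : ℂ) • yosida R r)
            (NormedSpace.exp (((t : ℝ) : ℂ) • yosida R r) f) := by
        intro r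
        have e : (((s + t : ℝ≥0) : ℝ) : ℂ) • yosida R r
            = ((s : ℝ) : ℂ) • yosida R r + ((t : ℝ) : ℂ) • yosida R r := by
          rw [← add_smul]; push_cast; rfl
        rw [e, exp_add_of_commute_clm (((Commute.refl _).smul_left _).smul_right _)]
        rfl
      have h2 : Tendsto (fun r : ℝ => NormedSpace.exp (((s : ℝ) : ℂ) • yosida R r)
          (NormedSpace.exp (((t : ℝ) : ℂ) • yosida R r) f - S t f)) atTop (𝓝 0) := by
        have h3 := ((hS t f).sub_const (S t f)).norm
        rw [sub_self, norm_zero] at h3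
        refine squeeze_zero_norm' ?_ h3
        filter_upwards [hpos] with r hr
        simpa using ContinuousLinearMap.le_of_opNorm_le _ (hc r hr s s.2)
          (NormedSpace.exp (((t : ℝ) : ℂ) • yosida R r) f - S t f)
      have h4 := h2.add (hS s (S t f))
      rw [zero_add] at h4
      refine h4.congr fun r => ?_
      rw [h1 r, map_sub, sub_add_cancel]
    · have h0 : Tendsto (fun t : ℝ≥0 => (t : ℝ)) (𝓝 0) (𝓝 0) :=
        NNReal.continuous_coe.tendsto 0
      refine tendsto_apply_of_dense (U := ContinuousLinearMap.id ℂ X)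
        (Eventually.of_forall hS1) hd ?_
      rintro _ ⟨⟨f, h⟩, hf, rfl⟩
      have h1 := h0.mul_const ‖h‖
      rw [zero_mul] at h1
      rw [tendsto_iff_norm_sub_tendsto_zero]
      refine squeeze_zero (fun _ => norm_nonneg _) (fun t => ?_) h1
      refine le_of_tendsto_of_tendsto ((hS t f).sub_const f).norm
        ((tendsto_yosida hR hb hd hf).norm.const_mul (t : ℝ)) ?_
      filter_upwards [hpos] with r hr
      exact norm_exp_smul_sub_self_le (hc r hr) t.2 f
  have hsub : L ⊆ generatorGraph S := by
    rintro ⟨f, h⟩ hf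
    change Tendsto _ _ _
    rw [Metric.tendsto_nhds]
    intro ε hε
    obtain ⟨_, hg, ⟨⟨g, k⟩, hgk, rfl⟩⟩ := Metric.dense_iff.1 hd h (ε / 4) (by positivity)
    rw [Metric.mem_ball, dist_comm, dist_eq_norm] at hg
    have h0 : Tendsto (fun t : ℝ≥0 => (t : ℝ) * ‖k‖) (𝓝[>] 0) (𝓝 0) := by
      have : Tendsto (fun t : ℝ≥0 => (t : ℝ) * ‖k‖) (𝓝 0) (𝓝 (((0 : ℝ≥0) : ℝ) * ‖k‖)) :=
        (NNReal.continuous_coe.tendsto 0).mul_const _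
      rw [NNReal.coe_zero, zero_mul] at this
      exact this.mono_left nhdsWithin_le_nhds
    filter_upwards [h0.eventually_lt_const (show (0 : ℝ) < ε / 2 by positivity),
      self_mem_nhdsWithin] with t ht1 ht2
    have ht : (0 : ℝ) < t := by exact_mod_cast ht2
    have e : ((t : ℝ)⁻¹ : ℂ) • (S t f - f) - h
        = ((t : ℝ)⁻¹ : ℂ) • (S t f - f - ((t : ℝ) : ℂ) • h) := by
      have : ((t : ℝ) : ℂ) ≠ 0 := by exact_mod_cast ht.ne'
      rw [smul_sub _ (S t f - f), smul_smul, inv_mul_cancel₀ this, one_smul]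
    rw [dist_eq_norm]
    change ‖((t : ℝ)⁻¹ : ℂ) • (S t f - f) - h‖ < ε
    rw [e, norm_smul, norm_inv, Complex.norm_real, Real.norm_of_nonneg ht.le, inv_mul_lt_iff₀ ht]
    refine (hexp hf hgk t).trans_lt ?_
    gcongr
    simp only at hg
    linarith
  refine ⟨S, ⟨hC0, Set.Subset.antisymm ?_ hsub⟩, hS1, ?_⟩
  -- the generator is dissipative and extends `L`, whose range under `1 - L` is everything, so the
  -- two operators coincide
  · rintro ⟨f, h⟩ hf
    have hm := hR.mem one_pos (f - h)
    set f' := R 1 (f - h) with hf'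
    have hu : ((f - f', f - f') : X × X) ∈ generatorGraph S := by
      have h1 : Tendsto _ _ _ := hf
      have h2 : Tendsto _ _ _ := hsub hm
      have h3 := h1.sub h2
      have e : h - (((1 : ℝ) : ℂ) • f' - (f - h)) = f - f' := by
        rw [Complex.ofReal_one, one_smul]; abel
      simp only [e] at h3
      refine h3.congr fun t => ?_
      simp only [map_sub]
      module
    have hlim : Tendsto _ _ _ := hu
    have h5 := ((innerSL ℂ (f - f')).continuous.tendsto _).comp hlim
    have h6 := (Complex.continuous_re.tendsto _).comp h5
    have h7 : (inner ℂ (f - f') (f - f')).re ≤ 0 := by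
      refine le_of_tendsto h6 ?_
      filter_upwards [self_mem_nhdsWithin] with t ht
      have ht : (0 : ℝ) < t := by exact_mod_cast ht
      change (inner ℂ (f - f') (((t : ℝ)⁻¹ : ℂ) • (S t (f - f') - (f - f')))).re ≤ 0
      rw [inner_smul_right, inner_sub_right, ← Complex.ofReal_inv, Complex.re_ofReal_mul,
        Complex.sub_re]
      refine mul_nonpos_of_nonneg_of_nonpos (by positivity) ?_
      have h8 : (inner ℂ (f - f') (S t (f - f'))).re ≤ ‖f - f'‖ * ‖f - f'‖ :=
        (Complex.re_le_norm _).trans ((norm_inner_le_norm _ _).trans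
          (by gcongr; exact hS1f t _))
      have h9 : (inner ℂ (f - f') (f - f')).re = ‖f - f'‖ * ‖f - f'‖ :=
        (inner_self_eq_norm_mul_norm (𝕜 := ℂ) (f - f'))
      linarith
    have h10 : f - f' = 0 := by
      have h9 : (inner ℂ (f - f') (f - f')).re = ‖f - f'‖ * ‖f - f'‖ :=
        inner_self_eq_norm_mul_norm (𝕜 := ℂ) (f - f')
      rw [h9] at h7
      exact norm_eq_zero.1 (mul_self_eq_zero.1 (le_antisymm h7 (mul_self_nonneg _)))
    rw [sub_eq_zero] at h10
    rw [hR 1 one_pos, Complex.ofReal_one, one_smul]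
    exact h10.symm
  · intro K hK h0 hadd hsmul hRK t f hf
    refine hK.mem_of_tendsto (hS t f) ?_
    filter_upwards [hpos] with r hr
    exact exp_yosida_mem hr hK h0 hadd hsmul (hRK r hr) t.2 hf

end Contraction

/-- Rescaling a semigroup by `e^{c t}` shifts its generator by `c`. -/
theorem generatorGraph_exp_smul_subset (S : ℝ≥0 → X →L[ℂ] X) (hS : IsC0Semigroup S) (c : ℝ)
    {f h : X} (hf : (f, h) ∈ generatorGraph S) :
    (f, h + (c : ℂ) • f) ∈ generatorGraph fun t : ℝ≥0 => ((Real.exp (c * t) : ℝ) : ℂ) • S t := by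
  change Tendsto _ _ _
  have h1 : Tendsto _ _ _ := hf
  have h0 : Tendsto (fun t : ℝ≥0 => (t : ℝ)) (𝓝[>] 0) (𝓝[≠] 0) := by
    refine tendsto_nhdsWithin_iff.2 ⟨?_, ?_⟩
    · exact (NNReal.continuous_coe.tendsto 0).mono_left nhdsWithin_le_nhds
    · filter_upwards [self_mem_nhdsWithin] with t ht
      exact_mod_cast ne_of_gt ht
  have hd : HasDerivAt (fun t : ℝ => Real.exp (c * t)) c 0 := by
    have := ((hasDerivAt_id (0 : ℝ)).const_mul c).exp
    simpa using this
  have h2 := (hasDerivAt_iff_tendsto_slope.1 hd).comp h0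
  have h3 : Tendsto (fun t : ℝ≥0 => S t f) (𝓝[>] 0) (𝓝 f) :=
    (hS.tendsto_zero f).mono_left nhdsWithin_le_nhds
  have h4 := h1.add (((Complex.continuous_ofReal.tendsto _).comp h2).smul h3)
  have h5 : Tendsto (fun t : ℝ≥0 => ((t : ℝ)⁻¹ : ℂ) • (S t f - f) +
      ((slope (fun t : ℝ => Real.exp (c * t)) 0 t : ℝ) : ℂ) • S t f) (𝓝[>] 0)
      (𝓝 (h + (c : ℂ) • f)) := h4
  refine h5.congr fun t => ?_
  rw [slope_def_field]
  simp only [smul_apply, mul_zero, Real.exp_zero, sub_zero]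
  push_cast
  rw [div_eq_inv_mul, mul_smul, ← smul_add]
  congr 1
  module

theorem isC0Semigroup_exp_smul (S : ℝ≥0 → X →L[ℂ] X) (hS : IsC0Semigroup S) (c : ℝ) :
    IsC0Semigroup fun t : ℝ≥0 => ((Real.exp (c * t) : ℝ) : ℂ) • S t := by
  refine ⟨?_, fun s t => ?_, fun f => ?_⟩
  · simp [hS.map_zero]
  · ext f
    simp only [hS.map_add, NNReal.coe_add, mul_add, Real.exp_add]
    simp [smul_smul, mul_comm]
  · have h1 : Tendsto (fun t : ℝ≥0 => ((Real.exp (c * t) : ℝ) : ℂ)) (𝓝 0)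
        (𝓝 ((Real.exp (c * (0 : ℝ≥0)) : ℝ) : ℂ)) :=
      Continuous.tendsto (by fun_prop) 0
    have h2 := h1.smul (hS.tendsto_zero f)
    simpa using h2

/-- The Hille–Yosida theorem for quasi-contractions, together with the invariance of closed convex
cones that are invariant under the resolvent. -/
theorem exists_semigroup_of_resolvent {L : Set (X × X)} {κ : ℝ} {R : ℝ → X →L[ℂ] X}
    (hR : IsResolventOn L κ R) (hb : ∀ r > κ, ‖R r‖ ≤ (r - κ)⁻¹) (hd : Dense (Prod.fst '' L)) :
    ∃ S : ℝ≥0 → X →L[ℂ] X, IsGeneratedBy S L ∧ (∀ t, ‖S t‖ ≤ Real.exp (κ * t)) ∧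
      ∀ K : Set X, IsClosed K → (0 : X) ∈ K → (∀ f ∈ K, ∀ g ∈ K, f + g ∈ K) →
        (∀ c : ℝ, 0 ≤ c → ∀ f ∈ K, (c : ℂ) • f ∈ K) → (∀ r > κ, ∀ f ∈ K, R r f ∈ K) →
        ∀ t, ∀ f ∈ K, S t f ∈ K := by
  let L' : Set (X × X) := {p | (p.1, p.2 + (κ : ℂ) • p.1) ∈ L}
  have hR' : IsResolventOn L' 0 fun r => R (r + κ) := by
    intro r hr f h
    change (f, h + (κ : ℂ) • f) ∈ L ↔ _
    rw [hR (r + κ) (by linarith)]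
    have : ((r + κ : ℝ) : ℂ) • f - (h + (κ : ℂ) • f) = (r : ℂ) • f - h := by
      push_cast
      module
    rw [this]
  have hb' : ∀ r > 0, ‖R (r + κ)‖ ≤ r⁻¹ := fun r hr => by
    simpa using hb (r + κ) (by linarith)
  have hd' : Dense (Prod.fst '' L') := by
    refine hd.mono ?_
    rintro _ ⟨⟨f, h⟩, hf, rfl⟩
    refine ⟨(f, h - (κ : ℂ) • f), ?_, rfl⟩
    change (f, h - (κ : ℂ) • f + (κ : ℂ) • f) ∈ L
    rwa [sub_add_cancel]
  obtain ⟨S, ⟨hS, hgen⟩, hS1, hK⟩ := exists_contraction_semigroup hR' hb' hd'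
  have hT := isC0Semigroup_exp_smul S hS κ
  refine ⟨fun t => ((Real.exp (κ * t) : ℝ) : ℂ) • S t, ⟨hT, ?_⟩, fun t => ?_, ?_⟩
  · ext ⟨f, h⟩
    constructor
    · intro hf
      have h1 := generatorGraph_exp_smul_subset _ hT (-κ) hf
      have h2 : (fun t : ℝ≥0 => ((Real.exp (-κ * t) : ℝ) : ℂ) •
          (((Real.exp (κ * t) : ℝ) : ℂ) • S t)) = S := by
        ext t : 1
        rw [smul_smul, ← Complex.ofReal_mul, ← Real.exp_add]
        simp
      rw [h2, hgen] at h1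
      have h3 : (f, h + ((-κ : ℝ) : ℂ) • f + (κ : ℂ) • f) ∈ L := h1
      have h4 : h + ((-κ : ℝ) : ℂ) • f + (κ : ℂ) • f = h := by
        push_cast
        module
      rwa [h4] at h3
    · intro hf
      have h1 : (f, h - (κ : ℂ) • f) ∈ generatorGraph S := by
        rw [hgen]
        change (f, h - (κ : ℂ) • f + (κ : ℂ) • f) ∈ L
        rwa [sub_add_cancel]
      have h2 := generatorGraph_exp_smul_subset S hS κ h1
      rwa [sub_add_cancel] at h2
  · rw [norm_smul, Complex.norm_real, Real.norm_of_nonneg (Real.exp_pos _).le]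
    exact mul_le_of_le_one_right (Real.exp_pos _).le (hS1 t)
  · intro K hKc h0 hadd hsmul hRK t f hf
    exact hsmul _ (Real.exp_pos _).le _
      (hK K hKc h0 hadd hsmul (fun r hr => hRK _ (by linarith)) t f hf)

end HilleYosida

section Orbits

variable {X : Type*} [NormedAddCommGroup X] [InnerProductSpace ℂ X] [CompleteSpace X]

/-! ### Orbits and uniqueness of the generated semigroup -/

namespace IsC0Semigroup

variable {S : ℝ≥0 → X →L[ℂ] X}

/-- A `C₀`-semigroup is bounded near `0`, by the uniform boundedness principle. -/
theorem exists_bound_near_zero (hS : IsC0Semigroup S) :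
    ∃ δ : ℝ≥0, 0 < δ ∧ ∃ M : ℝ, 1 ≤ M ∧ ∀ t ≤ δ, ‖S t‖ ≤ M := by
  by_contra! hcon
  have h1 : ∀ n : ℕ, ∃ t : ℝ≥0, t ≤ 1 / ((n : ℝ≥0) + 1) ∧ (n : ℝ) + 1 < ‖S t‖ := fun n =>
    hcon _ (by positivity) _ (by linarith [n.cast_nonneg (α := ℝ)])
  choose t ht1 ht2 using h1
  have ht : Tendsto t atTop (𝓝 0) :=
    tendsto_of_tendsto_of_tendsto_of_le_of_le tendsto_const_nhds
      tendsto_one_div_add_atTop_nhds_zero_nat (fun _ => zero_le) ht1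
  obtain ⟨C, hC⟩ := banach_steinhaus (g := fun n => S (t n)) fun f => by
    obtain ⟨C, hC⟩ := ((hS.tendsto_zero f).comp ht).norm.bddAbove_range
    exact ⟨C, fun n => hC ⟨n, rfl⟩⟩
  obtain ⟨n, hn⟩ := exists_nat_gt C
  linarith [hC n, ht2 n]

theorem exists_bound (hS : IsC0Semigroup S) (T : ℝ≥0) : ∃ M : ℝ, ∀ t ≤ T, ‖S t‖ ≤ M := by
  obtain ⟨δ, hδ, M, hM1, hM⟩ := hS.exists_bound_near_zero
  have key : ∀ n : ℕ, ∀ t : ℝ≥0, t ≤ n * δ → ‖S t‖ ≤ M ^ (n + 1) := by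
    intro n
    induction n with
    | zero =>
      intro t ht
      simp only [Nat.cast_zero, zero_mul, nonpos_iff_eq_zero] at ht
      simpa [ht] using hM 0 zero_le
    | succ n ih =>
      intro t ht
      rcases le_total t δ with h | h
      · exact (hM t h).trans (le_self_pow₀ hM1 (by omega))
      · have e : t = δ + (t - δ) := (add_tsub_cancel_of_le h).symm
        rw [e, hS.map_add, pow_succ' M (n + 1)]
        refine (ContinuousLinearMap.opNorm_comp_le _ _).trans ?_
        gcongr
        · exact hM δ le_rfl
        · refine ih _ ?_
          rw [tsub_le_iff_right]
          refine ht.trans (le_of_eq ?_)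
          push_cast
          ring
  obtain ⟨n, hn⟩ := exists_nat_ge (T / δ)
  exact ⟨M ^ (n + 1), fun t ht => key n t (ht.trans ((div_le_iff₀ hδ).1 hn))⟩

theorem continuous_apply (hS : IsC0Semigroup S) (f : X) : Continuous fun t => S t f := by
  rw [continuous_iff_continuousAt]
  intro t
  obtain ⟨M, hM⟩ := hS.exists_bound (t + 1)
  have hle : ∀ s r : ℝ≥0, s ≤ r → s ≤ t + 1 → ‖S r f - S s f‖ ≤ M * ‖S (nndist s r) f - f‖ := by
    intro s r hsr hs
    have e1 : nndist s r = r - s := by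
      rw [NNReal.nndist_eq, tsub_eq_zero_of_le hsr]
      simp
    have e2 : S r f = S s (S (r - s) f) := by
      rw [← ContinuousLinearMap.comp_apply, ← hS.map_add, add_tsub_cancel_of_le hsr]
    rw [e1, e2, ← map_sub]
    exact ContinuousLinearMap.le_of_opNorm_le _ (hM s hs) _
  have h1 : Tendsto (fun s : ℝ≥0 => nndist s t) (𝓝 t) (𝓝 0) := by
    simpa using (Continuous.tendsto (by fun_prop : Continuous fun s : ℝ≥0 => nndist s t) t)
  have h2 := ((((hS.tendsto_zero f).comp h1).sub_const f).norm).const_mul M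
  rw [sub_self, norm_zero, mul_zero] at h2
  rw [ContinuousAt, tendsto_iff_norm_sub_tendsto_zero]
  refine squeeze_zero' (Eventually.of_forall fun _ => norm_nonneg _) ?_ h2
  have h3 : ∀ᶠ s in 𝓝 t, s ≤ t + 1 := eventually_le_nhds (lt_add_one t)
  filter_upwards [h3] with s hs
  rcases le_total s t with h | h
  · rw [norm_sub_rev]
    exact hle s t h hs
  · have := hle t s h (by simp)
    rwa [nndist_comm] at this

theorem commute (hS : IsC0Semigroup S) (s t : ℝ≥0) (f : X) : S s (S t f) = S t (S s f) := by
  rw [← ContinuousLinearMap.comp_apply, ← hS.map_add, add_comm, hS.map_add,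
    ContinuousLinearMap.comp_apply]

theorem map_generator (hS : IsC0Semigroup S) {f h : X} (hf : (f, h) ∈ generatorGraph S)
    (t : ℝ≥0) : (S t f, S t h) ∈ generatorGraph S := by
  have h1 : Tendsto _ _ _ := hf
  refine (((S t).continuous.tendsto _).comp h1).congr fun s => ?_
  simp only [Function.comp_apply, map_smul, map_sub, hS.commute t s]

theorem hasDerivWithinAt_orbit (hS : IsC0Semigroup S) {f h : X}
    (hf : (f, h) ∈ generatorGraph S) {t : ℝ} (ht : 0 ≤ t) :
    HasDerivWithinAt (fun s : ℝ => S s.toNNReal f) (S t.toNNReal h) (Set.Ici t) t := by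
  rw [← hasDerivWithinAt_Ioi_iff_Ici, hasDerivWithinAt_iff_tendsto_slope' (by simp)]
  have hmap : Tendsto (fun s : ℝ => (s - t).toNNReal) (𝓝[>] t) (𝓝[>] 0) := by
    refine tendsto_nhdsWithin_iff.2 ⟨?_, ?_⟩
    · have : Continuous fun s : ℝ => (s - t).toNNReal := by fun_prop
      have h2 := (this.tendsto t).mono_left (nhdsWithin_le_nhds (s := Set.Ioi t))
      simpa using h2
    · filter_upwards [self_mem_nhdsWithin] with s hs
      exact Real.toNNReal_pos.2 (sub_pos.2 hs)
  have h1 : Tendsto _ _ _ := hf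
  refine (((S t.toNNReal).continuous.tendsto _).comp (h1.comp hmap)).congr' ?_
  filter_upwards [self_mem_nhdsWithin] with s hs
  have hs' : t < s := hs
  have e : s.toNNReal = t.toNNReal + (s - t).toNNReal := by
    rw [← Real.toNNReal_add ht (sub_nonneg.2 hs'.le)]
    congr 1
    ring
  simp only [Function.comp_apply, slope_def_module, e, hS.map_add, ContinuousLinearMap.comp_apply,
    map_smul, map_sub]
  rw [Real.coe_toNNReal _ (sub_nonneg.2 hs'.le), ← Complex.ofReal_inv, Complex.coe_smul]

end IsC0Semigroup

theorem generatorGraph_sub {S : ℝ≥0 → X →L[ℂ] X} {f h g k : X}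
    (hf : (f, h) ∈ generatorGraph S) (hg : (g, k) ∈ generatorGraph S) :
    (f - g, h - k) ∈ generatorGraph S := by
  have h1 : Tendsto _ _ _ := hf
  have h2 : Tendsto _ _ _ := hg
  refine (h1.sub h2).congr fun t => ?_
  simp only [map_sub]
  module

/-- A densely defined operator `L` with `Re ⟨f, L f⟩ ≤ κ ‖f‖²` generates at most one semigroup:
the squared norm of the difference of two orbits satisfies Grönwall's differential inequality. -/
theorem IsGeneratedBy.unique {L : Set (X × X)} {κ : ℝ}
    (hL : ∀ p ∈ L, (inner ℂ p.1 p.2).re ≤ κ * ‖p.1‖ ^ 2) (hd : Dense (Prod.fst '' L))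
    {S T : ℝ≥0 → X →L[ℂ] X} (hS : IsGeneratedBy S L) (hT : IsGeneratedBy T L) : S = T := by
  ext t : 1
  refine ContinuousLinearMap.ext_on (s := Prod.fst '' L)
    (hd.mono Submodule.subset_span) ?_
  rintro _ ⟨⟨f, h⟩, hf, rfl⟩
  have hfS : (f, h) ∈ generatorGraph S := hS.2 ▸ hf
  have hfT : (f, h) ∈ generatorGraph T := hT.2 ▸ hf
  set w : ℝ → X := fun s => S s.toNNReal f - T s.toNNReal f with hw
  have hwd : ∀ s : ℝ, 0 ≤ s →
      HasDerivWithinAt w (S s.toNNReal h - T s.toNNReal h) (Set.Ici s) s := fun s hs =>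
    (hS.1.hasDerivWithinAt_orbit hfS hs).sub (hT.1.hasDerivWithinAt_orbit hfT hs)
  have hwc : Continuous w := ((hS.1.continuous_apply f).comp continuous_real_toNNReal).sub
    ((hT.1.continuous_apply f).comp continuous_real_toNNReal)
  have hmem : ∀ s : ℝ, (w s, S s.toNNReal h - T s.toNNReal h) ∈ L := by
    intro s
    have h1 : (S s.toNNReal f, S s.toNNReal h) ∈ L := hS.2 ▸ hS.1.map_generator hfS _
    have h2 : (T s.toNNReal f, T s.toNNReal h) ∈ L := hT.2 ▸ hT.1.map_generator hfT _
    rw [← hS.2] at h1 h2 ⊢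
    exact generatorGraph_sub h1 h2
  have hsq : ∀ x : X, (inner ℂ x x).re = ‖x‖ ^ 2 := fun x => by
    simpa using inner_self_eq_norm_sq (𝕜 := ℂ) x
  have hder : ∀ s : ℝ, 0 ≤ s → HasDerivWithinAt (fun s => ‖w s‖ ^ 2)
      (2 * (inner ℂ (w s) (S s.toNNReal h - T s.toNNReal h)).re) (Set.Ici s) s := by
    intro s hs
    have h1 := (hwd s hs).inner ℂ (hwd s hs)
    have h2 := Complex.reCLM.hasFDerivAt.comp_hasDerivWithinAt s h1
    have h3 : HasDerivWithinAt (fun s => (inner ℂ (w s) (w s)).re) _ (Set.Ici s) s := h2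
    simp_rw [hsq] at h3
    refine h3.congr_deriv ?_
    rw [Complex.reCLM_apply, Complex.add_re, ← inner_conj_symm (S s.toNNReal h - _) (w s),
      Complex.conj_re]
    ring
  have key := le_gronwallBound_of_liminf_deriv_right_le (f := fun s => ‖w s‖ ^ 2) (δ := 0)
    (K := 2 * κ) (ε := 0) (a := 0) (b := (t : ℝ)) (hwc.norm.pow 2).continuousOn
    (fun s hs r hr => (hder s hs.1).liminf_right_slope_le hr)
    (by simp [hw, hS.1.map_zero, hT.1.map_zero])
    (fun s hs => by
      have := hL _ (hmem s)
      simp only at this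
      linarith) t ⟨t.2, le_rfl⟩
  rw [gronwallBound_ε0_δ0] at key
  have h0 : w t = 0 := by
    have : ‖w t‖ ^ 2 = 0 := le_antisymm key (by positivity)
    simpa using this
  rw [hw] at h0
  simp only [Real.toNNReal_coe] at h0
  exact sub_eq_zero.1 h0

/-- Positivity of the matrix coefficient `⟨g, S t f⟩` of the semigroup passes to the resolvent. With
`u = R r f` the function `e^{-rt} Re ⟨g, S t u⟩` decreases to `0`, so it is nonnegative at `0`; this
replaces the Laplace transform. -/
theorem re_inner_resolvent_nonneg {L : Set (X × X)} {κ : ℝ} {R : ℝ → X →L[ℂ] X}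
    (hR : IsResolventOn L κ R) {S : ℝ≥0 → X →L[ℂ] X} (hS : IsGeneratedBy S L)
    (hb : ∀ t, ‖S t‖ ≤ Real.exp (κ * t)) {f g : X} (hfg : ∀ t, 0 ≤ (inner ℂ g (S t f)).re)
    {r : ℝ} (hr : κ < r) : 0 ≤ (inner ℂ g (R r f)).re := by
  set u := R r f with hu
  have hmem : (u, (r : ℂ) • u - f) ∈ generatorGraph S := hS.2 ▸ hR.mem hr f
  set φ : ℝ → ℝ := fun s => Real.exp (-r * s) * (inner ℂ g (S s.toNNReal u)).re with hφ
  have hd1 : ∀ s : ℝ, 0 ≤ s → HasDerivWithinAt (fun s : ℝ => (inner ℂ g (S s.toNNReal u)).re)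
      (inner ℂ g (S s.toNNReal ((r : ℂ) • u - f))).re (Set.Ici s) s := by
    intro s hs
    have h1 := hS.1.hasDerivWithinAt_orbit hmem hs
    have h2 := ((Complex.reCLM.comp ((innerSL ℂ g).restrictScalars ℝ)).hasFDerivAt
      (x := S s.toNNReal u)).comp_hasDerivWithinAt s h1
    exact h2
  have hd2 : ∀ s : ℝ, 0 ≤ s → HasDerivWithinAt φ
      (-(Real.exp (-r * s) * (inner ℂ g (S s.toNNReal f)).re)) (Set.Ici s) s := by
    intro s hs
    have h1 : HasDerivAt (fun s : ℝ => Real.exp (-r * s)) (Real.exp (-r * s) * (-r * 1)) s :=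
      ((hasDerivAt_id s).const_mul (-r)).exp
    refine (h1.hasDerivWithinAt.mul (hd1 s hs)).congr_deriv ?_
    simp only [map_sub, map_smul, inner_sub_right, inner_smul_right, Complex.sub_re,
      Complex.re_ofReal_mul]
    ring
  have hc : Continuous φ := by
    have h1 := (hS.1.continuous_apply u).comp continuous_real_toNNReal
    have h2 : Continuous fun s : ℝ => inner ℂ g (S s.toNNReal u) := continuous_const.inner h1
    exact (by fun_prop : Continuous fun s : ℝ => Real.exp (-r * s)).mul
      (Complex.continuous_re.comp h2)
  have hle : ∀ t : ℝ, 0 ≤ t → φ t ≤ φ 0 := fun t ht =>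
    image_le_of_deriv_right_le_deriv_boundary (B := fun _ => φ 0) (B' := fun _ => 0)
      hc.continuousOn (fun s hs => hd2 s hs.1) le_rfl continuousOn_const
      (fun s _ => hasDerivWithinAt_const _ _ _)
      (fun s _ => neg_nonpos.2 (mul_nonneg (Real.exp_pos _).le (hfg _)))
      (⟨ht, le_rfl⟩ : t ∈ Set.Icc 0 t)
  have hlim : Tendsto φ atTop (𝓝 0) := by
    have h1 : Tendsto (fun t : ℝ => Real.exp (-((r - κ) * t)) * (‖g‖ * ‖u‖)) atTop (𝓝 0) := by
      have h2 : Tendsto (fun t : ℝ => (r - κ) * t) atTop atTop :=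
        tendsto_id.const_mul_atTop (sub_pos.2 hr)
      simpa using (Real.tendsto_exp_neg_atTop_nhds_zero.comp h2).mul_const (‖g‖ * ‖u‖)
    refine squeeze_zero_norm' ?_ h1
    filter_upwards [eventually_ge_atTop 0] with t ht
    rw [hφ, norm_mul, Real.norm_of_nonneg (Real.exp_pos _).le]
    have h3 : ‖(inner ℂ g (S t.toNNReal u)).re‖ ≤ ‖g‖ * (Real.exp (κ * t) * ‖u‖) := by
      refine (Complex.abs_re_le_norm _).trans ((norm_inner_le_norm _ _).trans ?_)
      gcongr
      refine ContinuousLinearMap.le_of_opNorm_le _ ?_ u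
      simpa [Real.coe_toNNReal t ht] using hb t.toNNReal
    calc _ ≤ Real.exp (-r * t) * (‖g‖ * (Real.exp (κ * t) * ‖u‖)) := by gcongr
      _ = Real.exp (-r * t) * Real.exp (κ * t) * (‖g‖ * ‖u‖) := by ring
      _ = _ := by rw [← Real.exp_add]; congr 2; ring
  have h0 : 0 ≤ φ 0 := by
    refine le_of_tendsto hlim ?_
    filter_upwards [eventually_ge_atTop 0] with t ht using hle t ht
  simpa [hφ, hS.1.map_zero] using h0

end Orbits

section Form

variable {X W : Type*} [NormedAddCommGroup X] [InnerProductSpace ℂ X] [CompleteSpace X]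
  [NormedAddCommGroup W] [InnerProductSpace ℂ W] [CompleteSpace W]

/-! ### The operator associated with a coercive form -/

/-- The graph of minus the operator associated with a form. The form domain is a Hilbert space `W`
embedded in `X` by `j`, and the form is `a(f, g) = ⟨g, A f⟩` with a bounded operator `A` on `W`. -/
def formGraph (j : W →L[ℂ] X) (A : W →L[ℂ] W) : Set (X × X) :=
  {p | ∃ f, j f = p.1 ∧ ∀ g, inner ℂ g (A f) = -inner ℂ (j g) p.2}

/-- The form is elliptic: `a + κ` is coercive on the form domain. -/
def IsElliptic (j : W →L[ℂ] X) (A : W →L[ℂ] W) (α κ : ℝ) : Prop :=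
  ∀ f, α * ‖f‖ ^ 2 ≤ (inner ℂ f (A f)).re + κ * ‖j f‖ ^ 2

/-- The operator on the form domain that represents the shifted form `a + r`. -/
noncomputable def shiftedForm (j : W →L[ℂ] X) (A : W →L[ℂ] W) (r : ℝ) : W →L[ℂ] W :=
  A + (r : ℂ) • (ContinuousLinearMap.adjoint j ∘L j)

/-- The solution operator `k ↦ f` of the variational problem `a(f, g) + r ⟨f, g⟩ = ⟨k, g⟩`. -/
noncomputable def formSolution (j : W →L[ℂ] X) (A : W →L[ℂ] W) (r : ℝ) : X →L[ℂ] W :=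
  Ring.inverse (shiftedForm j A r) ∘L ContinuousLinearMap.adjoint j

variable {j : W →L[ℂ] X} {A : W →L[ℂ] W} {α κ : ℝ}

theorem inner_shiftedForm (r : ℝ) (f g : W) :
    inner ℂ g (shiftedForm j A r f) = inner ℂ g (A f) + r * inner ℂ (j g) (j f) := by
  simp [shiftedForm, ContinuousLinearMap.adjoint_inner_right]

theorem IsElliptic.le_re_inner_shiftedForm (h : IsElliptic j A α κ) (r : ℝ) (f : W) :
    α * ‖f‖ ^ 2 + (r - κ) * ‖j f‖ ^ 2 ≤ (inner ℂ f (shiftedForm j A r f)).re := by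
  have h1 : (inner ℂ (j f) (j f)).re = ‖j f‖ ^ 2 := by
    simpa using inner_self_eq_norm_sq (𝕜 := ℂ) (j f)
  rw [inner_shiftedForm, Complex.add_re, Complex.re_ofReal_mul, h1]
  linarith [h f]

theorem IsElliptic.isUnit (h : IsElliptic j A α κ) (hα : 0 < α) {r : ℝ} (hr : κ < r) :
    IsUnit (shiftedForm j A r) := by
  refine ContinuousLinearMap.isUnit_of_forall_le_norm_inner_map _ (c := ⟨α, hα.le⟩) hα fun f => ?_
  have h1 := h.le_re_inner_shiftedForm r f
  have h2 : 0 ≤ (r - κ) * ‖j f‖ ^ 2 := mul_nonneg (by linarith) (by positivity)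
  rw [norm_inner_symm]
  calc ‖f‖ ^ 2 * α ≤ (inner ℂ f (shiftedForm j A r f)).re := by linarith
    _ ≤ _ := Complex.re_le_norm _

theorem IsElliptic.formSolution_spec (h : IsElliptic j A α κ) (hα : 0 < α) {r : ℝ} (hr : κ < r)
    (k : X) (g : W) :
    inner ℂ g (A (formSolution j A r k)) + r * inner ℂ (j g) (j (formSolution j A r k))
      = inner ℂ (j g) k := by
  rw [← inner_shiftedForm]
  have h1 : shiftedForm j A r (formSolution j A r k) = ContinuousLinearMap.adjoint j k := by
    have := Ring.mul_inverse_cancel _ (h.isUnit hα hr)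
    exact congrArg (fun T : W →L[ℂ] W => T (ContinuousLinearMap.adjoint j k)) this
  rw [h1, ContinuousLinearMap.adjoint_inner_right]

theorem IsElliptic.eq_formSolution (h : IsElliptic j A α κ) (hα : 0 < α) {r : ℝ} (hr : κ < r)
    {k : X} {f : W} (hf : ∀ g, inner ℂ g (A f) + r * inner ℂ (j g) (j f) = inner ℂ (j g) k) :
    f = formSolution j A r k := by
  set d := f - formSolution j A r k with hd
  have h1 : inner ℂ d (shiftedForm j A r d) = 0 := by
    have h2 := hf d
    have h3 := h.formSolution_spec hα hr k d
    rw [← inner_shiftedForm] at h2 h3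
    conv_lhs => rw [hd, map_sub, inner_sub_right, ← hd, h2, h3, sub_self]
  have h4 := h.le_re_inner_shiftedForm r d
  have h5 : 0 ≤ (r - κ) * ‖j d‖ ^ 2 := mul_nonneg (by linarith) (by positivity)
  rw [h1, Complex.zero_re] at h4
  have h6 : ‖d‖ ^ 2 ≤ 0 := by
    by_contra! hcon
    linarith [mul_pos hα hcon]
  have h7 : d = 0 := by
    have : ‖d‖ ^ 2 = 0 := le_antisymm h6 (by positivity)
    simpa using this
  exact sub_eq_zero.1 h7

theorem IsElliptic.isResolventOn (h : IsElliptic j A α κ) (hα : 0 < α) :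
    IsResolventOn (formGraph j A) κ fun r => j ∘L formSolution j A r := by
  intro r hr u k
  constructor
  · rintro ⟨f, hf, hA⟩
    simp only at hf
    have := h.eq_formSolution hα hr (k := (r : ℂ) • u - k) (f := f) fun g => by
      rw [hA, inner_sub_right, inner_smul_right, hf]
      ring
    rw [ContinuousLinearMap.comp_apply, ← this, hf]
  · intro hu
    refine ⟨_, hu, fun g => ?_⟩
    have := h.formSolution_spec hα hr ((r : ℂ) • u - k) g
    rw [ContinuousLinearMap.comp_apply] at hu
    rw [hu, inner_sub_right, inner_smul_right] at this
    linear_combination this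

theorem IsElliptic.norm_resolvent_le (h : IsElliptic j A α κ) (hα : 0 < α) {r : ℝ} (hr : κ < r) :
    ‖j ∘L formSolution j A r‖ ≤ (r - κ)⁻¹ := by
  have hr' : 0 < r - κ := by linarith
  refine ContinuousLinearMap.opNorm_le_bound _ (by positivity) fun k => ?_
  rw [ContinuousLinearMap.comp_apply, inv_mul_eq_div, le_div_iff₀ hr']
  set f := formSolution j A r k
  have h1 := h.le_re_inner_shiftedForm r f
  rw [inner_shiftedForm, h.formSolution_spec hα hr k f] at h1
  have h2 : (inner ℂ (j f) k).re ≤ ‖j f‖ * ‖k‖ :=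
    (Complex.re_le_norm _).trans (norm_inner_le_norm _ _)
  have h3 : 0 ≤ α * ‖f‖ ^ 2 := by positivity
  rcases (norm_nonneg (j f)).eq_or_lt with h0 | h0
  · rw [← h0]; simp
  · nlinarith

/-- A vector `k` orthogonal to the domain is orthogonal to its own resolvent `j f`, and coercivity
then gives `f = 0`, hence `k = 0`. -/
theorem IsElliptic.dense_domain (h : IsElliptic j A α κ) (hα : 0 < α) (hj : DenseRange j) :
    Dense (Prod.fst '' formGraph j A) := by
  have hr : κ < κ + 1 := by linarith
  have hsub : ((j ∘L formSolution j A (κ + 1)).range : Set X) ⊆ Prod.fst '' formGraph j A := by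
    rintro _ ⟨k, rfl⟩
    exact ⟨_, (h.isResolventOn hα).mem hr k, rfl⟩
  refine Dense.mono hsub ?_
  rw [Submodule.dense_iff_topologicalClosure_eq_top, Submodule.topologicalClosure_eq_top_iff,
    Submodule.eq_bot_iff]
  intro k hk
  set f := formSolution j A (κ + 1) k with hf
  have h0 : inner ℂ (j f) k = 0 := hk _ ⟨k, rfl⟩
  have h1 := h.le_re_inner_shiftedForm (κ + 1) f
  rw [inner_shiftedForm, h.formSolution_spec hα hr k f, h0, Complex.zero_re] at h1
  have hf0 : f = 0 := by
    have h2 : 0 ≤ (κ + 1 - κ) * ‖j f‖ ^ 2 := mul_nonneg (by linarith) (by positivity)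
    have h6 : ‖f‖ ^ 2 ≤ 0 := by
      by_contra! hcon
      linarith [mul_pos hα hcon]
    have : ‖f‖ ^ 2 = 0 := le_antisymm h6 (by positivity)
    simpa using this
  have h3 : ∀ g, inner ℂ (j g) k = 0 := by
    intro g
    have := h.formSolution_spec hα hr k g
    rw [← hf, hf0] at this
    simpa using this.symm
  have h4 : ∀ x, inner ℂ x k = 0 := fun x =>
    hj.induction_on x (isClosed_eq (by fun_prop) continuous_const) h3
  exact inner_self_eq_zero.1 (h4 k)

theorem IsElliptic.re_inner_le (h : IsElliptic j A α κ) (hα : 0 < α) {p : X × X}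
    (hp : p ∈ formGraph j A) : (inner ℂ p.1 p.2).re ≤ κ * ‖p.1‖ ^ 2 := by
  obtain ⟨f, hf, hA⟩ := hp
  have h1 := h f
  have h2 := hA f
  rw [hf] at h1 h2
  have h3 : 0 ≤ α * ‖f‖ ^ 2 := by positivity
  rw [h2, Complex.neg_re] at h1
  linarith

/-- A sequence that is bounded in the form domain and tends to zero in the ambient space tends to
zero weakly in the form domain. -/
theorem tendsto_inner_of_tendsto_apply {ι : Type*} {l : Filter ι} (hj : Function.Injective j)
    {w : ι → W} {C : ℝ} (hC : ∀ᶠ i in l, ‖w i‖ ≤ C) (hw : Tendsto (fun i => j (w i)) l (𝓝 0))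
    (v : W) : Tendsto (fun i => inner ℂ (w i) v) l (𝓝 0) := by
  have hd : Dense ((ContinuousLinearMap.adjoint j).range : Set W) := by
    rw [Submodule.dense_iff_topologicalClosure_eq_top, Submodule.topologicalClosure_eq_top_iff,
      ContinuousLinearMap.orthogonal_range, ContinuousLinearMap.adjoint_adjoint]
    exact LinearMap.ker_eq_bot.2 hj
  have := tendsto_apply_of_dense (T := fun i => innerSL ℂ (w i)) (U := 0) (C := C)
    (by simpa using hC) hd ?_ v
  · simpa using this
  rintro _ ⟨k, rfl⟩
  have h1 := hw.inner (tendsto_const_nhds (x := k)) (𝕜 := ℂ)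
  rw [inner_zero_left] at h1
  refine h1.congr fun i => ?_
  simp [ContinuousLinearMap.adjoint_inner_right]

/-- If `⟨f, g⟩ = 0` and the matrix coefficient `⟨S t f, g⟩` is nonnegative for all times, then the
form satisfies `Re a(f, g) ≤ 0`. The form is recovered from the resolvent by
`a(f, g) = lim r ⟨f - r R r f, g⟩`, because `r R r f` tends to `f` weakly in the form domain. -/
theorem IsElliptic.re_form_nonpos (h : IsElliptic j A α κ) (hα : 0 < α)
    (hj : Function.Injective j) {S : ℝ≥0 → X →L[ℂ] X} (hS : IsGeneratedBy S (formGraph j A))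
    (hb : ∀ t, ‖S t‖ ≤ Real.exp (κ * t)) {f g : W} (h0 : inner ℂ (j g) (j f) = 0)
    (hfg : ∀ t, 0 ≤ (inner ℂ (j g) (S t (j f))).re) : (inner ℂ g (A f)).re ≤ 0 := by
  set u : ℝ → W := fun r => formSolution j A r ((r : ℂ) • j f) with hu
  have hspec : ∀ r, κ < r → ∀ v, inner ℂ v (A (u r)) = -(r * inner ℂ (j v) (j (u r - f))) := by
    intro r hr v
    have := h.formSolution_spec hα hr ((r : ℂ) • j f) v
    rw [inner_smul_right] at this
    rw [map_sub, inner_sub_right]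
    linear_combination this
  -- testing the equation for `u r` with `u r - f` bounds `u r - f` in the form domain and makes it
  -- tend to zero in `X`
  have hbound : ∀ r, κ < r →
      α * ‖u r - f‖ ^ 2 + (r - κ) * ‖j (u r - f)‖ ^ 2 ≤ ‖A f‖ * ‖u r - f‖ := by
    intro r hr
    have h1 := h.le_re_inner_shiftedForm r (u r - f)
    have h2 : inner ℂ (u r - f) (shiftedForm j A r (u r - f)) = -inner ℂ (u r - f) (A f) := by
      rw [inner_shiftedForm, map_sub A, inner_sub_right, hspec r hr]
      ring
    rw [h2, Complex.neg_re] at h1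
    have h3 : |(inner ℂ (u r - f) (A f)).re| ≤ ‖u r - f‖ * ‖A f‖ :=
      (Complex.abs_re_le_norm _).trans (norm_inner_le_norm _ _)
    linarith [neg_abs_le (inner ℂ (u r - f) (A f)).re]
  have hw1 : ∀ r, κ < r → ‖u r - f‖ ≤ ‖A f‖ / α := by
    intro r hr
    have h1 := hbound r hr
    have h2 : 0 ≤ (r - κ) * ‖j (u r - f)‖ ^ 2 := mul_nonneg (by linarith) (by positivity)
    rw [le_div_iff₀ hα]
    rcases (norm_nonneg (u r - f)).eq_or_lt with h0 | h0
    · rw [← h0]; simp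
    · nlinarith
  have hw2 : Tendsto (fun r => j (u r - f)) atTop (𝓝 0) := by
    have h1 : Tendsto (fun r : ℝ => (r - κ)⁻¹ * (‖A f‖ * (‖A f‖ / α))) atTop (𝓝 0) := by
      have h2 : Tendsto (fun r : ℝ => r - κ) atTop atTop :=
        tendsto_atTop_add_const_right _ _ tendsto_id
      simpa using (tendsto_inv_atTop_zero.comp h2).mul_const (‖A f‖ * (‖A f‖ / α))
    have h3 : Tendsto (fun r => ‖j (u r - f)‖ ^ 2) atTop (𝓝 0) := by
      refine squeeze_zero' (Eventually.of_forall fun _ => by positivity) ?_ h1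
      filter_upwards [eventually_gt_atTop κ] with r hr
      have hr' : 0 < r - κ := by linarith
      rw [inv_mul_eq_div, le_div_iff₀ hr']
      have h4 : ‖A f‖ * ‖u r - f‖ ≤ ‖A f‖ * (‖A f‖ / α) := by
        gcongr
        exact hw1 r hr
      have h5 : 0 ≤ α * ‖u r - f‖ ^ 2 := by positivity
      linarith [hbound r hr]
    rw [tendsto_zero_iff_norm_tendsto_zero]
    have h4 := h3.sqrt
    simpa using h4
  have hlim : Tendsto (fun r => (inner ℂ g (A (u r))).re) atTop (𝓝 (inner ℂ g (A f)).re) := by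
    have h1 := tendsto_inner_of_tendsto_apply hj (w := fun r => u r - f)
      (by filter_upwards [eventually_gt_atTop κ] with r hr using hw1 r hr) hw2
      (ContinuousLinearMap.adjoint A g)
    have h2 := (Complex.continuous_re.tendsto _).comp h1
    have h3 := h2.add_const (inner ℂ g (A f)).re
    rw [Complex.zero_re, zero_add] at h3
    refine h3.congr fun r => ?_
    simp only [Function.comp_apply]
    rw [ContinuousLinearMap.adjoint_inner_right, ← Complex.conj_re, inner_conj_symm, map_sub,
      inner_sub_right, Complex.sub_re, sub_add_cancel]
  refine le_of_tendsto hlim ?_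
  filter_upwards [eventually_gt_atTop κ, eventually_gt_atTop 0] with r hr hr0
  have h1 := re_inner_resolvent_nonneg (h.isResolventOn hα) hS hb hfg hr
  rw [hspec r hr g, map_sub, inner_sub_right, h0, sub_zero, show u r = (r : ℂ) • _ from
    map_smul _ _ _, map_smul, inner_smul_right, Complex.neg_re, Complex.re_ofReal_mul,
    Complex.re_ofReal_mul]
  rw [ContinuousLinearMap.comp_apply] at h1
  nlinarith [mul_nonneg hr0.le (mul_nonneg hr0.le h1)]

end Form

section Sobolev

variable {d m : ℕ}

/-! ### Translations, difference quotients and weak derivatives -/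

/-- Translation by `v`, that is, `f ↦ f (· + v)`. -/
noncomputable def translate (v : Space d) : VLp d m 2 →ₗᵢ[ℂ] VLp d m 2 :=
  Lp.compMeasurePreservingₗᵢ ℂ (· + v) (measurePreserving_add_right volume v)

theorem coeFn_translate (v : Space d) (f : VLp d m 2) :
    translate v f =ᵐ[volume] fun x => f (x + v) :=
  Lp.coeFn_compMeasurePreserving f (measurePreserving_add_right volume v)

theorem continuous_translate (f : VLp d m 2) : Continuous fun v => translate v f :=
  Continuous.compMeasurePreservingLp (p := 2) (μ := (volume : Measure (Space d)))
    (ν := (volume : Measure (Space d))) (f := fun _ : Space d => f)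
    (g := fun v => (⟨fun x => x + v, by fun_prop⟩ : C(Space d, Space d))) continuous_const
    (ContinuousMap.continuous_of_continuous_uncurry _ (by
      simp only [ContinuousMap.coe_mk]
      fun_prop))
    (fun v => measurePreserving_add_right volume v) (by norm_num)

theorem translate_zero (f : VLp d m 2) : translate 0 f = f := by
  refine Lp.ext ((coeFn_translate 0 f).trans ?_)
  simp

/-- Pairing with a continuous compactly supported function, as a bounded operator on `L²`. -/
noncomputable def testPairing (φ : Space d → ℝ) (hφ : Continuous φ) (hc : HasCompactSupport φ) :
    VLp d m 2 →L[ℂ] EuclideanSpace ℂ (Fin m) :=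
  (ContinuousLinearMap.lsmul ℂ ℂ).lpPairing volume 2 2
    (((Complex.continuous_ofReal.comp hφ).memLp_of_hasCompactSupport (p := 2) (μ := volume)
      (hc.comp_left Complex.ofReal_zero)).toLp _)

theorem testPairing_apply (φ : Space d → ℝ) (hφ : Continuous φ) (hc : HasCompactSupport φ)
    (f : VLp d m 2) : testPairing φ hφ hc f = ∫ x, φ x • f x := by
  rw [testPairing, ContinuousLinearMap.lpPairing_eq_integral]
  refine integral_congr_ae ?_
  filter_upwards [MemLp.coeFn_toLp ((Complex.continuous_ofReal.comp hφ).memLp_of_hasCompactSupport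
    (p := 2) (μ := volume) (hc.comp_left Complex.ofReal_zero))] with x hx
  rw [hx]
  simp

theorem locallyIntegrable_VLp (f : VLp d m 2) : LocallyIntegrable f volume :=
  (Lp.memLp f).locallyIntegrable (by norm_num)

theorem VLp_ext_of_testPairing {f g : VLp d m 2}
    (h : ∀ φ : Space d → ℝ, ContDiff ℝ ∞ φ → HasCompactSupport φ →
      ∫ x, φ x • f x = ∫ x, φ x • g x) : f = g :=
  Lp.ext (ae_eq_of_integral_contDiff_smul_eq (locallyIntegrable_VLp f) (locallyIntegrable_VLp g) h)

theorem integral_smul_translate (φ : Space d → ℝ) (f : VLp d m 2) (v : Space d) :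
    ∫ x, φ x • translate v f x = ∫ x, φ (x - v) • f x := by
  have h1 : ∫ x, φ x • translate v f x = ∫ x, φ (x + v - v) • f (x + v) := by
    refine integral_congr_ae ?_
    filter_upwards [coeFn_translate v f] with x hx
    rw [hx, add_sub_cancel_right]
  rw [h1, integral_add_right_eq_self (fun x => φ (x - v) • f x)]

/-- The pairing with a moving test function is differentiable along a direction. -/
theorem hasDerivAt_integral_smul_translate {φ : Space d → ℝ} (hφ : ContDiff ℝ ∞ φ)
    (hc : HasCompactSupport φ) (f : VLp d m 2) (e : Space d) (t : ℝ) :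
    HasDerivAt (fun s : ℝ => ∫ x, φ (x - s • e) • f x)
      (-∫ x, fderiv ℝ φ (x - t • e) e • f x) t := by
  -- the pairing is the convolution of `f` with the reflected test function `ψ`
  set ψ : Space d → ℝ := fun x => φ (-x) with hψ
  have hψ1 : ContDiff ℝ 1 ψ := (hφ.of_le (by simp)).comp contDiff_neg
  have hψc : HasCompactSupport ψ := hc.comp_homeomorph (Homeomorph.neg _)
  have hfd : ∀ x, fderiv ℝ ψ x = -(fderiv ℝ φ (-x)) := fun x => by
    have h1 : HasFDerivAt φ (fderiv ℝ φ (-x)) (-x) :=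
      (hφ.differentiable (by simp) (-x)).hasFDerivAt
    have h2 := h1.comp x (hasFDerivAt_id x).fun_neg
    have h3 : HasFDerivAt ψ _ x := h2
    rw [h3.fderiv]
    ext v
    simp
  let B : EuclideanSpace ℂ (Fin m) →L[ℝ] ℝ →L[ℝ] EuclideanSpace ℂ (Fin m) :=
    (ContinuousLinearMap.lsmul ℝ ℝ).flip
  have h1 := hψc.hasFDerivAt_convolution_right B (locallyIntegrable_VLp f) hψ1 (t • e)
  have h2 := h1.comp_hasDerivAt t ((hasDerivAt_id t).smul_const e)
  have e1 : ∀ s : ℝ, (convolution f ψ B volume) (s • e) = ∫ x, φ (x - s • e) • f x := by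
    intro s
    rw [convolution_def]
    simp [B, hψ]
  have h3 : HasDerivAt (fun s : ℝ => ∫ x, φ (x - s • e) • f x) _ t :=
    h2.congr_of_eventuallyEq (Eventually.of_forall fun s => (e1 s).symm)
  refine h3.congr_deriv ?_
  simp only [one_smul]
  rw [convolution_precompR_apply B (locallyIntegrable_VLp f) (hψc.fderiv ℝ)
    (hψ1.continuous_fderiv one_ne_zero), convolution_def, ← integral_neg]
  refine integral_congr_ae (Eventually.of_forall fun x => ?_)
  simp [B, hfd]

/-- The translation group acts on a function with weak derivative `g` by integrating the translates
of `g`. -/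
theorem IsWeakPartial.translate_sub_eq_integral {k : Fin d} {f g : VLp d m 2}
    (h : IsWeakPartial k f g) (t : ℝ) :
    translate (t • EuclideanSpace.single k (1 : ℝ)) f - f
      = ∫ s in (0 : ℝ)..t, translate (s • EuclideanSpace.single k (1 : ℝ)) g := by
  set e : Space d := EuclideanSpace.single k (1 : ℝ) with he
  have hcont : Continuous fun s : ℝ => translate (s • e) g :=
    (continuous_translate g).comp (by fun_prop)
  refine VLp_ext_of_testPairing fun φ hφ hc => ?_
  rw [← testPairing_apply φ hφ.continuous hc, ← testPairing_apply φ hφ.continuous hc, map_sub,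
    ← ContinuousLinearMap.intervalIntegral_comp_comm _ (hcont.intervalIntegrable _ _)]
  simp_rw [testPairing_apply, integral_smul_translate]
  have hder : ∀ s : ℝ, HasDerivAt (fun s : ℝ => ∫ x, φ (x - s • e) • f x)
      (∫ x, φ (x - s • e) • g x) s := by
    intro s
    refine (hasDerivAt_integral_smul_translate hφ hc f e s).congr_deriv ?_
    have h1 := h (fun x => φ (x - s • e)) (hφ.comp (contDiff_id.sub contDiff_const))
      (hc.comp_homeomorph (Homeomorph.subRight (s • e)))
    have h2 : ∀ x, fderiv ℝ (fun x => φ (x - s • e)) x = fderiv ℝ φ (x - s • e) := fun x => by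
      simp_rw [sub_eq_add_neg]
      exact fderiv_comp_add_right _
    simp_rw [h2] at h1
    rw [← he] at h1
    rw [h1, neg_neg]
  have hc2 : Continuous fun s : ℝ => ∫ x, φ (x - s • e) • g x := by
    have := (testPairing (m := m) φ hφ.continuous hc).continuous.comp hcont
    refine this.congr fun s => ?_
    rw [Function.comp_apply, testPairing_apply, integral_smul_translate]
  rw [intervalIntegral.integral_eq_sub_of_hasDerivAt (fun s _ => hder s)
    (hc2.intervalIntegrable _ _)]
  simp

/-- Difference quotients converge strongly in `L²` to the weak derivative. -/
theorem IsWeakPartial.hasDerivAt_translate {k : Fin d} {f g : VLp d m 2}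
    (h : IsWeakPartial k f g) :
    HasDerivAt (fun t : ℝ => translate (t • EuclideanSpace.single k (1 : ℝ)) f) g 0 := by
  have hcont : Continuous fun s : ℝ => translate (s • EuclideanSpace.single k (1 : ℝ)) g :=
    (continuous_translate g).comp (by fun_prop)
  have h1 := (intervalIntegral.integral_hasDerivAt_right (hcont.intervalIntegrable 0 0)
    (hcont.stronglyMeasurableAtFilter _ _) hcont.continuousAt).const_add f
  simp only [zero_smul, translate_zero] at h1
  refine h1.congr_of_eventuallyEq (Eventually.of_forall fun t => ?_)
  simp only
  rw [← h.translate_sub_eq_integral, add_sub_cancel]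

theorem IsWeakPartial.norm_translate_sub_le {k : Fin d} {f g : VLp d m 2}
    (h : IsWeakPartial k f g) (t : ℝ) :
    ‖translate (t • EuclideanSpace.single k (1 : ℝ)) f - f‖ ≤ ‖g‖ * |t| := by
  rw [h.translate_sub_eq_integral]
  have := intervalIntegral.norm_integral_le_of_norm_le_const (a := 0) (b := t) (C := ‖g‖)
    (f := fun s : ℝ => translate (s • EuclideanSpace.single k (1 : ℝ)) g)
    fun s _ => (LinearIsometry.norm_map _ g).le
  simpa using this

/-- A bounded sequence in a Hilbert space has a weak limit along an ultrafilter. -/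
theorem exists_weak_limit {H : Type*} [NormedAddCommGroup H] [InnerProductSpace ℂ H]
    [CompleteSpace H] {u : ℕ → H} {C : ℝ} (hu : ∀ n, ‖u n‖ ≤ C) (U : Ultrafilter ℕ) :
    ∃ g : H, ∀ v, Tendsto (fun n => inner ℂ (u n) v) U (𝓝 (inner ℂ g v)) := by
  let F : ℕ → WeakDual ℂ H := fun n => StrongDual.toWeakDual (innerSL ℂ (u n))
  have hK := WeakDual.isCompact_closedBall (𝕜 := ℂ) (E := H) (0 : StrongDual ℂ H) C
  obtain ⟨ℓ, -, hℓ⟩ := hK.ultrafilter_le_nhds (U.map F) (by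
    simp only [le_principal_iff, Ultrafilter.mem_coe, Ultrafilter.mem_map]
    refine univ_mem' fun n => ?_
    simpa [F] using hu n)
  refine ⟨(InnerProductSpace.toDual ℂ H).symm (WeakDual.toStrongDual ℓ), fun v => ?_⟩
  rw [InnerProductSpace.toDual_symm_apply]
  have h1 : Tendsto F U (𝓝 ℓ) := hℓ
  exact (WeakDual.eval_continuous v).continuousAt.tendsto.comp h1

/-- A function with bounded difference quotients in the direction `k` has a weak derivative in that
direction, namely a weak limit of the difference quotients. -/
theorem exists_isWeakPartial_of_norm_translate_sub_le {k : Fin d} {f : VLp d m 2} {C : ℝ}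
    (h : ∀ t : ℝ, ‖translate (t • EuclideanSpace.single k (1 : ℝ)) f - f‖ ≤ C * |t|) :
    ∃ g, IsWeakPartial k f g := by
  set e : Space d := EuclideanSpace.single k (1 : ℝ) with he
  let τ : ℕ → ℝ := fun n => 1 / ((n : ℝ) + 1)
  have hτ : ∀ n, 0 < τ n := fun n => by positivity
  have hτ0 : Tendsto τ atTop (𝓝[≠] 0) :=
    tendsto_nhdsWithin_iff.2 ⟨tendsto_one_div_add_atTop_nhds_zero_nat,
      Eventually.of_forall fun n => (hτ n).ne'⟩
  let u : ℕ → VLp d m 2 := fun n => ((τ n)⁻¹ : ℂ) • (translate (τ n • e) f - f)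
  have hu : ∀ n, ‖u n‖ ≤ C := by
    intro n
    have h1 := h (τ n)
    rw [abs_of_pos (hτ n)] at h1
    rw [norm_smul, norm_inv, Complex.norm_real, Real.norm_of_nonneg (hτ n).le,
      inv_mul_le_iff₀ (hτ n), mul_comm]
    exact h1
  obtain ⟨g, hg⟩ := exists_weak_limit hu (hyperfilter ℕ)
  refine ⟨g, fun φ hφ hc => ?_⟩
  rw [← he]
  set Λ := testPairing (m := m) φ hφ.continuous hc with hΛ
  have hlim1 : ∀ c, Tendsto (fun n => inner ℂ (Λ (u n)) c) (hyperfilter ℕ)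
      (𝓝 (inner ℂ (Λ g) c)) := by
    intro c
    have := hg (ContinuousLinearMap.adjoint Λ c)
    simpa only [ContinuousLinearMap.adjoint_inner_right] using this
  have hder := hasDerivAt_integral_smul_translate hφ hc f e 0
  have hslope := (hasDerivAt_iff_tendsto_slope.1 hder).comp hτ0
  have heq : ∀ n, Λ (u n) = slope (fun s : ℝ => ∫ x, φ (x - s • e) • f x) 0 (τ n) := by
    intro n
    rw [hΛ, map_smul, map_sub, testPairing_apply, testPairing_apply, integral_smul_translate,
      slope_def_module, ← Complex.ofReal_inv, Complex.coe_smul]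
    simp
  have hlim2 : ∀ c, Tendsto (fun n => inner ℂ (Λ (u n)) c) (hyperfilter ℕ)
      (𝓝 (inner ℂ (-∫ x, fderiv ℝ φ (x - (0 : ℝ) • e) e • f x) c)) := by
    intro c
    simp_rw [heq]
    exact (hslope.mono_left Nat.hyperfilter_le_atTop).inner tendsto_const_nhds
  have hfin : Λ g = -∫ x, fderiv ℝ φ (x - (0 : ℝ) • e) e • f x :=
    ext_inner_right ℂ fun c => tendsto_nhds_unique (hlim1 c) (hlim2 c)
  rw [hΛ, testPairing_apply] at hfin
  rw [hfin]
  simp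

/-- Composition with a contraction fixing the origin preserves `H¹`. -/
theorem IsH1.compLp {G : EuclideanSpace ℂ (Fin m) → EuclideanSpace ℂ (Fin m)}
    (hG : LipschitzWith 1 G) (hG0 : G 0 = 0) {f : VLp d m 2} (hf : IsH1 f) :
    IsH1 (hG.compLp hG0 f : VLp d m 2) := by
  intro k
  obtain ⟨g, hg⟩ := hf k
  refine exists_isWeakPartial_of_norm_translate_sub_le (C := ‖g‖) fun t => ?_
  set v : Space d := t • EuclideanSpace.single k (1 : ℝ)
  have h1 : translate v (hG.compLp hG0 f : VLp d m 2) = hG.compLp hG0 (translate v f) := by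
    refine Lp.ext ?_
    have h2 : ∀ᵐ x, (hG.compLp hG0 f : VLp d m 2) (x + v) = G (f (x + v)) :=
      (measurePreserving_add_right volume v).quasiMeasurePreserving.ae (hG.coeFn_compLp hG0 f)
    filter_upwards [coeFn_translate v (hG.compLp hG0 f : VLp d m 2), coeFn_translate v f,
      hG.coeFn_compLp hG0 (translate v f), h2] with x h3 h4 h5 h6
    rw [h3, h5, h6, Function.comp_apply, h4]
  rw [h1]
  have h2 := hG.norm_compLp_sub_le hG0 (translate v f) f
  rw [NNReal.coe_one, one_mul] at h2
  exact h2.trans (hg.norm_translate_sub_le t)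

/-- If a real-linear functional `T` of `f` is nonnegative, then its weak derivative vanishes almost
everywhere on the set where `T f` vanishes. -/
theorem IsWeakPartial.ae_apply_eq_zero {k : Fin d} {f g : VLp d m 2} (h : IsWeakPartial k f g)
    (T : EuclideanSpace ℂ (Fin m) →L[ℝ] ℝ) (hT : ∀ᵐ x, 0 ≤ T (f x)) :
    ∀ᵐ x, T (f x) = 0 → T (g x) = 0 := by
  -- where `T f` vanishes, the right difference quotients of `T f` are nonnegative and the left ones
  -- are nonpositive
  set e : Space d := EuclideanSpace.single k (1 : ℝ) with he
  have hslope := hasDerivAt_iff_tendsto_slope.1 h.hasDerivAt_translate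
  have key : ∀ l : Filter ℝ, l.NeBot → l.IsCountablyGenerated → l ≤ 𝓝[≠] 0 →
      ∃ ns : ℕ → ℝ, Tendsto ns atTop l ∧ ∀ᵐ x, T (f x) = 0 →
        Tendsto (fun n => (ns n)⁻¹ * T (f (x + ns n • e))) atTop (𝓝 (T (g x))) := by
    intro l _ _ hl
    obtain ⟨ns, hns, hae⟩ := (tendstoInMeasure_of_tendsto_Lp
      (hslope.mono_left hl)).exists_seq_tendsto_ae'
    refine ⟨ns, hns, ?_⟩
    have h2 : ∀ᵐ x, ∀ n, slope (fun t : ℝ => translate (t • e) f) 0 (ns n) x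
        = (ns n)⁻¹ • (f (x + ns n • e) - f x) := by
      rw [ae_all_iff]
      intro n
      have e1 : slope (fun t : ℝ => translate (t • e) f) 0 (ns n)
          = (ns n)⁻¹ • (translate (ns n • e) f - f) := by
        rw [slope_def_module, zero_smul, translate_zero, sub_zero]
      rw [e1]
      filter_upwards [Lp.coeFn_smul (ns n)⁻¹ (translate (ns n • e) f - f),
        Lp.coeFn_sub (translate (ns n • e) f) f, coeFn_translate (ns n • e) f] with x h3 h4 h5
      rw [h3, Pi.smul_apply, h4, Pi.sub_apply, h5]
    filter_upwards [hae, h2] with x h3 h4 h5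
    have h6 := (T.continuous.tendsto _).comp h3
    refine h6.congr fun n => ?_
    rw [Function.comp_apply, h4, map_smul, map_sub, h5, sub_zero, smul_eq_mul]
  have hpos : ∀ ns : ℕ → ℝ, ∀ᵐ x, ∀ n, 0 ≤ T (f (x + ns n • e)) := fun ns => by
    rw [ae_all_iff]
    exact fun n => (measurePreserving_add_right volume (ns n • e)).quasiMeasurePreserving.ae hT
  obtain ⟨ns, hns, h1⟩ := key (𝓝[>] 0) inferInstance inferInstance
    (nhdsWithin_mono _ fun x hx => ne_of_gt hx)
  obtain ⟨ms, hms, h2⟩ := key (𝓝[<] 0) inferInstance inferInstance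
    (nhdsWithin_mono _ fun x hx => ne_of_lt hx)
  filter_upwards [h1, h2, hpos ns, hpos ms] with x h1 h2 h3 h4 h0
  refine le_antisymm (le_of_tendsto (h2 h0) ?_) (ge_of_tendsto (h1 h0) ?_)
  · filter_upwards [hms self_mem_nhdsWithin] with n hn
    exact mul_nonpos_of_nonpos_of_nonneg (inv_nonpos.2 (le_of_lt hn)) (h4 n)
  · filter_upwards [hns self_mem_nhdsWithin] with n hn
    exact mul_nonneg (inv_nonneg.2 (le_of_lt hn)) (h3 n)

theorem IsH1.isWeakPartial_weakPartial {f : VLp d m 2} (hf : IsH1 f) (k : Fin d) :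
    IsWeakPartial k f (weakPartial k f) := by
  obtain ⟨g, hg⟩ := hf k
  rwa [hg.weakPartial_eq]

theorem IsWeakPartial.add {k : Fin d} {f g f' g' : VLp d m 2} (h : IsWeakPartial k f g)
    (h' : IsWeakPartial k f' g') : IsWeakPartial k (f + f') (g + g') := by
  intro φ hφ hc
  have hc' : HasCompactSupport fun x => fderiv ℝ φ x (EuclideanSpace.single k 1) :=
    hc.fderiv_apply ℝ _
  have hφ' : Continuous fun x => fderiv ℝ φ x (EuclideanSpace.single k 1) :=
    (hφ.continuous_fderiv (by simp)).clm_apply continuous_const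
  have h1 := h φ hφ hc
  have h2 := h' φ hφ hc
  rw [← testPairing_apply _ hφ' hc', ← testPairing_apply _ hφ.continuous hc] at h1 h2 ⊢
  rw [map_add, map_add, h1, h2, neg_add]

theorem IsWeakPartial.smul {k : Fin d} {f g : VLp d m 2} (h : IsWeakPartial k f g) (c : ℂ) :
    IsWeakPartial k (c • f) (c • g) := by
  intro φ hφ hc
  have hc' : HasCompactSupport fun x => fderiv ℝ φ x (EuclideanSpace.single k 1) :=
    hc.fderiv_apply ℝ _
  have hφ' : Continuous fun x => fderiv ℝ φ x (EuclideanSpace.single k 1) :=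
    (hφ.continuous_fderiv (by simp)).clm_apply continuous_const
  have h1 := h φ hφ hc
  rw [← testPairing_apply _ hφ' hc', ← testPairing_apply _ hφ.continuous hc] at h1 ⊢
  rw [map_smul, map_smul, h1, smul_neg]

/-- The weak derivative is a closed operator. -/
theorem IsWeakPartial.of_tendsto {k : Fin d} {ι : Type*} {l : Filter ι} [l.NeBot]
    {f g : ι → VLp d m 2} {f₀ g₀ : VLp d m 2} (h : ∀ n, IsWeakPartial k (f n) (g n))
    (hf : Tendsto f l (𝓝 f₀)) (hg : Tendsto g l (𝓝 g₀)) : IsWeakPartial k f₀ g₀ := by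
  intro φ hφ hc
  have hc' : HasCompactSupport fun x => fderiv ℝ φ x (EuclideanSpace.single k 1) :=
    hc.fderiv_apply ℝ _
  have hφ' : Continuous fun x => fderiv ℝ φ x (EuclideanSpace.single k 1) :=
    (hφ.continuous_fderiv (by simp)).clm_apply continuous_const
  rw [← testPairing_apply _ hφ' hc', ← testPairing_apply _ hφ.continuous hc]
  refine tendsto_nhds_unique (((testPairing _ hφ' hc').continuous.tendsto _).comp hf) ?_
  refine ((((testPairing _ hφ.continuous hc).continuous.tendsto _).comp hg).neg).congr fun n => ?_
  have h1 := h n φ hφ hc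
  rw [← testPairing_apply _ hφ' hc', ← testPairing_apply _ hφ.continuous hc] at h1
  exact h1.symm

end Sobolev

section Density

variable {d m : ℕ}

/-! ### Pointwise algebra of the form density -/

section Sesq

variable (C : Matrix (Fin m) (Fin m) ℝ) (ξ ξ' ζ ζ' : EuclideanSpace ℂ (Fin m)) (c : ℂ)

theorem sesq_add_left : sesq C (ξ + ξ') ζ = sesq C ξ ζ + sesq C ξ' ζ := by
  simp only [sesq, PiLp.add_apply, mul_add, add_mul, Finset.sum_add_distrib]

theorem sesq_add_right : sesq C ξ (ζ + ζ') = sesq C ξ ζ + sesq C ξ ζ' := by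
  simp only [sesq, PiLp.add_apply, map_add, mul_add, Finset.sum_add_distrib]

theorem sesq_smul_left : sesq C (c • ξ) ζ = c * sesq C ξ ζ := by
  simp only [sesq, PiLp.smul_apply, smul_eq_mul, Finset.mul_sum]
  refine Finset.sum_congr rfl fun i _ => Finset.sum_congr rfl fun j _ => ?_
  ring

theorem sesq_smul_right : sesq C ξ (c • ζ) = conj c * sesq C ξ ζ := by
  simp only [sesq, PiLp.smul_apply, smul_eq_mul, map_mul, Finset.mul_sum]
  refine Finset.sum_congr rfl fun i _ => Finset.sum_congr rfl fun j _ => ?_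
  ring

theorem sesq_transpose : sesq C.transpose ξ ζ = conj (sesq C ζ ξ) := by
  simp only [sesq, map_sum, map_mul, Complex.conj_ofReal, Complex.conj_conj,
    Matrix.transpose_apply]
  rw [Finset.sum_comm]
  refine Finset.sum_congr rfl fun i _ => Finset.sum_congr rfl fun j _ => ?_
  ring

theorem sesq_symmPart : sesq (symmPart C) ξ ζ = (sesq C ξ ζ + conj (sesq C ζ ξ)) / 2 := by
  rw [← sesq_transpose]
  simp only [sesq, symmPart, Matrix.smul_apply, Matrix.add_apply, smul_eq_mul,
    ← Finset.sum_add_distrib, Finset.sum_div]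
  refine Finset.sum_congr rfl fun i _ => Finset.sum_congr rfl fun j _ => ?_
  push_cast
  ring

theorem sesq_symmPart_self : sesq (symmPart C) ξ ξ = ((sesq C ξ ξ).re : ℂ) := by
  rw [sesq_symmPart, Complex.add_conj]
  push_cast
  ring

theorem symmPart_symmPart : symmPart (symmPart C) = symmPart C := by
  ext i j
  simp only [symmPart, Matrix.smul_apply, Matrix.add_apply, Matrix.transpose_apply, smul_eq_mul]
  ring

/-- The matrix is sectorial with constant `M`. -/
def IsSectorial (M : ℝ) : Prop :=
  ∀ ξ : EuclideanSpace ℂ (Fin m), |(sesq C ξ ξ).im| ≤ M * (sesq C ξ ξ).re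

variable {C} {M : ℝ}

theorem IsSectorial.re_nonneg (hM : 0 < M) (h : IsSectorial C M) : 0 ≤ (sesq C ξ ξ).re :=
  nonneg_of_mul_nonneg_right ((abs_nonneg _).trans (h ξ)) hM

theorem IsSectorial.norm_self_le (hM : 0 < M) (h : IsSectorial C M) :
    ‖sesq C ξ ξ‖ ≤ (1 + M) * (sesq C ξ ξ).re := by
  have h1 := Complex.norm_le_abs_re_add_abs_im (sesq C ξ ξ)
  rw [abs_of_nonneg (h.re_nonneg ξ hM)] at h1
  linarith [h ξ]

/-- A sectorial form is bounded by its real part, by polarization and the parallelogram law. -/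
theorem IsSectorial.norm_le (hM : 0 < M) (h : IsSectorial C M) :
    ‖sesq C ξ ζ‖ ≤ (1 + M) * ((sesq C ξ ξ).re + (sesq C ζ ζ).re) := by
  have e1 : 4 * sesq C ξ ζ = sesq C (ξ + ζ) (ξ + ζ) - sesq C (ξ + (-1 : ℂ) • ζ) (ξ + (-1 : ℂ) • ζ)
      + Complex.I * sesq C (ξ + Complex.I • ζ) (ξ + Complex.I • ζ)
      - Complex.I * sesq C (ξ + (-Complex.I) • ζ) (ξ + (-Complex.I) • ζ) := by
    simp only [sesq_add_left, sesq_add_right, sesq_smul_left, sesq_smul_right, map_neg, map_one,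
      Complex.conj_I]
    linear_combination (2 * sesq C ξ ζ - 2 * sesq C ζ ξ) * Complex.I_mul_I
  have e2 : (sesq C (ξ + ζ) (ξ + ζ)).re + (sesq C (ξ + (-1 : ℂ) • ζ) (ξ + (-1 : ℂ) • ζ)).re
      + (sesq C (ξ + Complex.I • ζ) (ξ + Complex.I • ζ)).re
      + (sesq C (ξ + (-Complex.I) • ζ) (ξ + (-Complex.I) • ζ)).re
      = 4 * ((sesq C ξ ξ).re + (sesq C ζ ζ).re) := by
    simp only [sesq_add_left, sesq_add_right, sesq_smul_left, sesq_smul_right, map_neg, map_one,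
      Complex.conj_I, Complex.add_re, Complex.mul_re, Complex.neg_re, Complex.neg_im, Complex.I_re,
      Complex.I_im, Complex.one_re, Complex.one_im, Complex.mul_im, Complex.add_im]
    ring
  have h1 := h.norm_self_le (ξ + ζ) hM
  have h2 := h.norm_self_le (ξ + (-1 : ℂ) • ζ) hM
  have h3 := h.norm_self_le (ξ + Complex.I • ζ) hM
  have h4 := h.norm_self_le (ξ + (-Complex.I) • ζ) hM
  have h5 : 4 * ‖sesq C ξ ζ‖ ≤ ‖sesq C (ξ + ζ) (ξ + ζ)‖
      + ‖sesq C (ξ + (-1 : ℂ) • ζ) (ξ + (-1 : ℂ) • ζ)‖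
      + ‖sesq C (ξ + Complex.I • ζ) (ξ + Complex.I • ζ)‖
      + ‖sesq C (ξ + (-Complex.I) • ζ) (ξ + (-Complex.I) • ζ)‖ := by
    have : 4 * ‖sesq C ξ ζ‖ = ‖4 * sesq C ξ ζ‖ := by simp
    rw [this, e1]
    refine (norm_sub_le _ _).trans (add_le_add ((norm_add_le _ _).trans
      (add_le_add (norm_sub_le _ _) ?_)) ?_) <;> simp
  have h6 : (1 + M) * (4 * ((sesq C ξ ξ).re + (sesq C ζ ζ).re)) =
    (1 + M) * ((sesq C (ξ + ζ) (ξ + ζ)).re)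
      + (1 + M) * (sesq C (ξ + (-1 : ℂ) • ζ) (ξ + (-1 : ℂ) • ζ)).re
      + (1 + M) * (sesq C (ξ + Complex.I • ζ) (ξ + Complex.I • ζ)).re
      + (1 + M) * (sesq C (ξ + (-Complex.I) • ζ) (ξ + (-Complex.I) • ζ)).re := by
    rw [← e2]; ring
  linarith

end Sesq

/-- The second order part of the form density at a point, where `p` and `q` are the gradients of the
two functions. -/
def principalDensity (A : Matrix (Fin d) (Fin d) ℝ) (p q : Fin d → EuclideanSpace ℂ (Fin m)) : ℂ :=
  ∑ i, ∑ k, ∑ l, (A k l : ℂ) * p l i * conj (q k i)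

/-- The drift part of the form density. -/
def driftDensity (B : Fin m → Fin m → Space d) (p : Fin d → EuclideanSpace ℂ (Fin m))
    (ζ : EuclideanSpace ℂ (Fin m)) : ℂ :=
  ∑ i, ∑ j, (∑ k, (B i j k : ℂ) * p k j) * conj (ζ i)

/-- The integrand of the form at a point, as a function of the `1`-jets `(ξ, p)` and `(ζ, q)` of the
two arguments. -/
def density (A : Matrix (Fin d) (Fin d) ℝ) (B : Fin m → Fin m → Space d)
    (C : Matrix (Fin m) (Fin m) ℝ) (ξ : EuclideanSpace ℂ (Fin m))
    (p : Fin d → EuclideanSpace ℂ (Fin m)) (ζ : EuclideanSpace ℂ (Fin m))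
    (q : Fin d → EuclideanSpace ℂ (Fin m)) : ℂ :=
  principalDensity A p q + driftDensity B p ζ + sesq C ξ ζ

/-- The density of the squared norm of the form domain. -/
noncomputable def normDensity (C : Matrix (Fin m) (Fin m) ℝ) (ξ : EuclideanSpace ℂ (Fin m))
    (p : Fin d → EuclideanSpace ℂ (Fin m)) : ℝ :=
  ‖ξ‖ ^ 2 + ∑ k, ‖p k‖ ^ 2 + (sesq C ξ ξ).re

variable {A : Matrix (Fin d) (Fin d) ℝ} {B : Fin m → Fin m → Space d}
  {C : Matrix (Fin m) (Fin m) ℝ}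

theorem density_add_left (ξ ξ' ζ : EuclideanSpace ℂ (Fin m))
    (p p' q : Fin d → EuclideanSpace ℂ (Fin m)) :
    density A B C (ξ + ξ') (p + p') ζ q = density A B C ξ p ζ q + density A B C ξ' p' ζ q := by
  simp only [density, principalDensity, driftDensity, sesq_add_left, Pi.add_apply, PiLp.add_apply,
    mul_add, add_mul, Finset.sum_add_distrib]
  ring

theorem density_add_right (ξ ζ ζ' : EuclideanSpace ℂ (Fin m))
    (p q q' : Fin d → EuclideanSpace ℂ (Fin m)) :
    density A B C ξ p (ζ + ζ') (q + q') = density A B C ξ p ζ q + density A B C ξ p ζ' q' := by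
  simp only [density, principalDensity, driftDensity, sesq_add_right, Pi.add_apply, PiLp.add_apply,
    map_add, mul_add, Finset.sum_add_distrib]
  ring

theorem density_smul_left (c : ℂ) (ξ ζ : EuclideanSpace ℂ (Fin m))
    (p q : Fin d → EuclideanSpace ℂ (Fin m)) :
    density A B C (c • ξ) (c • p) ζ q = c * density A B C ξ p ζ q := by
  simp only [density, principalDensity, driftDensity, sesq_smul_left, Pi.smul_apply,
    PiLp.smul_apply, smul_eq_mul, mul_add, Finset.mul_sum, Finset.sum_mul]
  congr 2
  · refine Finset.sum_congr rfl fun i _ => Finset.sum_congr rfl fun k _ =>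
      Finset.sum_congr rfl fun l _ => ?_
    ring
  · refine Finset.sum_congr rfl fun i _ => Finset.sum_congr rfl fun k _ =>
      Finset.sum_congr rfl fun l _ => ?_
    ring

theorem density_smul_right (c : ℂ) (ξ ζ : EuclideanSpace ℂ (Fin m))
    (p q : Fin d → EuclideanSpace ℂ (Fin m)) :
    density A B C ξ p (c • ζ) (c • q) = conj c * density A B C ξ p ζ q := by
  simp only [density, principalDensity, driftDensity, sesq_smul_right, Pi.smul_apply,
    PiLp.smul_apply, smul_eq_mul, mul_add, map_mul, Finset.mul_sum, Finset.sum_mul]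
  congr 2
  · refine Finset.sum_congr rfl fun i _ => Finset.sum_congr rfl fun k _ =>
      Finset.sum_congr rfl fun l _ => ?_
    ring
  · refine Finset.sum_congr rfl fun i _ => Finset.sum_congr rfl fun k _ =>
      Finset.sum_congr rfl fun l _ => ?_
    ring

theorem density_conj_symm (ξ ζ : EuclideanSpace ℂ (Fin m))
    (p q : Fin d → EuclideanSpace ℂ (Fin m)) :
    conj (density 1 0 (symmPart C) ζ q ξ p) = density 1 0 (symmPart C) ξ p ζ q := by
  simp only [density, principalDensity, driftDensity, sesq_symmPart, map_add, map_sum, map_mul,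
    Complex.conj_ofReal, Complex.conj_conj, map_div₀, Pi.zero_apply, PiLp.zero_apply,
    Complex.ofReal_zero, zero_mul, Finset.sum_const_zero, add_zero, Complex.conj_ofNat]
  congr 1
  · refine Finset.sum_congr rfl fun i _ => ?_
    rw [Finset.sum_comm]
    refine Finset.sum_congr rfl fun k _ => Finset.sum_congr rfl fun l _ => ?_
    simp only [Matrix.one_apply, eq_comm (a := k)]
    ring
  · ring

theorem density_one_zero_self (ξ : EuclideanSpace ℂ (Fin m))
    (p : Fin d → EuclideanSpace ℂ (Fin m)) :
    density 1 0 (symmPart C) ξ p ξ p = ((∑ k, ‖p k‖ ^ 2 + (sesq C ξ ξ).re : ℝ) : ℂ) := by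
  have h1 : principalDensity 1 p p = ((∑ k, ‖p k‖ ^ 2 : ℝ) : ℂ) := by
    simp only [principalDensity, Matrix.one_apply, EuclideanSpace.norm_sq_eq]
    rw [Finset.sum_comm]
    push_cast
    refine Finset.sum_congr rfl fun k _ => Finset.sum_congr rfl fun i _ => ?_
    rw [Finset.sum_eq_single k (fun l _ hl => by rw [if_neg hl.symm]; simp) (by simp), if_pos rfl,
      Complex.ofReal_one, one_mul, Complex.mul_conj, Complex.normSq_eq_norm_sq, Complex.ofReal_pow]
  simp only [density, h1, sesq_symmPart_self, driftDensity, Pi.zero_apply, PiLp.zero_apply,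
    Complex.ofReal_zero, zero_mul, Finset.sum_const_zero, add_zero]
  push_cast
  ring

theorem norm_coord_le (ξ : EuclideanSpace ℂ (Fin m)) (i : Fin m) : ‖ξ i‖ ≤ ‖ξ‖ :=
  PiLp.norm_apply_le ξ i

/-- Boundedness of the principal part in terms of a bound for the entries. -/
theorem norm_principalDensity_summand_le {a : ℝ} (ha : ∀ k l, |A k l| ≤ a)
    (p q : Fin d → EuclideanSpace ℂ (Fin m)) (i : Fin m) (k l : Fin d) :
    ‖(A k l : ℂ) * p l i * conj (q k i)‖ ≤ a * (‖p l‖ ^ 2 + ‖q k‖ ^ 2) := by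
  rw [norm_mul, norm_mul, RCLike.norm_conj, Complex.norm_real, Real.norm_eq_abs, mul_assoc]
  have h0 : 0 ≤ a := (abs_nonneg _).trans (ha k l)
  have h1 := norm_coord_le (p l) i
  have h2 := norm_coord_le (q k) i
  have h3 : ‖p l i‖ * ‖q k i‖ ≤ ‖p l‖ ^ 2 + ‖q k‖ ^ 2 := by
    have : ‖p l i‖ * ‖q k i‖ ≤ ‖p l‖ * ‖q k‖ := by gcongr
    nlinarith [sq_nonneg (‖p l‖ - ‖q k‖), sq_nonneg ‖p l‖, sq_nonneg ‖q k‖]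
  exact mul_le_mul (ha k l) h3 (by positivity) h0

theorem norm_driftDensity_summand_le {b : ℝ} (hb : ∀ i j, ‖B i j‖ ≤ b)
    (p : Fin d → EuclideanSpace ℂ (Fin m)) (ζ : EuclideanSpace ℂ (Fin m)) (i j : Fin m) :
    ‖(∑ k, (B i j k : ℂ) * p k j) * conj (ζ i)‖ ≤ b * (∑ k, ‖p k‖) * ‖ζ‖ := by
  have h0 : 0 ≤ b := (norm_nonneg _).trans (hb i j)
  rw [norm_mul, RCLike.norm_conj]
  refine mul_le_mul ?_ (norm_coord_le ζ i) (norm_nonneg _) (by positivity)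
  rw [Finset.mul_sum]
  refine norm_sum_le_of_le _ fun k _ => ?_
  rw [norm_mul, Complex.norm_real]
  refine mul_le_mul ((PiLp.norm_apply_le (B i j) k).trans (hb i j)) (norm_coord_le _ _)
    (norm_nonneg _) h0

theorem norm_driftDensity_le {b : ℝ} (hb : ∀ i j, ‖B i j‖ ≤ b)
    (p : Fin d → EuclideanSpace ℂ (Fin m)) (ζ : EuclideanSpace ℂ (Fin m)) :
    ‖driftDensity B p ζ‖ ≤ m * m * b * (∑ k, ‖p k‖) * ‖ζ‖ := by
  have h1 : ∀ i : Fin m, ‖∑ j, (∑ k, (B i j k : ℂ) * p k j) * conj (ζ i)‖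
      ≤ m * (b * (∑ k, ‖p k‖) * ‖ζ‖) := fun i => by
    refine (norm_sum_le_of_le _ fun j _ => norm_driftDensity_summand_le hb p ζ i j).trans ?_
    simp
  refine (norm_sum_le_of_le _ fun i _ => h1 i).trans (le_of_eq ?_)
  simp
  ring

theorem norm_principalDensity_le {a : ℝ} (ha : ∀ k l, |A k l| ≤ a)
    (p q : Fin d → EuclideanSpace ℂ (Fin m)) :
    ‖principalDensity A p q‖ ≤ m * d * a * (∑ k, ‖p k‖ ^ 2 + ∑ k, ‖q k‖ ^ 2) := by
  have h1 : ∀ i : Fin m, ‖∑ k, ∑ l, (A k l : ℂ) * p l i * conj (q k i)‖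
      ≤ d * a * (∑ k, ‖p k‖ ^ 2 + ∑ k, ‖q k‖ ^ 2) := fun i => by
    refine (norm_sum_le_of_le _ fun k _ => norm_sum_le_of_le _ fun l _ =>
      norm_principalDensity_summand_le ha p q i k l).trans (le_of_eq ?_)
    simp only [← Finset.mul_sum, Finset.sum_add_distrib, Finset.sum_const, Finset.card_univ,
      Fintype.card_fin, nsmul_eq_mul]
    ring
  refine (norm_sum_le_of_le _ fun i _ => h1 i).trans (le_of_eq ?_)
  simp
  ring

/-- The density is bounded by the norm densities of its arguments. -/
theorem norm_density_le {a b M : ℝ} (ha0 : 0 ≤ a) (ha : ∀ k l, |A k l| ≤ a) (hb0 : 0 ≤ b)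
    (hb : ∀ i j, ‖B i j‖ ≤ b) (hM : 0 < M) (hC : IsSectorial C M)
    (ξ ζ : EuclideanSpace ℂ (Fin m)) (p q : Fin d → EuclideanSpace ℂ (Fin m)) :
    ‖density A B C ξ p ζ q‖
      ≤ (m * d * a + m * m * b * (d + 1) + (1 + M)) * (normDensity C ξ p + normDensity C ζ q) := by
  have h1 := norm_principalDensity_le ha p q
  have h2 := norm_driftDensity_le hb p ζ
  have h3 := hC.norm_le ξ ζ hM
  have h4 : (∑ k, ‖p k‖) * ‖ζ‖ ≤ (d + 1) * (∑ k, ‖p k‖ ^ 2 + ‖ζ‖ ^ 2) := by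
    have : (∑ k, ‖p k‖) * ‖ζ‖ ≤ ∑ k, (‖p k‖ ^ 2 + ‖ζ‖ ^ 2) := by
      rw [Finset.sum_mul]
      refine Finset.sum_le_sum fun k _ => ?_
      nlinarith [sq_nonneg (‖p k‖ - ‖ζ‖), sq_nonneg ‖p k‖, sq_nonneg ‖ζ‖]
    refine this.trans ?_
    rw [Finset.sum_add_distrib]
    simp only [Finset.sum_const, Finset.card_univ, Fintype.card_fin, nsmul_eq_mul]
    have hs : 0 ≤ ∑ k, ‖p k‖ ^ 2 := by positivity
    have hd : (0 : ℝ) ≤ d := by positivity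
    nlinarith [mul_nonneg hd hs, sq_nonneg ‖ζ‖]
  have hN1 : ∑ k, ‖p k‖ ^ 2 + (sesq C ξ ξ).re + ‖ξ‖ ^ 2 = normDensity C ξ p := by
    rw [normDensity]; ring
  have hN2 : ∑ k, ‖q k‖ ^ 2 + (sesq C ζ ζ).re + ‖ζ‖ ^ 2 = normDensity C ζ q := by
    rw [normDensity]; ring
  have c1 := hC.re_nonneg ξ hM
  have c2 := hC.re_nonneg ζ hM
  have c3 : 0 ≤ ∑ k, ‖p k‖ ^ 2 := by positivity
  have c4 : 0 ≤ ∑ k, ‖q k‖ ^ 2 := by positivity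
  have c5 := sq_nonneg ‖ξ‖
  have c6 := sq_nonneg ‖ζ‖
  have h5 : ‖density A B C ξ p ζ q‖ ≤ ‖principalDensity A p q‖ + ‖driftDensity B p ζ‖
      + ‖sesq C ξ ζ‖ := (norm_add_le _ _).trans (by gcongr; exact norm_add_le _ _)
  have k1 : (m * d * a) * (∑ k, ‖p k‖ ^ 2 + ∑ k, ‖q k‖ ^ 2)
      ≤ (m * d * a) * (normDensity C ξ p + normDensity C ζ q) := by
    gcongr <;> linarith
  have k2 : m * m * b * (∑ k, ‖p k‖) * ‖ζ‖
      ≤ (m * m * b * (d + 1)) * (normDensity C ξ p + normDensity C ζ q) := by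
    have : m * m * b * (∑ k, ‖p k‖) * ‖ζ‖ = m * m * b * ((∑ k, ‖p k‖) * ‖ζ‖) := by ring
    rw [this]
    calc _ ≤ m * m * b * ((d + 1) * (∑ k, ‖p k‖ ^ 2 + ‖ζ‖ ^ 2)) := by gcongr
      _ = (m * m * b * (d + 1)) * (∑ k, ‖p k‖ ^ 2 + ‖ζ‖ ^ 2) := by ring
      _ ≤ _ := by
        gcongr <;> linarith
  have k3 : (1 + M) * ((sesq C ξ ξ).re + (sesq C ζ ζ).re)
      ≤ (1 + M) * (normDensity C ξ p + normDensity C ζ q) := by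
    gcongr <;> linarith
  linarith

/-- Ellipticity of a real matrix extends to complex vectors. -/
theorem le_re_principalDensity {η : ℝ}
    (hA : ∀ v : Space d, η * ‖v‖ ^ 2 ≤ ∑ k, ∑ l, A k l * v l * v k)
    (p : Fin d → EuclideanSpace ℂ (Fin m)) :
    η * ∑ k, ‖p k‖ ^ 2 ≤ (principalDensity A p p).re := by
  have h1 : ∑ k, ‖p k‖ ^ 2 = ∑ i, ∑ k, ‖p k i‖ ^ 2 := by
    simp only [EuclideanSpace.norm_sq_eq]
    rw [Finset.sum_comm]
  rw [h1, principalDensity, Complex.re_sum, Finset.mul_sum]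
  refine Finset.sum_le_sum fun i _ => ?_
  have h2 := hA (WithLp.toLp 2 fun k => (p k i).re)
  have h3 := hA (WithLp.toLp 2 fun k => (p k i).im)
  have h4 : ∑ k, ‖p k i‖ ^ 2 = ‖(WithLp.toLp 2 fun k => (p k i).re : Space d)‖ ^ 2
      + ‖(WithLp.toLp 2 fun k => (p k i).im : Space d)‖ ^ 2 := by
    simp only [EuclideanSpace.norm_sq_eq, Real.norm_eq_abs, sq_abs, ← Finset.sum_add_distrib,
      ← Complex.normSq_eq_norm_sq, Complex.normSq_apply]
    refine Finset.sum_congr rfl fun k _ => ?_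
    ring
  rw [h4, mul_add]
  refine (add_le_add h2 h3).trans (le_of_eq ?_)
  rw [Complex.re_sum, ← Finset.sum_add_distrib]
  refine Finset.sum_congr rfl fun k _ => ?_
  rw [Complex.re_sum, ← Finset.sum_add_distrib]
  refine Finset.sum_congr rfl fun l _ => ?_
  simp only [Complex.mul_re, Complex.mul_im, Complex.ofReal_re, Complex.ofReal_im, Complex.conj_re,
    Complex.conj_im]
  ring

/-- Gårding's inequality for the density. -/
theorem le_re_density {η b : ℝ} (hη : 0 < η)
    (hA : ∀ v : Space d, η * ‖v‖ ^ 2 ≤ ∑ k, ∑ l, A k l * v l * v k)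
    (hb : ∀ i j, ‖B i j‖ ≤ b) (hC : ∀ ξ, 0 ≤ (sesq C ξ ξ).re)
    (ξ : EuclideanSpace ℂ (Fin m)) (p : Fin d → EuclideanSpace ℂ (Fin m)) :
    min (η / 2) 1 * normDensity C ξ p
      ≤ (density A B C ξ p ξ p).re + (d * ((m * m * b) ^ 2 / (2 * η)) + 1) * ‖ξ‖ ^ 2 := by
  have h1 := le_re_principalDensity hA p
  have h2 := norm_driftDensity_le hb p ξ
  have h3 : m * m * b * (∑ k, ‖p k‖) * ‖ξ‖
      ≤ η / 2 * ∑ k, ‖p k‖ ^ 2 + d * ((m * m * b) ^ 2 / (2 * η)) * ‖ξ‖ ^ 2 := by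
    have e1 : m * m * b * (∑ k, ‖p k‖) * ‖ξ‖ = ∑ k, m * m * b * ‖p k‖ * ‖ξ‖ := by
      rw [Finset.mul_sum, Finset.sum_mul]
    have e2 : η / 2 * ∑ k, ‖p k‖ ^ 2 + d * ((m * m * b) ^ 2 / (2 * η)) * ‖ξ‖ ^ 2
        = ∑ k : Fin d, (η / 2 * ‖p k‖ ^ 2 + (m * m * b) ^ 2 / (2 * η) * ‖ξ‖ ^ 2) := by
      rw [Finset.sum_add_distrib, Finset.mul_sum]
      simp
      ring
    rw [e1, e2]
    refine Finset.sum_le_sum fun k _ => ?_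
    have h4 : η / 2 * ‖p k‖ ^ 2 + (m * m * b) ^ 2 / (2 * η) * ‖ξ‖ ^ 2 - m * m * b * ‖p k‖ * ‖ξ‖
        = (η * ‖p k‖ - m * m * b * ‖ξ‖) ^ 2 / (2 * η) := by
      field_simp
      ring
    have h5 : 0 ≤ (η * ‖p k‖ - m * m * b * ‖ξ‖) ^ 2 / (2 * η) := by positivity
    linarith
  have h4 := neg_abs_le (driftDensity B p ξ).re
  have h5 := (Complex.abs_re_le_norm (driftDensity B p ξ)).trans h2
  have h6 := hC ξ
  have h7 : 0 ≤ ∑ k, ‖p k‖ ^ 2 := by positivity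
  have h8 : min (η / 2) 1 * ∑ k, ‖p k‖ ^ 2 ≤ η / 2 * ∑ k, ‖p k‖ ^ 2 := by
    gcongr
    exact min_le_left _ _
  have h9 : min (η / 2) 1 * (‖ξ‖ ^ 2 + (sesq C ξ ξ).re) ≤ 1 * (‖ξ‖ ^ 2 + (sesq C ξ ξ).re) := by
    gcongr
    exact min_le_right _ _
  rw [density, Complex.add_re, Complex.add_re, normDensity]
  linarith

/-- An off-diagonally nonpositive matrix pairs a positive part nonnegatively with the corresponding
negative part `ζ ≤ 0`. -/
theorem re_sesq_nonneg_of_disjoint {ξ ζ : EuclideanSpace ℂ (Fin m)}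
    (hC : ∀ i j, i ≠ j → C i j ≤ 0) (hξ : ∀ i, (ξ i).im = 0) (hξ0 : ∀ i, 0 ≤ (ξ i).re)
    (hζ0 : ∀ i, (ζ i).re ≤ 0) (hor : ∀ i, (ξ i).re = 0 ∨ (ζ i).re = 0) :
    0 ≤ (sesq C ξ ζ).re := by
  rw [sesq, Complex.re_sum]
  refine Finset.sum_nonneg fun i _ => ?_
  rw [Complex.re_sum]
  refine Finset.sum_nonneg fun j _ => ?_
  have e : ((C i j : ℂ) * ξ j * conj (ζ i)).re = C i j * ((ξ j).re * (ζ i).re) := by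
    simp [hξ j]
    ring
  rw [e]
  by_cases hij : i = j
  · subst hij
    rcases hor i with h | h <;> simp [h]
  · exact mul_nonneg_of_nonpos_of_nonpos (hC i j hij)
      (mul_nonpos_of_nonneg_of_nonpos (hξ0 j) (hζ0 i))

/-- The pointwise inequality behind the positivity of the semigroup. Its arguments are the jet
`(ξ, p)` of the positive part `P u` of a function `u` and the jet `(ζ, q)` of `u - P u`. -/
theorem re_density_nonneg {ξ ζ : EuclideanSpace ℂ (Fin m)}
    {p q : Fin d → EuclideanSpace ℂ (Fin m)} (hB : ∀ i j, i ≠ j → B i j = 0)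
    (hC : ∀ i j, i ≠ j → C i j ≤ 0) (hξ : ∀ i, (ξ i).im = 0) (hξ0 : ∀ i, 0 ≤ (ξ i).re)
    (hζ0 : ∀ i, (ζ i).re ≤ 0) (hor : ∀ i, (ξ i).re = 0 ∨ (ζ i).re = 0)
    (hp : ∀ k i, (p k i).im = 0) (hp0 : ∀ k i, (ξ i).re = 0 → (p k i).re = 0)
    (hq0 : ∀ k i, (ζ i).re = 0 → (q k i).re = 0) :
    0 ≤ (density A B C ξ p ζ q).re := by
  have h3 := re_sesq_nonneg_of_disjoint hC hξ hξ0 hζ0 hor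
  have h1 : (principalDensity A p q).re = 0 := by
    rw [principalDensity, Complex.re_sum]
    refine Finset.sum_eq_zero fun i _ => ?_
    rw [Complex.re_sum]
    refine Finset.sum_eq_zero fun k _ => ?_
    rw [Complex.re_sum]
    refine Finset.sum_eq_zero fun l _ => ?_
    have e : ((A k l : ℂ) * p l i * conj (q k i)).re = A k l * ((p l i).re * (q k i).re) := by
      simp [hp l i]
      ring
    rw [e]
    rcases hor i with h | h
    · simp [hp0 l i h]
    · simp [hq0 k i h]
  have h2 : (driftDensity B p ζ).re = 0 := by
    rw [driftDensity, Complex.re_sum]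
    refine Finset.sum_eq_zero fun i _ => ?_
    rw [Complex.re_sum]
    refine Finset.sum_eq_zero fun j _ => ?_
    by_cases hij : i = j
    · subst hij
      rw [Finset.sum_mul, Complex.re_sum]
      refine Finset.sum_eq_zero fun k _ => ?_
      have e : ((B i i k : ℂ) * p k i * conj (ζ i)).re = B i i k * ((p k i).re * (ζ i).re) := by
        simp [hp k i]
        ring
      rw [e]
      rcases hor i with h | h
      · simp [hp0 k i h]
      · simp [h]
    · simp [hB i j hij]
  rw [density, Complex.add_re, Complex.add_re, h1, h2]
  simpa using h3

end Density

section FormIntegral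

variable {d m : ℕ}

/-! ### The form as an integral of its density -/

/-- The weak gradient at a point. -/
noncomputable def weakGrad (f : VLp d m 2) (x : Space d) : Fin d → EuclideanSpace ℂ (Fin m) :=
  fun k => weakPartial k f x

theorem integrable_norm_sq (f : VLp d m 2) : Integrable (fun x => ‖f x‖ ^ 2) volume :=
  (Lp.memLp f).norm.integrable_sq

theorem integral_norm_sq (f : VLp d m 2) : ∫ x, ‖f x‖ ^ 2 = ‖f‖ ^ 2 := by
  have h1 : inner ℂ f f = ((∫ x, ‖f x‖ ^ 2 : ℝ) : ℂ) := by
    rw [L2.inner_def, ← integral_complex_ofReal]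
    refine integral_congr_ae (Eventually.of_forall fun x => ?_)
    simp only
    rw [inner_self_eq_norm_sq_to_K]
    push_cast
    rfl
  have h2 := congrArg Complex.re h1
  rw [Complex.ofReal_re] at h2
  rw [← h2]
  exact inner_self_eq_norm_sq (𝕜 := ℂ) f

variable {Q : Space d → Matrix (Fin d) (Fin d) ℝ} {F : Fin m → Fin m → Space d → Space d}
  {V : Space d → Matrix (Fin m) (Fin m) ℝ}

/-- An elliptic symmetric matrix has bounded entries. -/
theorem abs_entry_le_of_isSymm {A : Matrix (Fin d) (Fin d) ℝ} {η : ℝ} (hs : A.IsSymm)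
    (h0 : ∀ v : Space d, 0 ≤ ∑ k, ∑ l, A k l * v l * v k)
    (h1 : ∀ v : Space d, ∑ k, ∑ l, A k l * v l * v k ≤ η * ‖v‖ ^ 2) (k l : Fin d) :
    |A k l| ≤ η := by
  have hq : ∀ v w : Space d, ∑ k, ∑ l, A k l * (v + w) l * (v + w) k
      = ∑ k, ∑ l, A k l * v l * v k + ∑ k, ∑ l, A k l * w l * w k
        + 2 * ∑ k, ∑ l, A k l * w l * v k := by
    intro v w
    have e : ∑ k, ∑ l, A k l * v l * w k = ∑ k, ∑ l, A k l * w l * v k := by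
      rw [Finset.sum_comm]
      refine Finset.sum_congr rfl fun i _ => Finset.sum_congr rfl fun j _ => ?_
      rw [hs.apply i j]
      ring
    have e' : ∑ k, ∑ l, A k l * (v + w) l * (v + w) k
        = ∑ k, ∑ l, A k l * v l * v k + ∑ k, ∑ l, A k l * w l * w k
          + (∑ k, ∑ l, A k l * w l * v k + ∑ k, ∑ l, A k l * v l * w k) := by
      simp only [← Finset.sum_add_distrib, PiLp.add_apply]
      refine Finset.sum_congr rfl fun i _ => Finset.sum_congr rfl fun j _ => ?_
      ring
    rw [e', e, two_mul]
  have hs1 : ∀ i j : Fin d, ∑ k, ∑ l, A k l * (EuclideanSpace.single j (1 : ℝ) : Space d) l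
      * (EuclideanSpace.single i (1 : ℝ) : Space d) k = A i j := by
    intro i j
    simp
  have hn : ∀ i : Fin d, ‖(EuclideanSpace.single i (1 : ℝ) : Space d)‖ = 1 := fun i => by simp
  have a1 := h0 (EuclideanSpace.single k 1)
  have a2 := h1 (EuclideanSpace.single k 1)
  have b1 := h0 (EuclideanSpace.single l 1)
  have b2 := h1 (EuclideanSpace.single l 1)
  have c1 := h0 (EuclideanSpace.single k 1 + EuclideanSpace.single l 1)
  rw [hq, hs1, hs1, hs1] at c1
  have c2 := h0 (EuclideanSpace.single k 1 + (-1 : ℝ) • EuclideanSpace.single l 1)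
  rw [hq, hs1] at c2
  simp only [PiLp.smul_apply, smul_eq_mul, neg_mul, one_mul, mul_neg, neg_neg,
    Finset.sum_neg_distrib, hs1] at c2
  rw [hs1, hn] at a2 b2
  rw [abs_le]
  constructor <;> linarith

theorem HypH1.exists_bounds (hyp : HypH1 Q F V) : ∃ η a b M : ℝ, 0 < η ∧ 0 ≤ a ∧ 0 ≤ b ∧ 0 < M ∧
    (∀ x (v : Space d), η * ‖v‖ ^ 2 ≤ ∑ k, ∑ l, Q x k l * v l * v k) ∧
    (∀ x k l, |Q x k l| ≤ a) ∧ (∀ᵐ x, ∀ i j, ‖F i j x‖ ≤ b) ∧ ∀ x, IsSectorial (V x) M := by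
  obtain ⟨η₁, η₂, h1, h2, hQ⟩ := hyp.Q_elliptic
  obtain ⟨M, hM, hV⟩ := hyp.V_sectorial
  have hF : ∀ i j, ∃ b : ℝ, 0 ≤ b ∧ ∀ᵐ x, ‖F i j x‖ ≤ b := by
    intro i j
    have hfin : eLpNormEssSup (F i j) volume ≠ ⊤ := by
      have := (hyp.F_bounded i j).2
      rw [eLpNorm_exponent_top] at this
      exact this.ne
    refine ⟨(eLpNormEssSup (F i j) volume).toReal, ENNReal.toReal_nonneg, ?_⟩
    filter_upwards [enorm_ae_le_eLpNormEssSup (F i j) volume] with x hx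
    rw [← toReal_enorm]
    exact ENNReal.toReal_mono hfin hx
  choose b hb0 hb using hF
  have hble : ∀ i j, b i j ≤ ∑ i, ∑ j, b i j := fun i j =>
    (Finset.single_le_sum (f := fun j => b i j) (fun j _ => hb0 i j) (Finset.mem_univ j)).trans
      (Finset.single_le_sum (f := fun i => ∑ j, b i j)
        (fun i _ => Finset.sum_nonneg fun j _ => hb0 i j) (Finset.mem_univ i))
  refine ⟨η₁, η₂, ∑ i, ∑ j, b i j, M, h1, h2.le,
    Finset.sum_nonneg fun i _ => Finset.sum_nonneg fun j _ => hb0 i j, hM,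
    fun x v => (hQ x v).1, fun x k l => abs_entry_le_of_isSymm (hyp.Q_symm x)
      (fun v => le_trans (by positivity) (hQ x v).1) (fun v => (hQ x v).2) k l, ?_, hV⟩
  rw [ae_all_iff]
  intro i
  rw [ae_all_iff]
  intro j
  filter_upwards [hb i j] with x hx using hx.trans (hble i j)

theorem HypH1.re_sesq_nonneg (hyp : HypH1 Q F V) (x : Space d) (ξ : EuclideanSpace ℂ (Fin m)) :
    0 ≤ (sesq (V x) ξ ξ).re := by
  obtain ⟨M, hM, hV⟩ := hyp.V_sectorial
  exact IsSectorial.re_nonneg (C := V x) ξ hM (hV x)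

/-- The coefficients of the form that gives the inner product on the form domain. -/
theorem HypH1.symm (hyp : HypH1 Q F V) :
    HypH1 (fun _ : Space d => (1 : Matrix (Fin d) (Fin d) ℝ))
      (0 : Fin m → Fin m → Space d → Space d) fun x => symmPart (V x) where
  Q_measurable _ _ := measurable_const
  Q_symm _ := Matrix.isSymm_one
  Q_elliptic := ⟨1, 1, one_pos, one_pos, fun _ ξ => by
    have : ∑ k, ∑ l, (1 : Matrix (Fin d) (Fin d) ℝ) k l * ξ l * ξ k = 1 * ‖ξ‖ ^ 2 := by
      rw [EuclideanSpace.norm_sq_eq]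
      simp [Matrix.one_apply, sq]
    exact ⟨this.ge, this.le⟩⟩
  F_bounded _ _ := MemLp.zero
  V_locInt i j := by
    have h1 := ((hyp.V_locInt i j).add (hyp.V_locInt j i)).smul (1 / 2 : ℝ)
    exact h1
  V_sectorial := ⟨1, one_pos, fun x ξ => by
    rw [sesq_symmPart_self, Complex.ofReal_im, abs_zero, one_mul, Complex.ofReal_re]
    exact hyp.re_sesq_nonneg x ξ⟩

theorem formDomain_symmPart : formDomain (fun x => symmPart (V x)) = formDomain V := by
  simp only [formDomain, symmPart_symmPart]

theorem aestronglyMeasurable_coord (f : VLp d m 2) (i : Fin m) :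
    AEStronglyMeasurable (fun x => f x i) volume :=
  (EuclideanSpace.proj (𝕜 := ℂ) i).continuous.comp_aestronglyMeasurable
    (Lp.aestronglyMeasurable f)

theorem aestronglyMeasurable_sesq (hyp : HypH1 Q F V) (f g : VLp d m 2) :
    AEStronglyMeasurable (fun x => sesq (V x) (f x) (g x)) volume := by
  unfold sesq
  refine Finset.aestronglyMeasurable_fun_sum _ fun i _ =>
    Finset.aestronglyMeasurable_fun_sum _ fun j _ => ?_
  exact ((Complex.continuous_ofReal.comp_aestronglyMeasurable
    (hyp.V_locInt i j).aestronglyMeasurable).mul (aestronglyMeasurable_coord f j)).mul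
    (Complex.continuous_conj.comp_aestronglyMeasurable (aestronglyMeasurable_coord g i))

theorem mem_formDomain_iff {f : VLp d m 2} :
    f ∈ formDomain V ↔ IsH1 f ∧ Integrable (fun x => (sesq (V x) (f x) (f x)).re) volume := by
  refine and_congr_right fun _ => ?_
  simp only [sesq_symmPart_self]
  exact ⟨fun h => by simpa using h.re, fun h => h.ofReal⟩

theorem integrable_sesq (hyp : HypH1 Q F V) {f g : VLp d m 2} (hf : f ∈ formDomain V)
    (hg : g ∈ formDomain V) : Integrable (fun x => sesq (V x) (f x) (g x)) volume := by
  obtain ⟨M, hM, hV⟩ := hyp.V_sectorial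
  refine Integrable.mono' (((mem_formDomain_iff.1 hf).2.add (mem_formDomain_iff.1 hg).2).const_mul
    (1 + M)) (aestronglyMeasurable_sesq hyp f g) (Eventually.of_forall fun x => ?_)
  exact IsSectorial.norm_le (C := V x) (f x) (g x) hM (hV x)

theorem integrable_principal_summand (hyp : HypH1 Q F V) (p q : VLp d m 2) (i : Fin m)
    (k l : Fin d) : Integrable (fun x => (Q x k l : ℂ) * p x i * conj (q x i)) volume := by
  obtain ⟨η, a, b, M, -, -, -, -, -, hQ, -, -⟩ := hyp.exists_bounds
  refine Integrable.mono' (((integrable_norm_sq p).add (integrable_norm_sq q)).const_mul a) ?_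
    (Eventually.of_forall fun x => ?_)
  · exact ((Complex.continuous_ofReal.comp_aestronglyMeasurable
      (hyp.Q_measurable k l).aestronglyMeasurable).mul (aestronglyMeasurable_coord p i)).mul
      (Complex.continuous_conj.comp_aestronglyMeasurable (aestronglyMeasurable_coord q i))
  · exact norm_principalDensity_summand_le (hQ x) (fun _ => p x) (fun _ => q x) i k l

theorem integrable_drift_summand (hyp : HypH1 Q F V) (p : Fin d → VLp d m 2) (g : VLp d m 2)
    (i j : Fin m) :
    Integrable (fun x => (∑ k, (F i j x k : ℂ) * p k x j) * conj (g x i)) volume := by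
  obtain ⟨η, a, b, M, -, -, hb0, -, -, -, hF, -⟩ := hyp.exists_bounds
  refine Integrable.mono' (g := fun x => b * ∑ k, (‖p k x‖ ^ 2 + ‖g x‖ ^ 2)) ?_ ?_ ?_
  · exact (integrable_finsetSum _ fun k _ =>
      (integrable_norm_sq (p k)).add (integrable_norm_sq g)).const_mul b
  · refine AEStronglyMeasurable.mul (Finset.aestronglyMeasurable_fun_sum _ fun k _ => ?_)
      (Complex.continuous_conj.comp_aestronglyMeasurable (aestronglyMeasurable_coord g i))
    exact (Complex.continuous_ofReal.comp_aestronglyMeasurable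
      ((EuclideanSpace.proj (𝕜 := ℝ) k).continuous.comp_aestronglyMeasurable
        (hyp.F_bounded i j).1)).mul (aestronglyMeasurable_coord (p k) j)
  · filter_upwards [hF] with x hx
    refine (norm_driftDensity_summand_le (B := fun i j => F i j x) hx (fun k => p k x) (g x)
      i j).trans ?_
    rw [mul_assoc, Finset.sum_mul]
    gcongr with k
    nlinarith [sq_nonneg (‖p k x‖ - ‖g x‖), sq_nonneg ‖p k x‖, sq_nonneg ‖g x‖]

theorem integrable_density (hyp : HypH1 Q F V) {f g : VLp d m 2} (hf : f ∈ formDomain V)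
    (hg : g ∈ formDomain V) :
    Integrable (fun x => density (Q x) (fun i j => F i j x) (V x) (f x) (weakGrad f x) (g x)
      (weakGrad g x)) volume := by
  refine Integrable.add (Integrable.add ?_ ?_) (integrable_sesq hyp hf hg)
  · exact integrable_finsetSum _ fun i _ => integrable_finsetSum _ fun k _ =>
      integrable_finsetSum _ fun l _ => integrable_principal_summand hyp _ _ i k l
  · exact integrable_finsetSum _ fun i _ => integrable_finsetSum _ fun j _ =>
      integrable_drift_summand hyp (fun k => weakPartial k f) g i j

theorem form_eq_integral_density (hyp : HypH1 Q F V) {f g : VLp d m 2} (hf : f ∈ formDomain V)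
    (hg : g ∈ formDomain V) :
    form Q F V f g = ∫ x, density (Q x) (fun i j => F i j x) (V x) (f x) (weakGrad f x) (g x)
      (weakGrad g x) := by
  have h1 : ∀ i, Integrable (fun x => ∑ k, ∑ l, (Q x k l : ℂ) * weakPartial l f x i
      * conj (weakPartial k g x i)) volume := fun i => integrable_finsetSum _ fun k _ =>
      integrable_finsetSum _ fun l _ => integrable_principal_summand hyp _ _ i k l
  have h2 : ∀ i j, Integrable (fun x => (∑ k, (F i j x k : ℂ) * weakPartial k f x j)
      * conj (g x i)) volume := fun i j =>
      integrable_drift_summand hyp (fun k => weakPartial k f) g i j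
  have h3 : Integrable (fun x => principalDensity (Q x) (weakGrad f x) (weakGrad g x)) volume :=
    integrable_finsetSum _ fun i _ => h1 i
  have h4 : Integrable (fun x => driftDensity (fun i j => F i j x) (weakGrad f x) (g x)) volume :=
    integrable_finsetSum _ fun i _ => integrable_finsetSum _ fun j _ => h2 i j
  have e1 := integral_add (h3.add h4) (integrable_sesq hyp hf hg)
  have e2 := integral_add h3 h4
  have e3 : ∫ x, principalDensity (Q x) (weakGrad f x) (weakGrad g x) = _ :=
    integral_finsetSum _ fun i _ => h1 i
  have e4 : ∫ x, driftDensity (fun i j => F i j x) (weakGrad f x) (g x) = _ :=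
    (integral_finsetSum _ fun i _ => integrable_finsetSum _ fun j _ => h2 i j).trans
      (Finset.sum_congr rfl fun i _ => integral_finsetSum _ fun j _ => h2 i j)
  refine Eq.trans ?_ e1.symm
  refine congrArg₂ (· + ·) ?_ rfl
  refine Eq.trans ?_ e2.symm
  rw [e3, e4]
  rfl

theorem IsH1.add {f g : VLp d m 2} (hf : IsH1 f) (hg : IsH1 g) : IsH1 (f + g) := fun k =>
  ⟨_, (hf.isWeakPartial_weakPartial k).add (hg.isWeakPartial_weakPartial k)⟩

theorem IsH1.smul {f : VLp d m 2} (hf : IsH1 f) (c : ℂ) : IsH1 (c • f) := fun k =>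
  ⟨_, (hf.isWeakPartial_weakPartial k).smul c⟩

theorem weakPartial_add {f g : VLp d m 2} (hf : IsH1 f) (hg : IsH1 g) (k : Fin d) :
    weakPartial k (f + g) = weakPartial k f + weakPartial k g :=
  ((hf.isWeakPartial_weakPartial k).add (hg.isWeakPartial_weakPartial k)).weakPartial_eq

theorem weakPartial_smul {f : VLp d m 2} (hf : IsH1 f) (c : ℂ) (k : Fin d) :
    weakPartial k (c • f) = c • weakPartial k f :=
  ((hf.isWeakPartial_weakPartial k).smul c).weakPartial_eq

theorem ae_jet_add {f g : VLp d m 2} (hf : IsH1 f) (hg : IsH1 g) :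
    ∀ᵐ x, (f + g) x = f x + g x ∧ weakGrad (f + g) x = weakGrad f x + weakGrad g x := by
  have h : ∀ᵐ x, ∀ k, weakPartial k (f + g) x = weakPartial k f x + weakPartial k g x := by
    rw [ae_all_iff]
    intro k
    rw [weakPartial_add hf hg]
    exact Lp.coeFn_add _ _
  filter_upwards [h, Lp.coeFn_add f g] with x h1 h2
  exact ⟨h2, funext h1⟩

theorem ae_jet_smul {f : VLp d m 2} (hf : IsH1 f) (c : ℂ) :
    ∀ᵐ x, (c • f) x = c • f x ∧ weakGrad (c • f) x = c • weakGrad f x := by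
  have h : ∀ᵐ x, ∀ k, weakPartial k (c • f) x = c • weakPartial k f x := by
    rw [ae_all_iff]
    intro k
    rw [weakPartial_smul hf]
    exact Lp.coeFn_smul _ _
  filter_upwards [h, Lp.coeFn_smul c f] with x h1 h2
  exact ⟨h2, funext h1⟩

theorem add_mem_formDomain (hyp : HypH1 Q F V) {f g : VLp d m 2} (hf : f ∈ formDomain V)
    (hg : g ∈ formDomain V) : f + g ∈ formDomain V := by
  rw [mem_formDomain_iff]
  refine ⟨hf.1.add hg.1, ?_⟩
  have h1 := ((integrable_sesq hyp hf hf).add (integrable_sesq hyp hf hg)).add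
    ((integrable_sesq hyp hg hf).add (integrable_sesq hyp hg hg))
  have h2 : Integrable (fun x => (sesq (V x) ((f + g) x) ((f + g) x))) volume := by
    refine h1.congr ?_
    filter_upwards [Lp.coeFn_add f g] with x hx
    rw [hx]
    simp only [Pi.add_apply, sesq_add_left, sesq_add_right]
    ring
  simpa using h2.re

theorem smul_mem_formDomain {f : VLp d m 2} (hf : f ∈ formDomain V) (c : ℂ) :
    c • f ∈ formDomain V := by
  refine ⟨hf.1.smul c, ?_⟩
  refine (hf.2.const_mul (c * conj c)).congr ?_
  filter_upwards [Lp.coeFn_smul c f] with x hx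
  rw [hx]
  simp only [Pi.smul_apply, sesq_smul_left, sesq_smul_right]
  ring

theorem zero_mem_formDomain : (0 : VLp d m 2) ∈ formDomain V := by
  have h1 : (0 : VLp d m 2) =ᵐ[volume] 0 := Lp.coeFn_zero _ _ _
  refine ⟨fun k => ⟨0, fun φ hφ hc => ?_⟩, ?_⟩
  · have h2 : ∀ ψ : Space d → ℝ, ∫ x, ψ x • (0 : VLp d m 2) x = 0 := fun ψ =>
      integral_eq_zero_of_ae (by filter_upwards [h1] with x hx; rw [hx]; simp)
    rw [h2 φ, neg_zero]
    exact h2 _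
  · refine (integrable_zero _ ℂ volume).congr ?_
    filter_upwards [h1] with x hx
    rw [hx]
    simp [sesq]

theorem form_add_left (hyp : HypH1 Q F V) {f f' g : VLp d m 2} (hf : f ∈ formDomain V)
    (hf' : f' ∈ formDomain V) (hg : g ∈ formDomain V) :
    form Q F V (f + f') g = form Q F V f g + form Q F V f' g := by
  rw [form_eq_integral_density hyp (add_mem_formDomain hyp hf hf') hg,
    form_eq_integral_density hyp hf hg, form_eq_integral_density hyp hf' hg,
    ← integral_add (integrable_density hyp hf hg) (integrable_density hyp hf' hg)]
  refine integral_congr_ae ?_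
  filter_upwards [ae_jet_add hf.1 hf'.1] with x hx
  rw [hx.1, hx.2, density_add_left]

theorem form_add_right (hyp : HypH1 Q F V) {f g g' : VLp d m 2} (hf : f ∈ formDomain V)
    (hg : g ∈ formDomain V) (hg' : g' ∈ formDomain V) :
    form Q F V f (g + g') = form Q F V f g + form Q F V f g' := by
  rw [form_eq_integral_density hyp hf (add_mem_formDomain hyp hg hg'),
    form_eq_integral_density hyp hf hg, form_eq_integral_density hyp hf hg',
    ← integral_add (integrable_density hyp hf hg) (integrable_density hyp hf hg')]
  refine integral_congr_ae ?_
  filter_upwards [ae_jet_add hg.1 hg'.1] with x hx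
  rw [hx.1, hx.2, density_add_right]

theorem form_smul_left (hyp : HypH1 Q F V) {f g : VLp d m 2} (hf : f ∈ formDomain V)
    (hg : g ∈ formDomain V) (c : ℂ) : form Q F V (c • f) g = c * form Q F V f g := by
  rw [form_eq_integral_density hyp (smul_mem_formDomain hf c) hg,
    form_eq_integral_density hyp hf hg, ← integral_const_mul]
  refine integral_congr_ae ?_
  filter_upwards [ae_jet_smul hf.1 c] with x hx
  rw [hx.1, hx.2, density_smul_left]

theorem form_smul_right (hyp : HypH1 Q F V) {f g : VLp d m 2} (hf : f ∈ formDomain V)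
    (hg : g ∈ formDomain V) (c : ℂ) : form Q F V f (c • g) = conj c * form Q F V f g := by
  rw [form_eq_integral_density hyp hf (smul_mem_formDomain hg c),
    form_eq_integral_density hyp hf hg, ← integral_const_mul]
  refine integral_congr_ae ?_
  filter_upwards [ae_jet_smul hg.1 c] with x hx
  rw [hx.1, hx.2, density_smul_right]

/-- The form that gives the inner product on the form domain. -/
noncomputable def symmForm (V : Space d → Matrix (Fin m) (Fin m) ℝ) (f g : VLp d m 2) : ℂ :=
  form (fun _ => 1) 0 (fun x => symmPart (V x)) f g

theorem symmForm_conj_symm (hyp : HypH1 Q F V) {f g : VLp d m 2} (hf : f ∈ formDomain V)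
    (hg : g ∈ formDomain V) : conj (symmForm V g f) = symmForm V f g := by
  rw [← formDomain_symmPart] at hf hg
  rw [symmForm, symmForm, form_eq_integral_density hyp.symm hf hg,
    form_eq_integral_density hyp.symm hg hf, ← integral_conj]
  exact integral_congr_ae (Eventually.of_forall fun x => density_conj_symm _ _ _ _)

theorem symmForm_self (hyp : HypH1 Q F V) {f : VLp d m 2} (hf : f ∈ formDomain V) :
    symmForm V f f = ((∑ k, ‖weakPartial k f‖ ^ 2
      + ∫ x, (sesq (V x) (f x) (f x)).re : ℝ) : ℂ) := by
  have hf' := hf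
  rw [← formDomain_symmPart] at hf'
  rw [symmForm, form_eq_integral_density hyp.symm hf' hf']
  have h1 : ∀ x, density 1 (fun i j => (0 : Fin m → Fin m → Space d → Space d) i j x)
      (symmPart (V x)) (f x) (weakGrad f x) (f x) (weakGrad f x)
      = ((∑ k, ‖weakPartial k f x‖ ^ 2 + (sesq (V x) (f x) (f x)).re : ℝ) : ℂ) := fun x =>
    density_one_zero_self (f x) (weakGrad f x)
  simp_rw [h1]
  rw [integral_complex_ofReal, integral_add (integrable_finsetSum _ fun k _ =>
    integrable_norm_sq (weakPartial k f)) (mem_formDomain_iff.1 hf).2,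
    integral_finsetSum _ fun k _ => integrable_norm_sq (weakPartial k f)]
  simp_rw [integral_norm_sq]

theorem integral_sesq_nonneg (hyp : HypH1 Q F V) (f : VLp d m 2) :
    0 ≤ ∫ x, (sesq (V x) (f x) (f x)).re :=
  integral_nonneg fun x => hyp.re_sesq_nonneg x (f x)

end FormIntegral

section FormSpace

variable {d m : ℕ} {Q : Space d → Matrix (Fin d) (Fin d) ℝ}
  {F : Fin m → Fin m → Space d → Space d} {V : Space d → Matrix (Fin m) (Fin m) ℝ}

/-! ### The form domain as a Hilbert space -/

/-- The form domain as a subspace of `L²`. -/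
def formSubmodule (hyp : HypH1 Q F V) : Submodule ℂ (VLp d m 2) where
  carrier := formDomain V
  add_mem' := add_mem_formDomain hyp
  zero_mem' := zero_mem_formDomain
  smul_mem' c _ hf := smul_mem_formDomain hf c

/-- The form domain with the norm `‖f‖² + ‖∇f‖² + ∫ ⟨V_s f, f⟩` instead of the one of `L²`. -/
def FormSpace (hyp : HypH1 Q F V) : Type := formSubmodule hyp

noncomputable instance (hyp : HypH1 Q F V) : AddCommGroup (FormSpace hyp) :=
  inferInstanceAs (AddCommGroup (formSubmodule hyp))

noncomputable instance (hyp : HypH1 Q F V) : Module ℂ (FormSpace hyp) :=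
  inferInstanceAs (Module ℂ (formSubmodule hyp))

variable {hyp : HypH1 Q F V}

/-- The function in `L²` that underlies an element of the form domain. -/
def FormSpace.toLp (f : FormSpace hyp) : VLp d m 2 := Subtype.val (p := fun f => f ∈ formDomain V) f

theorem FormSpace.toLp_mem (f : FormSpace hyp) : f.toLp ∈ formDomain V :=
  Subtype.property (p := fun f => f ∈ formDomain V) f

theorem FormSpace.ext {f g : FormSpace hyp} (h : f.toLp = g.toLp) : f = g :=
  Subtype.ext (p := fun f => f ∈ formDomain V) h

theorem FormSpace.exists_toLp_eq (hyp : HypH1 Q F V) {f : VLp d m 2} (hf : f ∈ formDomain V) :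
    ∃ g : FormSpace hyp, g.toLp = f := ⟨(⟨f, hf⟩ : formSubmodule hyp), rfl⟩

@[simp] theorem FormSpace.toLp_add (f g : FormSpace hyp) : (f + g).toLp = f.toLp + g.toLp := rfl

@[simp] theorem FormSpace.toLp_smul (c : ℂ) (f : FormSpace hyp) :
    (c • f).toLp = c • f.toLp := rfl

@[simp] theorem FormSpace.toLp_sub (f g : FormSpace hyp) : (f - g).toLp = f.toLp - g.toLp := rfl

theorem FormSpace.re_inner_self_eq (f : FormSpace hyp) :
    (inner ℂ f.toLp f.toLp + symmForm V f.toLp f.toLp).re = ‖f.toLp‖ ^ 2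
      + ∑ k, ‖weakPartial k f.toLp‖ ^ 2 + ∫ x, (sesq (V x) (f.toLp x) (f.toLp x)).re := by
  have h1 : (inner ℂ f.toLp f.toLp).re = ‖f.toLp‖ ^ 2 := inner_self_eq_norm_sq (𝕜 := ℂ) f.toLp
  rw [Complex.add_re, symmForm_self hyp f.toLp_mem, Complex.ofReal_re, h1]
  ring

/-- The inner product `⟨f, g⟩ + ⟨∇f, ∇g⟩ + ∫ ⟨V_s f, g⟩` on the form domain. -/
@[reducible]
noncomputable def FormSpace.core (hyp : HypH1 Q F V) :
    InnerProductSpace.Core ℂ (FormSpace hyp) where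
  inner f g := inner ℂ f.toLp g.toLp + symmForm V g.toLp f.toLp
  conj_inner_symm f g := by
    simp only [map_add, symmForm_conj_symm hyp g.toLp_mem f.toLp_mem, inner_conj_symm]
  re_inner_nonneg f := by
    have h1 := f.re_inner_self_eq
    have h2 := integral_sesq_nonneg hyp f.toLp
    have h3 : 0 ≤ ‖f.toLp‖ ^ 2 + ∑ k, ‖weakPartial k f.toLp‖ ^ 2
      + ∫ x, (sesq (V x) (f.toLp x) (f.toLp x)).re := by positivity
    exact h3.trans_eq h1.symm
  add_left f g h := by
    have h1 : ∀ u : FormSpace hyp, u.toLp ∈ formDomain fun x => symmPart (V x) := fun u => by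
      rw [formDomain_symmPart]; exact u.toLp_mem
    rw [FormSpace.toLp_add, inner_add_left, symmForm,
      form_add_right hyp.symm (h1 h) (h1 f) (h1 g), ← symmForm, ← symmForm]
    ring
  smul_left f g c := by
    have h1 : ∀ u : FormSpace hyp, u.toLp ∈ formDomain fun x => symmPart (V x) := fun u => by
      rw [formDomain_symmPart]; exact u.toLp_mem
    rw [FormSpace.toLp_smul, inner_smul_left, symmForm,
      form_smul_right hyp.symm (h1 g) (h1 f), ← symmForm, mul_add]
  definite f hf := by
    have h1 := congrArg Complex.re hf
    have h4 := f.re_inner_self_eq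
    have h2 := integral_sesq_nonneg hyp f.toLp
    have h3 : 0 ≤ ∑ k, ‖weakPartial k f.toLp‖ ^ 2 := by positivity
    have h5 : ‖f.toLp‖ ^ 2 = 0 := by
      have h6 : ‖f.toLp‖ ^ 2 + ∑ k, ‖weakPartial k f.toLp‖ ^ 2
        + ∫ x, (sesq (V x) (f.toLp x) (f.toLp x)).re = 0 := h4.symm.trans h1
      nlinarith [sq_nonneg ‖f.toLp‖]
    exact FormSpace.ext (norm_eq_zero.1 (pow_eq_zero_iff two_ne_zero |>.1 h5))

noncomputable instance (hyp : HypH1 Q F V) : NormedAddCommGroup (FormSpace hyp) :=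
  @InnerProductSpace.Core.toNormedAddCommGroup ℂ _ _ _ _ (FormSpace.core hyp)

noncomputable instance (hyp : HypH1 Q F V) : InnerProductSpace ℂ (FormSpace hyp) :=
  InnerProductSpace.ofCore (FormSpace.core hyp).toCore

theorem FormSpace.norm_sq_eq (f : FormSpace hyp) :
    ‖f‖ ^ 2 = ‖f.toLp‖ ^ 2 + ∑ k, ‖weakPartial k f.toLp‖ ^ 2
      + ∫ x, (sesq (V x) (f.toLp x) (f.toLp x)).re := by
  rw [← f.re_inner_self_eq]
  exact (inner_self_eq_norm_sq (𝕜 := ℂ) f).symm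

theorem FormSpace.norm_toLp_le (f : FormSpace hyp) : ‖f.toLp‖ ≤ ‖f‖ := by
  have h1 := f.norm_sq_eq
  have h2 := integral_sesq_nonneg hyp f.toLp
  have h3 : 0 ≤ ∑ k, ‖weakPartial k f.toLp‖ ^ 2 := by positivity
  exact le_of_sq_le_sq (by linarith) (norm_nonneg _)

theorem FormSpace.norm_weakPartial_le (f : FormSpace hyp) (k : Fin d) :
    ‖weakPartial k f.toLp‖ ≤ ‖f‖ := by
  have h1 := f.norm_sq_eq
  have h2 := integral_sesq_nonneg hyp f.toLp
  have h3 : ‖weakPartial k f.toLp‖ ^ 2 ≤ ∑ k, ‖weakPartial k f.toLp‖ ^ 2 :=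
    Finset.single_le_sum (f := fun k => ‖weakPartial k f.toLp‖ ^ 2) (fun _ _ => sq_nonneg _)
      (Finset.mem_univ k)
  exact le_of_sq_le_sq (by linarith [sq_nonneg ‖f.toLp‖]) (norm_nonneg _)

theorem FormSpace.integral_sesq_le (f : FormSpace hyp) :
    ∫ x, (sesq (V x) (f.toLp x) (f.toLp x)).re ≤ ‖f‖ ^ 2 := by
  have h1 := f.norm_sq_eq
  have h3 : 0 ≤ ∑ k, ‖weakPartial k f.toLp‖ ^ 2 := by positivity
  linarith [sq_nonneg ‖f.toLp‖]

theorem continuous_sesq_self (C : Matrix (Fin m) (Fin m) ℝ) :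
    Continuous fun ξ : EuclideanSpace ℂ (Fin m) => sesq C ξ ξ := by
  unfold sesq
  refine continuous_finsetSum _ fun i _ => continuous_finsetSum _ fun j _ => ?_
  exact (continuous_const.mul (by fun_prop)).mul (Complex.continuous_conj.comp (by fun_prop))

/-- Fatou's lemma for the potential term. -/
theorem integrable_sesq_of_tendsto (hyp : HypH1 Q F V) {u : ℕ → VLp d m 2} {f : VLp d m 2} {c : ℝ}
    (hu : Tendsto u atTop (𝓝 f)) (hi : ∀ n, u n ∈ formDomain V)
    (hc : ∀ᶠ n in atTop, ∫ x, (sesq (V x) (u n x) (u n x)).re ≤ c) :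
    Integrable (fun x => (sesq (V x) (f x) (f x)).re) volume ∧
      ∫ x, (sesq (V x) (f x) (f x)).re ≤ c := by
  obtain ⟨ns, hns, hlim⟩ := (tendstoInMeasure_of_tendsto_Lp hu).exists_seq_tendsto_ae
  have hm : ∀ v : VLp d m 2, AEStronglyMeasurable (fun x => (sesq (V x) (v x) (v x)).re) volume :=
    fun v => Complex.continuous_re.comp_aestronglyMeasurable (aestronglyMeasurable_sesq hyp v v)
  have h0 : ∀ v : VLp d m 2, ∀ x, 0 ≤ (sesq (V x) (v x) (v x)).re := fun v x =>
    hyp.re_sesq_nonneg x (v x)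
  have hc0 : 0 ≤ c := by
    obtain ⟨n, hn⟩ := hc.exists
    exact (integral_sesq_nonneg hyp (u n)).trans hn
  have h1 : ∫⁻ x, ENNReal.ofReal (sesq (V x) (f x) (f x)).re ≤ ENNReal.ofReal c := by
    have h2 : ∫⁻ x, ENNReal.ofReal (sesq (V x) (f x) (f x)).re
        = ∫⁻ x, liminf (fun n => ENNReal.ofReal (sesq (V x) (u (ns n) x) (u (ns n) x)).re)
          atTop := by
      refine lintegral_congr_ae ?_
      filter_upwards [hlim] with x hx
      refine (Tendsto.liminf_eq ?_).symm
      exact ENNReal.tendsto_ofReal ((Complex.continuous_re.tendsto _).comp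
        (((continuous_sesq_self (V x)).tendsto _).comp hx))
    rw [h2]
    refine (lintegral_liminf_le' fun n => (hm (u (ns n))).aemeasurable.ennreal_ofReal).trans ?_
    refine liminf_le_of_le (by isBoundedDefault) fun b hb => ?_
    obtain ⟨n, hn1, hn2⟩ := (hb.and (hns.tendsto_atTop.eventually hc)).exists
    refine hn1.trans ?_
    rw [← ofReal_integral_eq_lintegral_ofReal (mem_formDomain_iff.1 (hi (ns n))).2
      (Eventually.of_forall (h0 _))]
    exact ENNReal.ofReal_le_ofReal hn2
  have h3 : Integrable (fun x => (sesq (V x) (f x) (f x)).re) volume := by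
    refine ⟨hm f, ?_⟩
    rw [hasFiniteIntegral_iff_ofReal (Eventually.of_forall (h0 f))]
    exact h1.trans_lt ENNReal.ofReal_lt_top
  refine ⟨h3, ?_⟩
  rw [← ofReal_integral_eq_lintegral_ofReal h3 (Eventually.of_forall (h0 f))] at h1
  exact (ENNReal.ofReal_le_ofReal_iff hc0).1 h1

/-- Completeness of the form domain: the weak derivatives are closed operators, and the potential
term is lower semicontinuous by Fatou's lemma. -/
instance (hyp : HypH1 Q F V) : CompleteSpace (FormSpace hyp) := by
  refine Metric.complete_of_cauchySeq_tendsto fun u hu => ?_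
  have hcomp : ∀ (T : FormSpace hyp → VLp d m 2), (∀ n k, ‖T (u n) - T (u k)‖ ≤ ‖u n - u k‖) →
      ∃ g, Tendsto (fun n => T (u n)) atTop (𝓝 g) := by
    intro T hT
    refine cauchySeq_tendsto_of_complete (Metric.cauchySeq_iff.2 fun ε hε => ?_)
    obtain ⟨N, hN⟩ := Metric.cauchySeq_iff.1 hu ε hε
    refine ⟨N, fun n hn k hk => lt_of_le_of_lt ?_ (hN n hn k hk)⟩
    rw [dist_eq_norm, dist_eq_norm]
    exact hT n k
  have hwsub : ∀ {f g : VLp d m 2}, IsH1 f → IsH1 g → ∀ k,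
      weakPartial k (f - g) = weakPartial k f - weakPartial k g := by
    intro f g hf hg k
    have h1 : f - g = f + (-1 : ℂ) • g := by simp [sub_eq_add_neg]
    rw [h1, weakPartial_add hf (hg.smul _), weakPartial_smul hg]
    simp [sub_eq_add_neg]
  obtain ⟨f, hf⟩ := hcomp (fun v => v.toLp) fun n k => by
    simpa using (u n - u k).norm_toLp_le
  choose g hg using fun k => hcomp (fun v => weakPartial k v.toLp) fun n l => by
    rw [← hwsub (u n).toLp_mem.1 (u l).toLp_mem.1, ← FormSpace.toLp_sub]
    exact (u n - u l).norm_weakPartial_le k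
  have hfg : ∀ k, IsWeakPartial k f (g k) := fun k => IsWeakPartial.of_tendsto
    (fun n => (u n).toLp_mem.1.isWeakPartial_weakPartial k) hf (hg k)
  have hH1 : IsH1 f := fun k => ⟨g k, hfg k⟩
  have hV : ∀ ε > 0, ∃ N, ∀ n ≥ N, Integrable (fun x => (sesq (V x) ((f - (u n).toLp) x)
      ((f - (u n).toLp) x)).re) volume ∧
      ∫ x, (sesq (V x) ((f - (u n).toLp) x) ((f - (u n).toLp) x)).re ≤ ε ^ 2 := by
    intro ε hε
    obtain ⟨N, hN⟩ := Metric.cauchySeq_iff.1 hu ε hε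
    refine ⟨N, fun n hn => integrable_sesq_of_tendsto hyp (u := fun k => (u k - u n).toLp)
      (hf.sub_const _) (fun k => (u k - u n).toLp_mem) ?_⟩
    filter_upwards [eventually_ge_atTop N] with k hk
    refine (u k - u n).integral_sesq_le.trans ?_
    have := hN k hk n hn
    rw [dist_eq_norm] at this
    gcongr
  have hmem : f ∈ formDomain V := by
    obtain ⟨N, hN⟩ := hV 1 one_pos
    have h1 : f - (u N).toLp ∈ formDomain V := mem_formDomain_iff.2 ⟨by
      have h2 := hH1.add ((u N).toLp_mem.1.smul (-1))
      simpa [sub_eq_add_neg] using h2, (hN N le_rfl).1⟩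
    simpa using add_mem_formDomain hyp h1 (u N).toLp_mem
  obtain ⟨w, rfl⟩ := FormSpace.exists_toLp_eq hyp hmem
  refine ⟨w, ?_⟩
  rw [tendsto_iff_norm_sub_tendsto_zero]
  have h1 : Tendsto (fun n => ‖(u n).toLp - w.toLp‖ ^ 2
      + ∑ k, ‖weakPartial k (u n).toLp - weakPartial k w.toLp‖ ^ 2
      + ∫ x, (sesq (V x) ((w.toLp - (u n).toLp) x) ((w.toLp - (u n).toLp) x)).re)
      atTop (𝓝 (0 ^ 2 + ∑ _k : Fin d, 0 ^ 2 + 0)) := by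
    refine Tendsto.add (Tendsto.add ?_ (tendsto_finsetSum _ fun k _ => ?_)) ?_
    · exact (tendsto_iff_norm_sub_tendsto_zero.1 hf).pow 2
    · rw [(hfg k).weakPartial_eq]
      exact (tendsto_iff_norm_sub_tendsto_zero.1 (hg k)).pow 2
    · rw [Metric.tendsto_atTop]
      intro ε hε
      obtain ⟨N, hN⟩ := hV (Real.sqrt (ε / 2)) (by positivity)
      refine ⟨N, fun n hn => ?_⟩
      have h2 := (hN n hn).2
      rw [Real.sq_sqrt (by positivity)] at h2
      rw [Real.dist_0_eq_abs, abs_of_nonneg (integral_sesq_nonneg hyp _)]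
      linarith
  have h2 : ∀ n, ‖u n - w‖ ^ 2 = ‖(u n).toLp - w.toLp‖ ^ 2
      + ∑ k, ‖weakPartial k (u n).toLp - weakPartial k w.toLp‖ ^ 2
      + ∫ x, (sesq (V x) ((w.toLp - (u n).toLp) x) ((w.toLp - (u n).toLp) x)).re := by
    intro n
    rw [norm_sub_rev, FormSpace.norm_sq_eq]
    simp only [FormSpace.toLp_sub, hwsub w.toLp_mem.1 (u n).toLp_mem.1]
    rw [norm_sub_rev]
    simp_rw [norm_sub_rev (weakPartial _ w.toLp)]
  have h3 := h1.congr fun n => (h2 n).symm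
  have h4 := (Real.continuous_sqrt.tendsto _).comp h3
  simpa [Function.comp_def, Real.sqrt_sq (norm_nonneg _)] using h4

end FormSpace

section FormOperator

variable {d m : ℕ} {Q : Space d → Matrix (Fin d) (Fin d) ℝ}
  {F : Fin m → Fin m → Space d → Space d} {V : Space d → Matrix (Fin m) (Fin m) ℝ}

/-! ### Test functions in the form domain -/

/-- The function `φ e_i` with a scalar test function `φ`. -/
noncomputable def testFun (φ : Space d → ℝ) (hφ : ContDiff ℝ ∞ φ) (hc : HasCompactSupport φ)
    (i : Fin m) : VLp d m 2 :=
  MemLp.toLp (fun x => φ x • (EuclideanSpace.single i 1 : EuclideanSpace ℂ (Fin m)))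
    ((hφ.continuous.smul continuous_const).memLp_of_hasCompactSupport hc.smul_right)

variable {φ : Space d → ℝ} {hφ : ContDiff ℝ ∞ φ} {hc : HasCompactSupport φ}

theorem coeFn_testFun (i : Fin m) : testFun φ hφ hc i
    =ᵐ[volume] fun x => φ x • (EuclideanSpace.single i 1 : EuclideanSpace ℂ (Fin m)) :=
  MemLp.coeFn_toLp _

theorem testFun_apply (i : Fin m) :
    ∀ᵐ x, ∀ j, testFun φ hφ hc i x j = if j = i then (φ x : ℂ) else 0 := by
  filter_upwards [coeFn_testFun (hφ := hφ) (hc := hc) i] with x hx j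
  rw [hx]
  simp [PiLp.smul_apply]

theorem contDiff_partial (hφ : ContDiff ℝ ∞ φ) (k : Fin d) :
    ContDiff ℝ ∞ fun x => fderiv ℝ φ x (EuclideanSpace.single k 1) :=
  (hφ.fderiv_right (m := ∞) (by simp)).clm_apply contDiff_const

theorem isWeakPartial_testFun (i : Fin m) (k : Fin d) :
    IsWeakPartial k (testFun φ hφ hc i)
      (testFun _ (contDiff_partial hφ k) (hc.fderiv_apply ℝ _) i) := by
  intro ψ hψ hcψ
  set e : EuclideanSpace ℂ (Fin m) := EuclideanSpace.single i 1 with he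
  have h1 : ∫ x, fderiv ℝ ψ x (EuclideanSpace.single k 1) • testFun φ hφ hc i x
      = (∫ x, fderiv ℝ ψ x (EuclideanSpace.single k 1) * φ x) • e := by
    rw [← integral_smul_const]
    refine integral_congr_ae ?_
    filter_upwards [coeFn_testFun (hφ := hφ) (hc := hc) i] with x hx
    rw [hx, smul_smul]
  have h2 : ∫ x, ψ x • testFun _ (contDiff_partial hφ k) (hc.fderiv_apply ℝ _) i x
      = (∫ x, ψ x * fderiv ℝ φ x (EuclideanSpace.single k 1)) • e := by
    rw [← integral_smul_const]
    refine integral_congr_ae ?_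
    filter_upwards [coeFn_testFun (hφ := contDiff_partial hφ k)
      (hc := hc.fderiv_apply ℝ _) i] with x hx
    rw [hx, smul_smul]
  rw [h1, h2, ← neg_smul]
  congr 1
  rw [eq_neg_iff_add_eq_zero, add_comm, ← eq_neg_iff_add_eq_zero]
  refine integral_mul_fderiv_eq_neg_fderiv_mul_of_integrable ?_ ?_ ?_
    (fun x _ => (hψ.differentiable (by simp)).differentiableAt)
    (fun x _ => (hφ.differentiable (by simp)).differentiableAt)
  · exact ((contDiff_partial hψ k).continuous.mul hφ.continuous).integrable_of_hasCompactSupport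
      hc.mul_left
  · exact (hψ.continuous.mul (contDiff_partial hφ k).continuous).integrable_of_hasCompactSupport
      hcψ.mul_right
  · exact (hψ.continuous.mul hφ.continuous).integrable_of_hasCompactSupport hcψ.mul_right

theorem sesq_single (C : Matrix (Fin m) (Fin m) ℝ) {i j : Fin m}
    {ξ ζ : EuclideanSpace ℂ (Fin m)} {a b : ℝ} (hξ : ∀ k, ξ k = if k = j then (a : ℂ) else 0)
    (hζ : ∀ k, ζ k = if k = i then (b : ℂ) else 0) :
    sesq C ξ ζ = ((C i j * a * b : ℝ) : ℂ) := by
  simp only [sesq, hξ, hζ]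
  rw [Finset.sum_eq_single i, Finset.sum_eq_single j] <;>
    simp +contextual

theorem testFun_mem_formDomain (hyp : HypH1 Q F V) (i : Fin m) :
    testFun φ hφ hc i ∈ formDomain V := by
  rw [mem_formDomain_iff]
  refine ⟨fun k => ⟨_, isWeakPartial_testFun i k⟩, ?_⟩
  have h1 : Integrable (fun x => (φ x * φ x) • V x i i) volume :=
    (hyp.V_locInt i i).integrable_smul_left_of_hasCompactSupport
      (hφ.continuous.mul hφ.continuous) hc.mul_right
  refine h1.congr ?_
  filter_upwards [testFun_apply (hφ := hφ) (hc := hc) i] with x hx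
  rw [sesq_single (V x) hx hx, Complex.ofReal_re, smul_eq_mul]
  ring

theorem inner_testFun (i : Fin m) (h : VLp d m 2) :
    inner ℂ (testFun φ hφ hc i) h = ∫ x, φ x • h x i := by
  rw [L2.inner_def]
  refine integral_congr_ae ?_
  filter_upwards [testFun_apply (hφ := hφ) (hc := hc) i] with x hx
  simp only [PiLp.inner_apply, hx]
  rw [Finset.sum_eq_single i]
  · simp [mul_comm]
  · simp +contextual
  · simp

theorem eq_zero_of_inner_testFun {h : VLp d m 2} (hh : ∀ (φ : Space d → ℝ) (hφ : ContDiff ℝ ∞ φ)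
    (hc : HasCompactSupport φ) (i : Fin m), inner ℂ (testFun φ hφ hc i) h = 0) : h = 0 := by
  have h1 : ∀ i, ∀ᵐ x, h x i = 0 := fun i => by
    refine ae_eq_zero_of_integral_contDiff_smul_eq_zero ?_ fun φ hφ hc => ?_
    · refine locallyIntegrable_VLp h |>.mono (aestronglyMeasurable_coord h i) ?_
      exact Eventually.of_forall fun x => PiLp.norm_apply_le _ _
    · rw [← inner_testFun (hφ := hφ) (hc := hc), hh]
  refine Lp.ext ?_
  filter_upwards [ae_all_iff.2 h1, Lp.coeFn_zero (EuclideanSpace ℂ (Fin m)) 2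
    (volume : Measure (Space d))] with x hx h0
  rw [h0]
  ext i
  exact hx i

/-! ### The operator of the form -/

/-- The inclusion of the form domain in `L²`. -/
noncomputable def FormSpace.inclusion (hyp : HypH1 Q F V) : FormSpace hyp →L[ℂ] VLp d m 2 :=
  LinearMap.mkContinuous ⟨⟨FormSpace.toLp, FormSpace.toLp_add⟩, FormSpace.toLp_smul⟩ 1
    fun f => by simpa using f.norm_toLp_le

variable {hyp : HypH1 Q F V}

@[simp] theorem FormSpace.inclusion_apply (f : FormSpace hyp) :
    FormSpace.inclusion hyp f = f.toLp := rfl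

theorem FormSpace.injective_inclusion : Function.Injective (FormSpace.inclusion hyp) :=
  fun _ _ h => FormSpace.ext h

theorem FormSpace.denseRange_inclusion : DenseRange (FormSpace.inclusion hyp) := by
  have h1 : Dense ((FormSpace.inclusion hyp).range : Set (VLp d m 2)) := by
    rw [Submodule.dense_iff_topologicalClosure_eq_top, Submodule.topologicalClosure_eq_top_iff,
      Submodule.eq_bot_iff]
    intro h hh
    refine eq_zero_of_inner_testFun fun φ hφ hc i => ?_
    obtain ⟨w, hw⟩ := FormSpace.exists_toLp_eq hyp
      (testFun_mem_formDomain hyp (hφ := hφ) (hc := hc) i)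
    rw [← hw]
    exact hh _ ⟨w, rfl⟩
  exact h1

theorem FormSpace.integrable_normDensity (f : FormSpace hyp) :
    Integrable (fun x => normDensity (V x) (f.toLp x) (weakGrad f.toLp x)) volume :=
  ((integrable_norm_sq _).add (integrable_finsetSum _ fun k _ =>
    integrable_norm_sq (weakPartial k f.toLp))).add (mem_formDomain_iff.1 f.toLp_mem).2

theorem FormSpace.integral_normDensity (f : FormSpace hyp) :
    ∫ x, normDensity (V x) (f.toLp x) (weakGrad f.toLp x) = ‖f‖ ^ 2 := by
  have h1 : Integrable (fun x => ∑ k, ‖weakGrad f.toLp x k‖ ^ 2) volume :=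
    integrable_finsetSum _ fun k _ => integrable_norm_sq (weakPartial k f.toLp)
  have h2 := integral_add ((integrable_norm_sq f.toLp).add h1)
    (mem_formDomain_iff.1 f.toLp_mem).2
  have h3 := integral_add (integrable_norm_sq f.toLp) h1
  have h4 : ∫ x, ∑ k, ‖weakGrad f.toLp x k‖ ^ 2 = ∑ k, ∫ x, ‖weakPartial k f.toLp x‖ ^ 2 :=
    integral_finsetSum _ fun k _ => integrable_norm_sq (weakPartial k f.toLp)
  rw [FormSpace.norm_sq_eq]
  refine h2.trans ?_
  refine congrArg (· + _) (h3.trans ?_)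
  rw [h4]
  simp_rw [integral_norm_sq]

theorem FormSpace.exists_norm_form_le (hyp : HypH1 Q F V) : ∃ C : ℝ, ∀ f g : FormSpace hyp,
    ‖form Q F V f.toLp g.toLp‖ ≤ C * ‖f‖ * ‖g‖ := by
  obtain ⟨η, a, b, M, hη, ha, hb, hM, -, hQ, hF, hV⟩ := hyp.exists_bounds
  set K : ℝ := m * d * a + m * m * b * (d + 1) + (1 + M) with hK
  have h1 : ∀ f g : FormSpace hyp, ‖form Q F V f.toLp g.toLp‖ ≤ K * (‖f‖ ^ 2 + ‖g‖ ^ 2) := by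
    intro f g
    rw [form_eq_integral_density hyp f.toLp_mem g.toLp_mem, ← f.integral_normDensity,
      ← g.integral_normDensity, ← integral_add f.integrable_normDensity g.integrable_normDensity,
      ← integral_const_mul]
    refine norm_integral_le_of_norm_le ((f.integrable_normDensity.add
      g.integrable_normDensity).const_mul K) ?_
    filter_upwards [hF] with x hx
    exact norm_density_le ha (hQ x) hb hx hM (hV x) _ _ _ _
  -- The bilinear bound follows by applying the quadratic one to normalized vectors.
  refine ⟨K * 2, fun f g => ?_⟩
  have hsl : ∀ (c : ℂ) (f g : FormSpace hyp), form Q F V (c • f).toLp g.toLp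
      = c * form Q F V f.toLp g.toLp := fun c f g => form_smul_left hyp f.toLp_mem g.toLp_mem c
  have hsr : ∀ (c : ℂ) (f g : FormSpace hyp), form Q F V f.toLp (c • g).toLp
      = conj c * form Q F V f.toLp g.toLp := fun c f g =>
    form_smul_right hyp f.toLp_mem g.toLp_mem c
  rcases eq_or_ne f 0 with rfl | hf
  · have := hsl 0 0 g
    rw [zero_smul, zero_mul] at this
    simp [this]
  rcases eq_or_ne g 0 with rfl | hg
  · have := hsr 0 f 0
    rw [zero_smul, map_zero, zero_mul] at this
    simp [this]
  have hf' : 0 < ‖f‖ := norm_pos_iff.2 hf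
  have hg' : 0 < ‖g‖ := norm_pos_iff.2 hg
  have h2 := h1 (((‖f‖⁻¹ : ℝ) : ℂ) • f) (((‖g‖⁻¹ : ℝ) : ℂ) • g)
  rw [hsl, hsr, norm_mul, norm_mul, RCLike.norm_conj, norm_smul, norm_smul, Complex.norm_real,
    Complex.norm_real, norm_inv, norm_inv, norm_norm, norm_norm, inv_mul_cancel₀ hf'.ne',
    inv_mul_cancel₀ hg'.ne'] at h2
  have h3 : ‖f‖ * ‖g‖ * (‖f‖⁻¹ * (‖g‖⁻¹ * ‖form Q F V f.toLp g.toLp‖))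
      ≤ ‖f‖ * ‖g‖ * (K * (1 ^ 2 + 1 ^ 2)) := mul_le_mul_of_nonneg_left h2 (by positivity)
  have h4 : ‖f‖ * ‖g‖ * (‖f‖⁻¹ * (‖g‖⁻¹ * ‖form Q F V f.toLp g.toLp‖))
      = ‖form Q F V f.toLp g.toLp‖ := by
    field_simp
  rw [h4] at h3
  linarith

/-- The form is represented by a bounded operator on the form domain. -/
theorem FormSpace.exists_operator (hyp : HypH1 Q F V) :
    ∃ A : FormSpace hyp →L[ℂ] FormSpace hyp, ∀ f g : FormSpace hyp,
      inner ℂ g (A f) = form Q F V f.toLp g.toLp := by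
  obtain ⟨C, hC⟩ := FormSpace.exists_norm_form_le hyp
  set B₀ : FormSpace hyp →ₛₗ[starRingEnd ℂ] FormSpace hyp →ₗ[ℂ] ℂ :=
    LinearMap.mk₂'ₛₗ (starRingEnd ℂ) (RingHom.id ℂ) (fun g f => form Q F V f.toLp g.toLp)
      (fun g g' f => form_add_right hyp f.toLp_mem g.toLp_mem g'.toLp_mem)
      (fun c g f => form_smul_right hyp f.toLp_mem g.toLp_mem c)
      (fun g f f' => form_add_left hyp f.toLp_mem f'.toLp_mem g.toLp_mem)
      (fun c g f => form_smul_left hyp f.toLp_mem g.toLp_mem c) with hB₀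
  set B := LinearMap.mkContinuous₂ B₀ C fun g f => by
    have := hC f g
    calc ‖form Q F V f.toLp g.toLp‖ ≤ C * ‖f‖ * ‖g‖ := this
      _ = C * ‖g‖ * ‖f‖ := by ring
  refine ⟨ContinuousLinearMap.adjoint (InnerProductSpace.continuousLinearMapOfBilin B),
    fun f g => ?_⟩
  rw [ContinuousLinearMap.adjoint_inner_right, InnerProductSpace.continuousLinearMapOfBilin_apply]
  rfl

/-- The bounded operator on the form domain that represents the form. -/
noncomputable def FormSpace.operator (hyp : HypH1 Q F V) : FormSpace hyp →L[ℂ] FormSpace hyp :=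
  (FormSpace.exists_operator hyp).choose

theorem FormSpace.inner_operator (f g : FormSpace hyp) :
    inner ℂ g (FormSpace.operator hyp f) = form Q F V f.toLp g.toLp :=
  (FormSpace.exists_operator hyp).choose_spec f g

theorem FormSpace.exists_isElliptic (hyp : HypH1 Q F V) : ∃ α κ : ℝ, 0 < α ∧
    IsElliptic (FormSpace.inclusion hyp) (FormSpace.operator hyp) α κ := by
  obtain ⟨η, a, b, M, hη, ha, hb, hM, hQ, -, hF, hV⟩ := hyp.exists_bounds
  refine ⟨min (η / 2) 1, d * ((m * m * b) ^ 2 / (2 * η)) + 1, by positivity, fun f => ?_⟩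
  have h1 := integrable_density hyp f.toLp_mem f.toLp_mem
  rw [FormSpace.inner_operator, form_eq_integral_density hyp f.toLp_mem f.toLp_mem,
    ← f.integral_normDensity, FormSpace.inclusion_apply, ← integral_norm_sq,
    ← integral_const_mul, ← integral_const_mul]
  have h2 : (∫ x, density (Q x) (fun i j => F i j x) (V x) (f.toLp x) (weakGrad f.toLp x)
      (f.toLp x) (weakGrad f.toLp x)).re = ∫ x, (density (Q x) (fun i j => F i j x) (V x)
      (f.toLp x) (weakGrad f.toLp x) (f.toLp x) (weakGrad f.toLp x)).re :=
    (integral_re h1).symm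
  have h3 : Integrable (fun x => (density (Q x) (fun i j => F i j x) (V x)
      (f.toLp x) (weakGrad f.toLp x) (f.toLp x) (weakGrad f.toLp x)).re) volume := h1.re
  rw [h2, ← integral_add h3 ((integrable_norm_sq _).const_mul _)]
  refine integral_mono_ae (f.integrable_normDensity.const_mul _)
    (h3.add ((integrable_norm_sq _).const_mul _)) ?_
  filter_upwards [hF] with x hx
  exact le_re_density hη (hQ x) hx (fun ξ => (hV x).re_nonneg ξ hM) _ _

theorem realization_eq_formGraph (hyp : HypH1 Q F V) : realization Q F V
    = formGraph (FormSpace.inclusion hyp) (FormSpace.operator hyp) := by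
  ext p
  constructor
  · rintro ⟨h1, h2⟩
    obtain ⟨f, hf⟩ := FormSpace.exists_toLp_eq hyp h1
    refine ⟨f, hf, fun g => ?_⟩
    rw [FormSpace.inner_operator, hf]
    exact h2 _ g.toLp_mem
  · rintro ⟨f, hf, h2⟩
    rw [FormSpace.inclusion_apply] at hf
    refine ⟨hf ▸ f.toLp_mem, fun g hg => ?_⟩
    obtain ⟨w, rfl⟩ := FormSpace.exists_toLp_eq hyp hg
    rw [← hf, ← FormSpace.inner_operator]
    exact h2 w

end FormOperator

section Positivity

variable {d m : ℕ} {Q : Space d → Matrix (Fin d) (Fin d) ℝ}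
  {F : Fin m → Fin m → Space d → Space d} {V : Space d → Matrix (Fin m) (Fin m) ℝ}

/-! ### Generation -/

/-- The realization generates a quasi-contraction semigroup that leaves invariant every closed
convex cone invariant under the resolvent. -/
theorem exists_isGeneratedBy_realization (hyp : HypH1 Q F V) :
    ∃ (α κ : ℝ) (S : ℝ≥0 → VLp d m 2 →L[ℂ] VLp d m 2), 0 < α ∧
      IsElliptic (FormSpace.inclusion hyp) (FormSpace.operator hyp) α κ ∧
      IsGeneratedBy S (realization Q F V) ∧ (∀ t, ‖S t‖ ≤ Real.exp (κ * t)) ∧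
      ∀ K : Set (VLp d m 2), IsClosed K → (0 : VLp d m 2) ∈ K → (∀ f ∈ K, ∀ g ∈ K, f + g ∈ K) →
        (∀ c : ℝ, 0 ≤ c → ∀ f ∈ K, (c : ℂ) • f ∈ K) →
        (∀ r > κ, ∀ f ∈ K,
          (formSolution (FormSpace.inclusion hyp) (FormSpace.operator hyp) r f).toLp ∈ K) →
        ∀ t, ∀ f ∈ K, S t f ∈ K := by
  obtain ⟨α, κ, hα, h⟩ := FormSpace.exists_isElliptic hyp
  obtain ⟨S, hS, hb, hK⟩ := exists_semigroup_of_resolvent (h.isResolventOn hα)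
    (fun r hr => h.norm_resolvent_le hα hr) (h.dense_domain hα FormSpace.denseRange_inclusion)
  exact ⟨α, κ, S, hα, h, realization_eq_formGraph hyp ▸ hS, hb, hK⟩

theorem isGeneratedBy_realization_unique (hyp : HypH1 Q F V)
    {S T : ℝ≥0 → VLp d m 2 →L[ℂ] VLp d m 2} (hS : IsGeneratedBy S (realization Q F V))
    (hT : IsGeneratedBy T (realization Q F V)) : S = T := by
  obtain ⟨α, κ, hα, h⟩ := FormSpace.exists_isElliptic hyp
  rw [realization_eq_formGraph hyp] at hS hT
  exact IsGeneratedBy.unique (fun p hp => h.re_inner_le hα hp)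
    (h.dense_domain hα FormSpace.denseRange_inclusion) hS hT

/-! ### Nonnegative functions -/

theorem Nonneg.add {p : ℝ≥0∞} {f g : VLp d m p} (hf : Nonneg f) (hg : Nonneg g) :
    Nonneg (f + g) := by
  filter_upwards [hf, hg, Lp.coeFn_add f g] with x h1 h2 h3 i
  rw [h3]
  simp only [Pi.add_apply, PiLp.add_apply, Complex.add_re, Complex.add_im]
  exact ⟨add_nonneg (h1 i).1 (h2 i).1, by rw [(h1 i).2, (h2 i).2, add_zero]⟩

theorem Nonneg.smul {p : ℝ≥0∞} {f : VLp d m p} (hf : Nonneg f) {c : ℝ} (hc : 0 ≤ c) :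
    Nonneg ((c : ℂ) • f) := by
  filter_upwards [hf, Lp.coeFn_smul (c : ℂ) f] with x h1 h2 i
  rw [h2]
  simp only [Pi.smul_apply, PiLp.smul_apply, smul_eq_mul, Complex.re_ofReal_mul,
    Complex.im_ofReal_mul]
  exact ⟨mul_nonneg hc (h1 i).1, by rw [(h1 i).2, mul_zero]⟩

theorem nonneg_zero {p : ℝ≥0∞} : Nonneg (0 : VLp d m p) := by
  filter_upwards [Lp.coeFn_zero (EuclideanSpace ℂ (Fin m)) p (volume : Measure (Space d))]
    with x hx i
  rw [hx]
  simp

theorem isClosed_nonneg {p : ℝ≥0∞} [Fact (1 ≤ p)] : IsClosed {f : VLp d m p | Nonneg f} := by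
  refine IsSeqClosed.isClosed fun u f hu hf => ?_
  obtain ⟨ns, -, hlim⟩ := (tendstoInMeasure_of_tendsto_Lp hf).exists_seq_tendsto_ae
  filter_upwards [hlim, ae_all_iff.2 fun n => hu (ns n)] with x hx h i
  have h1 : Tendsto (fun n => u (ns n) x i) atTop (𝓝 (f x i)) :=
    (((EuclideanSpace.proj (𝕜 := ℂ) i).continuous.tendsto _).comp hx)
  refine ⟨ge_of_tendsto' ((Complex.continuous_re.tendsto _).comp h1) fun n => (h n i).1, ?_⟩
  refine tendsto_nhds_unique ((Complex.continuous_im.tendsto _).comp h1) ?_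
  exact tendsto_const_nhds.congr fun n => (h n i).2.symm

theorem re_inner_eq_integral (f g : VLp d m 2) :
    (inner ℂ f g).re = ∫ x, (∑ i, g x i * conj (f x i)).re := by
  rw [L2.inner_def]
  refine (integral_re (L2.integrable_inner (𝕜 := ℂ) f g)).symm.trans ?_
  simp [PiLp.inner_apply]

theorem Nonneg.re_inner_nonneg {f g : VLp d m 2} (hf : Nonneg f) (hg : Nonneg g) :
    0 ≤ (inner ℂ f g).re := by
  rw [re_inner_eq_integral]
  refine integral_nonneg_of_ae ?_
  filter_upwards [hf, hg] with x h1 h2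
  rw [Complex.re_sum]
  refine Finset.sum_nonneg fun i _ => ?_
  simpa [(h1 i).2] using mul_nonneg (h2 i).1 (h1 i).1

/-! ### The positive part -/

/-- The coordinatewise positive part of the real part, which is the nearest point map onto
`[0, ∞)^m`. -/
noncomputable def posProj (ξ : EuclideanSpace ℂ (Fin m)) : EuclideanSpace ℂ (Fin m) :=
  WithLp.toLp 2 fun i => ((max (ξ i).re 0 : ℝ) : ℂ)

@[simp] theorem posProj_apply (ξ : EuclideanSpace ℂ (Fin m)) (i : Fin m) :
    posProj ξ i = ((max (ξ i).re 0 : ℝ) : ℂ) := rfl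

theorem posProj_zero : posProj (0 : EuclideanSpace ℂ (Fin m)) = 0 := by
  ext i
  simp

theorem lipschitzWith_posProj :
    LipschitzWith 1 (posProj : EuclideanSpace ℂ (Fin m) → EuclideanSpace ℂ (Fin m)) := by
  refine LipschitzWith.of_dist_le_mul fun ξ ζ => ?_
  rw [NNReal.coe_one, one_mul, EuclideanSpace.dist_eq, EuclideanSpace.dist_eq]
  refine Real.sqrt_le_sqrt (Finset.sum_le_sum fun i _ => ?_)
  gcongr
  rw [posProj_apply, posProj_apply, dist_eq_norm, dist_eq_norm, ← Complex.ofReal_sub,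
    Complex.norm_real, Real.norm_eq_abs]
  refine (abs_max_sub_max_le_abs _ _ _).trans ?_
  rw [← Complex.sub_re]
  exact Complex.abs_re_le_norm _

/-- The positive part of a function in `L²`. -/
noncomputable def posPart (u : VLp d m 2) : VLp d m 2 :=
  lipschitzWith_posProj.compLp posProj_zero u

theorem coeFn_posPart (u : VLp d m 2) : posPart u =ᵐ[volume] fun x => posProj (u x) :=
  LipschitzWith.coeFn_compLp _ _ _

theorem nonneg_posPart (u : VLp d m 2) : Nonneg (posPart u) := by
  filter_upwards [coeFn_posPart u] with x hx i
  rw [hx]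
  simp

/-- The sign and disjointness relations between the positive part `P u` and `u - P u`. -/
theorem ae_posPart (u : VLp d m 2) : ∀ᵐ x, ∀ i, (posPart u x i).im = 0 ∧ 0 ≤ (posPart u x i).re ∧
    ((u - posPart u) x i).re ≤ 0 ∧ ((posPart u x i).re = 0 ∨ ((u - posPart u) x i).re = 0) := by
  filter_upwards [coeFn_posPart u, Lp.coeFn_sub u (posPart u)] with x hx h i
  rw [h]
  simp only [Pi.sub_apply, PiLp.sub_apply, hx, posProj_apply, Complex.ofReal_im,
    Complex.ofReal_re, Complex.sub_re, true_and]
  rcases le_total (u x i).re 0 with h0 | h0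
  · simp [h0]
  · simp [h0]

/-- The real-linear functional `ξ ↦ Re ξ_i`. -/
noncomputable def reCoord (i : Fin m) : EuclideanSpace ℂ (Fin m) →L[ℝ] ℝ :=
  Complex.reCLM ∘L ((EuclideanSpace.proj i : EuclideanSpace ℂ (Fin m) →L[ℂ] ℂ).restrictScalars ℝ)

/-- The real-linear functional `ξ ↦ Im ξ_i`. -/
noncomputable def imCoord (i : Fin m) : EuclideanSpace ℂ (Fin m) →L[ℝ] ℝ :=
  Complex.imCLM ∘L ((EuclideanSpace.proj i : EuclideanSpace ℂ (Fin m) →L[ℂ] ℂ).restrictScalars ℝ)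

/-- The gradients of `P u` and `u - P u` vanish where the respective functions do. -/
theorem ae_weakGrad_posPart {u : VLp d m 2} (hP : IsH1 (posPart u))
    (hg : IsH1 (u - posPart u)) : ∀ᵐ x, ∀ (k : Fin d) (i : Fin m),
      (weakGrad (posPart u) x k i).im = 0 ∧
      ((posPart u x i).re = 0 → (weakGrad (posPart u) x k i).re = 0) ∧
      (((u - posPart u) x i).re = 0 → (weakGrad (u - posPart u) x k i).re = 0) := by
  rw [ae_all_iff]
  intro k
  rw [ae_all_iff]
  intro i
  have h0 := ae_posPart u
  have h1 := (hP.isWeakPartial_weakPartial k).ae_apply_eq_zero (imCoord i)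
    (h0.mono fun x hx => (hx i).1.ge)
  have h2 := (hP.isWeakPartial_weakPartial k).ae_apply_eq_zero (reCoord i)
    (h0.mono fun x hx => (hx i).2.1)
  have h3 := (hg.isWeakPartial_weakPartial k).ae_apply_eq_zero (-reCoord i)
    (h0.mono fun x hx => neg_nonneg.2 (hx i).2.2.1)
  filter_upwards [h0, h1, h2, h3] with x e0 e1 e2 e3
  refine ⟨e1 (e0 i).1, e2, fun h => ?_⟩
  have h4 := e3 (neg_eq_zero.2 h)
  exact neg_eq_zero.1 h4

theorem posPart_mem_formDomain (hyp : HypH1 Q F V) (hV : ∀ i j, i ≠ j → ∀ᵐ x, V x i j ≤ 0)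
    {u : VLp d m 2} (hu : u ∈ formDomain V) : posPart u ∈ formDomain V := by
  rw [mem_formDomain_iff]
  refine ⟨IsH1.compLp _ _ hu.1, ?_⟩
  refine Integrable.mono' (mem_formDomain_iff.1 hu).2
    (Complex.continuous_re.comp_aestronglyMeasurable (aestronglyMeasurable_sesq hyp _ _)) ?_
  have hV' : ∀ᵐ x, ∀ i j, i ≠ j → V x i j ≤ 0 := by
    simp only [ae_all_iff]
    exact fun i j hij => hV i j hij
  filter_upwards [ae_posPart u, hV', Lp.coeFn_sub u (posPart u)] with x hx hVx hsub
  rw [Real.norm_eq_abs, abs_of_nonneg (hyp.re_sesq_nonneg x _)]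
  set ξ := posPart u x
  set ζ := (u - posPart u) x
  have hux : u x = ξ + ζ := by
    rw [hsub, Pi.sub_apply, add_sub_cancel]
  have h1 : 0 ≤ (sesq (V x) ξ ζ).re := re_sesq_nonneg_of_disjoint hVx (fun i => (hx i).1)
    (fun i => (hx i).2.1) (fun i => (hx i).2.2.1) fun i => (hx i).2.2.2
  have h2 : 0 ≤ (sesq (V x).transpose ξ ζ).re := re_sesq_nonneg_of_disjoint
    (fun i j hij => hVx j i hij.symm) (fun i => (hx i).1) (fun i => (hx i).2.1)
    (fun i => (hx i).2.2.1) fun i => (hx i).2.2.2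
  rw [sesq_transpose, Complex.conj_re] at h2
  rw [hux]
  simp only [sesq_add_left, sesq_add_right, Complex.add_re]
  linarith [hyp.re_sesq_nonneg x ζ]

/-! ### Sufficiency of the coupling condition -/

theorem re_form_posPart_nonneg (hyp : HypH1 Q F V) (hc : CoupledOnlyByNonposPotential F V)
    {u : VLp d m 2} (hP : posPart u ∈ formDomain V) (hg : u - posPart u ∈ formDomain V) :
    0 ≤ (form Q F V (posPart u) (u - posPart u)).re := by
  rw [form_eq_integral_density hyp hP hg]
  refine le_of_le_of_eq ?_ (integral_re (integrable_density hyp hP hg))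
  have hc' : ∀ᵐ x, ∀ i j, i ≠ j → F i j x = 0 ∧ V x i j ≤ 0 := by
    simp only [ae_all_iff]
    exact fun i j hij => (hc i j hij).1.and (hc i j hij).2
  refine integral_nonneg_of_ae ?_
  filter_upwards [ae_posPart u, hc', ae_weakGrad_posPart hP.1 hg.1] with x hx hcx hgx
  exact re_density_nonneg (fun i j hij => (hcx i j hij).1) (fun i j hij => (hcx i j hij).2)
    (fun i => (hx i).1) (fun i => (hx i).2.1) (fun i => (hx i).2.2.1) (fun i => (hx i).2.2.2)
    (fun k i => (hgx k i).1) (fun k i => (hgx k i).2.1) (fun k i => (hgx k i).2.2)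

/-- Under the coupling condition the resolvent is positive: testing the equation for `u` with
`g = u - P u` gives `g = 0`. -/
theorem nonneg_formSolution (hyp : HypH1 Q F V) (hc : CoupledOnlyByNonposPotential F V) {α κ r : ℝ}
    (hα : 0 < α) (h : IsElliptic (FormSpace.inclusion hyp) (FormSpace.operator hyp) α κ)
    (hr : κ < r) {k : VLp d m 2} (hk : Nonneg k) :
    Nonneg (formSolution (FormSpace.inclusion hyp) (FormSpace.operator hyp) r k).toLp := by
  set u := formSolution (FormSpace.inclusion hyp) (FormSpace.operator hyp) r k with hu
  have hP := posPart_mem_formDomain hyp (fun i j hij => (hc i j hij).2) u.toLp_mem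
  obtain ⟨w, hw⟩ := FormSpace.exists_toLp_eq hyp hP
  set g := u - w with hg
  have hgL : g.toLp = u.toLp - posPart u.toLp := by rw [hg, FormSpace.toLp_sub, hw]
  have huw : u = w + g := by rw [hg]; abel
  have h1 := congrArg Complex.re (h.formSolution_spec hα hr k g)
  rw [← hu, huw, map_add, map_add, inner_add_right, inner_add_right] at h1
  simp only [FormSpace.inclusion_apply, Complex.add_re, Complex.re_ofReal_mul] at h1
  have h2 : 0 ≤ (inner ℂ g (FormSpace.operator hyp w)).re := by
    rw [FormSpace.inner_operator, hw, hgL]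
    exact re_form_posPart_nonneg hyp hc hP (hgL ▸ g.toLp_mem)
  have h3 : (inner ℂ g.toLp w.toLp).re = 0 := by
    rw [re_inner_eq_integral, hw, hgL]
    refine integral_eq_zero_of_ae ?_
    filter_upwards [ae_posPart u.toLp] with x hx
    rw [Complex.re_sum]
    refine Finset.sum_eq_zero fun i _ => ?_
    rw [Complex.mul_re, (hx i).1]
    rcases (hx i).2.2.2 with h | h
    · rw [h]
      simp
    · rw [Complex.conj_re, h]
      simp
  have h4 : (inner ℂ g.toLp g.toLp).re = ‖g.toLp‖ ^ 2 := inner_self_eq_norm_sq (𝕜 := ℂ) g.toLp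
  have h5 : (inner ℂ g.toLp k).re ≤ 0 := by
    rw [re_inner_eq_integral, hgL]
    refine integral_nonpos_of_ae ?_
    filter_upwards [ae_posPart u.toLp, hk] with x hx hkx
    rw [Complex.re_sum]
    refine Finset.sum_nonpos fun i _ => ?_
    simpa [(hkx i).2] using mul_nonpos_of_nonneg_of_nonpos (hkx i).1 (hx i).2.2.1
  have h6 := h g
  rw [FormSpace.inclusion_apply] at h6
  have h7 : 0 ≤ α * ‖g‖ ^ 2 := by positivity
  rw [h3, h4] at h1
  have h8 : ‖g.toLp‖ ^ 2 ≤ 0 := by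
    refine nonpos_of_mul_nonpos_right (a := r - κ) ?_ (by linarith)
    linarith
  have h9 : g.toLp = 0 := by
    rw [← norm_eq_zero]
    exact pow_eq_zero_iff two_ne_zero |>.1 (le_antisymm h8 (sq_nonneg _))
  have h10 : u.toLp = posPart u.toLp := sub_eq_zero.1 (hgL ▸ h9)
  rw [h10]
  exact nonneg_posPart _

theorem isPositiveFamily_of_coupled (hyp : HypH1 Q F V) (hc : CoupledOnlyByNonposPotential F V)
    {S : ℝ≥0 → VLp d m 2 →L[ℂ] VLp d m 2} (hS : IsGeneratedBy S (realization Q F V)) :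
    IsPositiveFamily S := by
  obtain ⟨α, κ, T, hα, h, hT, -, hK⟩ := exists_isGeneratedBy_realization hyp
  rw [isGeneratedBy_realization_unique hyp hS hT]
  exact hK {f | Nonneg f} isClosed_nonneg nonneg_zero (fun f hf g hg => Nonneg.add hf hg)
    (fun c hc f hf => Nonneg.smul hf hc) fun r hr f hf => nonneg_formSolution hyp hc hα h hr hf

end Positivity

section Necessity

variable {d m : ℕ} {Q : Space d → Matrix (Fin d) (Fin d) ℝ}
  {F : Fin m → Fin m → Space d → Space d} {V : Space d → Matrix (Fin m) (Fin m) ℝ}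

/-! ### Necessity of the coupling condition -/

/-- A locally integrable function that is nonpositive as a distribution is nonpositive almost
everywhere. -/
theorem ae_nonpos_of_integral_contDiff_mul_nonpos {c : Space d → ℝ}
    (hc : LocallyIntegrable c volume)
    (h : ∀ ψ : Space d → ℝ, ContDiff ℝ ∞ ψ → HasCompactSupport ψ → (∀ x, 0 ≤ ψ x) →
      ∫ x, ψ x * c x ≤ 0) : ∀ᵐ x, c x ≤ 0 := by
  let φ : ℕ → ContDiffBump (0 : Space d) := fun n =>
    ⟨(1 / ((n : ℝ) + 1)), 2 * (1 / ((n : ℝ) + 1)), by positivity, by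
      have : 0 < 1 / ((n : ℝ) + 1) := by positivity
      linarith⟩
  have hφ : Tendsto (fun n => (φ n).rOut) atTop (𝓝 0) := by
    have h2 := tendsto_one_div_add_atTop_nhds_zero_nat.const_mul (2 : ℝ)
    rwa [mul_zero] at h2
  have h1 := ContDiffBump.ae_convolution_tendsto_right_of_locallyIntegrable (K := 2) hφ
    (Eventually.of_forall fun n => le_rfl) hc
  filter_upwards [h1] with x hx
  refine le_of_tendsto' hx fun n => ?_
  rw [convolution_lsmul_swap]
  refine h (fun t => (φ n).normed volume (x - t)) ?_ ?_ fun t => (φ n).nonneg_normed _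
  · exact (φ n).contDiff_normed.comp (contDiff_const.sub contDiff_id)
  · exact (φ n).hasCompactSupport_normed.comp_homeomorph (Homeomorph.subLeft x)

/-- The density of the form at `φ e_j` and `ψ e_i` for `i ≠ j`. -/
theorem density_single {A : Matrix (Fin d) (Fin d) ℝ} {B : Fin m → Fin m → Space d}
    {C : Matrix (Fin m) (Fin m) ℝ} {i j : Fin m} (hij : i ≠ j)
    {ξ ζ : EuclideanSpace ℂ (Fin m)} {p q : Fin d → EuclideanSpace ℂ (Fin m)} {a b : ℝ}
    {a' b' : Fin d → ℝ} (hξ : ∀ l, ξ l = if l = j then (a : ℂ) else 0)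
    (hζ : ∀ l, ζ l = if l = i then (b : ℂ) else 0)
    (hp : ∀ k l, p k l = if l = j then (a' k : ℂ) else 0)
    (hq : ∀ k l, q k l = if l = i then (b' k : ℂ) else 0) :
    density A B C ξ p ζ q = ((b * (∑ k, B i j k * a' k + C i j * a) : ℝ) : ℂ) := by
  have h1 : principalDensity A p q = 0 := by
    refine Finset.sum_eq_zero fun r _ => Finset.sum_eq_zero fun k _ =>
      Finset.sum_eq_zero fun l _ => ?_
    rw [hp, hq]
    by_cases hr : r = j
    · simp [hr, hij.symm]
    · simp [hr]
  have h2 : driftDensity B p ζ = ((b * ∑ k, B i j k * a' k : ℝ) : ℂ) := by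
    simp only [driftDensity, hp, hζ]
    rw [Finset.sum_eq_single i, Finset.sum_eq_single j]
    · simp [mul_comm]
    · simp +contextual
    · simp
    · simp +contextual
    · simp
  rw [density, h1, h2, sesq_single C hξ hζ]
  push_cast
  ring

theorem nonneg_testFun {φ : Space d → ℝ} {hφ : ContDiff ℝ ∞ φ} {hc : HasCompactSupport φ}
    (h0 : ∀ x, 0 ≤ φ x) (i : Fin m) : Nonneg (testFun φ hφ hc i) := by
  filter_upwards [testFun_apply (hφ := hφ) (hc := hc) i] with x hx j
  rw [hx j]
  split_ifs <;> simp [h0]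

theorem locallyIntegrable_drift_add_potential (hyp : HypH1 Q F V) {φ : Space d → ℝ}
    (hφ : ContDiff ℝ ∞ φ) (i j : Fin m) :
    LocallyIntegrable (fun x => ∑ k, F i j x k * fderiv ℝ φ x (EuclideanSpace.single k 1)
      + V x i j * φ x) volume := by
  have hmul : ∀ {f g : Space d → ℝ}, LocallyIntegrable f volume → Continuous g →
      LocallyIntegrable (fun x => f x * g x) volume := fun hf hg => locallyIntegrable_iff.2
    fun K hK => (hf.integrableOn_isCompact hK).mul_continuousOn hg.continuousOn hK
  refine LocallyIntegrable.add ?_ ?_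
  · refine locallyIntegrable_finsetSum _ fun k _ => ?_
    have h1 : LocallyIntegrable (fun x => F i j x k) volume := by
      have h2 : LocallyIntegrable (F i j) volume :=
        (hyp.F_bounded i j).locallyIntegrable le_top
      refine h2.mono ((EuclideanSpace.proj (𝕜 := ℝ) k).continuous.comp_aestronglyMeasurable
        h2.aestronglyMeasurable) (Eventually.of_forall fun x => PiLp.norm_apply_le _ _)
    exact hmul h1 (contDiff_partial hφ k).continuous
  · exact hmul (hyp.V_locInt i j) hφ.continuous

/-- Positivity forces the off-diagonal part of the form to be nonpositive on nonnegative test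
functions. -/
theorem ae_drift_add_potential_nonpos (hyp : HypH1 Q F V)
    {S : ℝ≥0 → VLp d m 2 →L[ℂ] VLp d m 2} (hS : IsGeneratedBy S (realization Q F V))
    (hpos : IsPositiveFamily S) {i j : Fin m} (hij : i ≠ j) {φ : Space d → ℝ}
    (hφ : ContDiff ℝ ∞ φ) (hc : HasCompactSupport φ) (h0 : ∀ x, 0 ≤ φ x) :
    ∀ᵐ x, ∑ k, F i j x k * fderiv ℝ φ x (EuclideanSpace.single k 1) + V x i j * φ x ≤ 0 := by
  refine ae_nonpos_of_integral_contDiff_mul_nonpos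
    (locallyIntegrable_drift_add_potential hyp hφ i j) fun ψ hψ hcψ hψ0 => ?_
  obtain ⟨α, κ, T, hα, h, hT, hb, -⟩ := exists_isGeneratedBy_realization hyp
  obtain rfl := isGeneratedBy_realization_unique hyp hS hT
  have hfm := testFun_mem_formDomain (hφ := hφ) (hc := hc) hyp j
  have hgm := testFun_mem_formDomain (hφ := hψ) (hc := hcψ) hyp i
  obtain ⟨f, hf⟩ := FormSpace.exists_toLp_eq hyp hfm
  obtain ⟨g, hg⟩ := FormSpace.exists_toLp_eq hyp hgm
  have h1 : (inner ℂ g (FormSpace.operator hyp f)).re ≤ 0 := by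
    refine h.re_form_nonpos hα FormSpace.injective_inclusion (S := S)
      (realization_eq_formGraph hyp ▸ hS) hb ?_ fun t => ?_
    · rw [FormSpace.inclusion_apply, FormSpace.inclusion_apply, hf, hg, inner_testFun]
      refine integral_eq_zero_of_ae ?_
      filter_upwards [testFun_apply (hφ := hφ) (hc := hc) j] with x hx
      rw [hx, if_neg hij, smul_zero]
      rfl
    · rw [FormSpace.inclusion_apply, FormSpace.inclusion_apply, hf, hg]
      exact (nonneg_testFun hψ0 i).re_inner_nonneg (hpos t _ (nonneg_testFun h0 j))
  rw [FormSpace.inner_operator, hf, hg, form_eq_integral_density hyp hfm hgm] at h1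
  have h2 : ∀ (θ : Space d → ℝ) (hθ : ContDiff ℝ ∞ θ) (hcθ : HasCompactSupport θ) (r : Fin m),
      ∀ᵐ x, ∀ k l, weakGrad (testFun θ hθ hcθ r) x k l
        = if l = r then ((fderiv ℝ θ x (EuclideanSpace.single k 1) : ℝ) : ℂ) else 0 := by
    intro θ hθ hcθ r
    rw [ae_all_iff]
    intro k
    simp only [weakGrad]
    rw [(isWeakPartial_testFun r k).weakPartial_eq]
    exact testFun_apply r
  have h3 : ∫ x, density (Q x) (fun i j => F i j x) (V x) (testFun φ hφ hc j x)
      (weakGrad (testFun φ hφ hc j) x) (testFun ψ hψ hcψ i x) (weakGrad (testFun ψ hψ hcψ i) x)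
      = ∫ x, ((ψ x * (∑ k, F i j x k * fderiv ℝ φ x (EuclideanSpace.single k 1)
        + V x i j * φ x) : ℝ) : ℂ) := by
    refine integral_congr_ae ?_
    filter_upwards [testFun_apply (hφ := hφ) (hc := hc) j, testFun_apply (hφ := hψ) (hc := hcψ) i,
      h2 φ hφ hc j, h2 ψ hψ hcψ i] with x e1 e2 e3 e4
    exact density_single hij e1 e2 e3 e4
  rwa [h3, integral_complex_ofReal, Complex.ofReal_re] at h1

/-- Exponentials `e^{⟨a, x⟩}`, cut off far away, decouple the drift from the potential. -/
theorem ae_inner_add_potential_nonpos (hyp : HypH1 Q F V)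
    {S : ℝ≥0 → VLp d m 2 →L[ℂ] VLp d m 2} (hS : IsGeneratedBy S (realization Q F V))
    (hpos : IsPositiveFamily S) {i j : Fin m} (hij : i ≠ j) (a : Space d) :
    ∀ᵐ x, ∑ k, F i j x k * a k + V x i j ≤ 0 := by
  let χ : ℕ → ContDiffBump (0 : Space d) := fun n =>
    ⟨(n : ℝ) + 1, (n : ℝ) + 2, by positivity, by linarith⟩
  have hexp : ContDiff ℝ ∞ fun x : Space d => Real.exp (inner ℝ a x) :=
    Real.contDiff_exp.comp (contDiff_const.inner ℝ contDiff_id)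
  have h1 : ∀ᵐ x, ∀ n, ∑ k, F i j x k * fderiv ℝ (fun y => χ n y * Real.exp (inner ℝ a y)) x
      (EuclideanSpace.single k 1) + V x i j * (χ n x * Real.exp (inner ℝ a x)) ≤ 0 := by
    rw [ae_all_iff]
    exact fun n => ae_drift_add_potential_nonpos hyp hS hpos hij ((χ n).contDiff.mul hexp)
      (χ n).hasCompactSupport.mul_right fun x => mul_nonneg (χ n).nonneg (Real.exp_pos _).le
  filter_upwards [h1] with x hx
  obtain ⟨n, hn⟩ := exists_nat_gt ‖x‖
  have hball : x ∈ Metric.ball (0 : Space d) (χ n).rIn := by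
    rw [mem_ball_zero_iff]
    change ‖x‖ < (n : ℝ) + 1
    linarith
  have h2 : (fun y => χ n y * Real.exp (inner ℝ a y)) =ᶠ[𝓝 x] fun y => Real.exp (inner ℝ a y) := by
    filter_upwards [Metric.isOpen_ball.mem_nhds hball] with y hy
    rw [(χ n).one_of_mem_closedBall (Metric.ball_subset_closedBall hy), one_mul]
  have h3 : ∀ k, fderiv ℝ (fun y => χ n y * Real.exp (inner ℝ a y)) x (EuclideanSpace.single k 1)
      = Real.exp (inner ℝ a x) * a k := by
    intro k
    have h4 : HasFDerivAt (fun y : Space d => Real.exp (inner ℝ a y))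
        (Real.exp (inner ℝ a x) • innerSL ℝ a) x :=
      ((innerSL ℝ a).hasFDerivAt (x := x)).exp
    rw [h2.fderiv_eq, h4.fderiv]
    simp [EuclideanSpace.inner_single_right]
  have h5 := hx n
  simp only [h3] at h5
  have h7 : χ n x * Real.exp (inner ℝ a x) = Real.exp (inner ℝ a x) := h2.self_of_nhds
  rw [h7] at h5
  have h6 : Real.exp (inner ℝ a x) * (∑ k, F i j x k * a k + V x i j) ≤ 0 := by
    refine le_of_eq_of_le ?_ h5
    rw [mul_add, Finset.mul_sum]
    congr 1
    · exact Finset.sum_congr rfl fun k _ => by ring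
    · ring
  exact nonpos_of_mul_nonpos_right h6 (Real.exp_pos _)

theorem coupled_of_isPositiveFamily (hyp : HypH1 Q F V)
    {S : ℝ≥0 → VLp d m 2 →L[ℂ] VLp d m 2} (hS : IsGeneratedBy S (realization Q F V))
    (hpos : IsPositiveFamily S) : CoupledOnlyByNonposPotential F V := by
  intro i j hij
  have h0 := ae_inner_add_potential_nonpos hyp hS hpos hij
  refine ⟨?_, by simpa using h0 0⟩
  have h1 : ∀ᵐ x, ∀ (k : Fin d) (s : ℤ), F i j x k * s + V x i j ≤ 0 := by
    rw [ae_all_iff]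
    intro k
    rw [ae_all_iff]
    intro s
    filter_upwards [h0 (EuclideanSpace.single k (s : ℝ))] with x hx
    simpa [Finset.sum_ite_eq] using hx
  filter_upwards [h1] with x hx
  ext k
  -- An affine function of `s ∈ ℤ` that is bounded above is constant.
  by_contra hne
  have hne' : 0 < |F i j x k| := abs_pos.2 hne
  obtain ⟨n, hn⟩ := exists_nat_gt (-V x i j / |F i j x k|)
  rw [div_lt_iff₀ hne'] at hn
  have h2 := hx k n
  have h3 := hx k (-n)
  push_cast at h2 h3
  rcases abs_choice (F i j x k) with h | h
  · rw [h] at hn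
    linarith
  · rw [h] at hn
    linarith

/-! ### Transfer between the Lebesgue spaces -/

/-- Positivity passes to a consistent family on another Lebesgue space, because truncations of
nonnegative functions are nonnegative and lie in both spaces. -/
theorem IsPositiveFamily.of_consistent {p q : ℝ≥0∞} [Fact (1 ≤ p)] [Fact (1 ≤ q)] (hq : q ≠ ⊤)
    {S : ℝ≥0 → VLp d m p →L[ℂ] VLp d m p} {T : ℝ≥0 → VLp d m q →L[ℂ] VLp d m q}
    (h : Consistent S T) (hS : IsPositiveFamily S) : IsPositiveFamily T := by
  intro t f hf
  set A : ℕ → Set (Space d) := fun n => {x | ‖f x‖ ≤ n} ∩ Metric.closedBall 0 n with hA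
  have hAm : ∀ n, MeasurableSet (A n) := fun n =>
    ((Lp.stronglyMeasurable f).norm.measurable measurableSet_Iic).inter
      Metric.isClosed_closedBall.measurableSet
  have hev : ∀ x, ∀ᶠ n in atTop, x ∈ A n := by
    intro x
    obtain ⟨n₁, h1⟩ := exists_nat_ge ‖f x‖
    obtain ⟨n₂, h2⟩ := exists_nat_ge ‖x‖
    filter_upwards [eventually_ge_atTop n₁, eventually_ge_atTop n₂] with n h3 h4
    refine ⟨h1.trans (by exact_mod_cast h3), ?_⟩
    rw [mem_closedBall_zero_iff]
    exact h2.trans (by exact_mod_cast h4)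
  have hmq : ∀ n, MemLp ((A n).indicator f) q volume := fun n => (Lp.memLp f).indicator (hAm n)
  have hmp : ∀ n, MemLp ((A n).indicator f) p volume := by
    intro n
    refine MemLp.mono (g := (Metric.closedBall (0 : Space d) n).indicator fun _ => (n : ℝ))
      (memLp_indicator_const p Metric.isClosed_closedBall.measurableSet _
        (Or.inr measure_closedBall_lt_top.ne)) (hmq n).1 (Eventually.of_forall fun x => ?_)
    by_cases hx : x ∈ A n
    · rw [Set.indicator_of_mem hx, Set.indicator_of_mem hx.2]
      simpa using hx.1
    · rw [Set.indicator_of_notMem hx, norm_zero]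
      exact norm_nonneg _
  have hnn : ∀ {r : ℝ≥0∞} (n) (hr : MemLp ((A n).indicator f) r volume), Nonneg (hr.toLp _) := by
    intro r n hr
    filter_upwards [hr.coeFn_toLp, hf] with x hx hfx i
    rw [hx]
    by_cases hxA : x ∈ A n
    · rw [Set.indicator_of_mem hxA]
      exact hfx i
    · rw [Set.indicator_of_notMem hxA]
      simp
  have hT : ∀ n, Nonneg (T t ((hmq n).toLp _)) := by
    intro n
    have h1 := h t ((hmp n).toLp _) ((hmq n).toLp _)
      ((hmp n).coeFn_toLp.trans (hmq n).coeFn_toLp.symm)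
    filter_upwards [h1, hS t _ (hnn n (hmp n))] with x hx h2 i
    rw [← hx]
    exact h2 i
  have hlim : Tendsto (fun n => (hmq n).toLp _) atTop (𝓝 f) := by
    have hq0 : q ≠ 0 := (zero_lt_one.trans_le Fact.out).ne'
    have hqr : 0 < q.toReal := ENNReal.toReal_pos hq0 hq
    have h1 := (Lp.tendsto_Lp_iff_tendsto_eLpNorm'' (fi := atTop)
      (fun n => (A n).indicator f) hmq f (Lp.memLp f)).2 ?_
    · rwa [Lp.toLp_coeFn] at h1
    · have h2 : Tendsto (fun n => ∫⁻ x, ‖((A n).indicator f - f) x‖ₑ ^ q.toReal) atTop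
          (𝓝 (∫⁻ _ : Space d, 0)) := by
        refine tendsto_lintegral_of_dominated_convergence' (fun x => ‖f x‖ₑ ^ q.toReal)
          (fun n => ((hmq n).1.sub (Lp.memLp f).1).enorm.pow_const _) (fun n => ?_)
          (lintegral_rpow_enorm_lt_top_of_eLpNorm_lt_top hq0 hq (Lp.memLp f).2).ne
          (Eventually.of_forall fun x => ?_)
        · refine Eventually.of_forall fun x => ?_
          refine ENNReal.rpow_le_rpow ?_ hqr.le
          by_cases hx : x ∈ A n
          · simp [Set.indicator_of_mem hx]
          · simp [Set.indicator_of_notMem hx]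
        · refine tendsto_const_nhds.congr' ?_
          filter_upwards [hev x] with n hn
          simp [Set.indicator_of_mem hn, hqr]
      have h3 := ((ENNReal.continuous_rpow_const (y := 1 / q.toReal)).tendsto _).comp h2
      have h4 : (∫⁻ _ : Space d, (0 : ℝ≥0∞)) ^ (1 / q.toReal) = 0 := by simp [hqr]
      rw [h4] at h3
      refine h3.congr fun n => ?_
      rw [eLpNorm_eq_lintegral_rpow_enorm_toReal hq0 hq]
      rfl
  exact isClosed_nonneg.mem_of_tendsto (((T t).continuous.tendsto _).comp hlim)
    (Eventually.of_forall hT)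

theorem Consistent.symm {p q : ℝ≥0∞} [Fact (1 ≤ p)] [Fact (1 ≤ q)]
    {S : ℝ≥0 → VLp d m p →L[ℂ] VLp d m p} {T : ℝ≥0 → VLp d m q →L[ℂ] VLp d m q}
    (h : Consistent S T) : Consistent T S :=
  fun t f g hfg => (h t g f hfg.symm).symm

end Necessity

end EllipticSystem

theorem mainTheorem5 (d m : ℕ) (hd : 1 ≤ d) (hm : 1 ≤ m)
    (Q : EllipticSystem.Space d → Matrix (Fin d) (Fin d) ℝ)
    (F : Fin m → Fin m → EllipticSystem.Space d → EllipticSystem.Space d)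
    (V : EllipticSystem.Space d → Matrix (Fin m) (Fin m) ℝ)
    (hyp : EllipticSystem.HypH1 Q F V) :
    (∃! S : ℝ≥0 → EllipticSystem.VLp d m 2 →L[ℂ] EllipticSystem.VLp d m 2,
      EllipticSystem.IsGeneratedBy S (EllipticSystem.realization Q F V)) ∧
    ∀ S₂ : ℝ≥0 → EllipticSystem.VLp d m 2 →L[ℂ] EllipticSystem.VLp d m 2,
      EllipticSystem.IsGeneratedBy S₂ (EllipticSystem.realization Q F V) →
      (EllipticSystem.IsPositiveFamily S₂ ↔
        EllipticSystem.CoupledOnlyByNonposPotential F V) ∧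
      ∀ (p : ℝ≥0∞) [Fact (1 ≤ p)], p ≠ ⊤ →
        ∀ Sp : ℝ≥0 → EllipticSystem.VLp d m p →L[ℂ] EllipticSystem.VLp d m p,
          EllipticSystem.Consistent S₂ Sp →
          (EllipticSystem.IsPositiveFamily Sp ↔
            EllipticSystem.CoupledOnlyByNonposPotential F V) := by
  refine ⟨?_, fun S₂ hS₂ => ?_⟩
  · obtain ⟨_, _, S, -, -, hS, -⟩ := EllipticSystem.exists_isGeneratedBy_realization hyp
    exact ⟨S, hS, fun T hT => EllipticSystem.isGeneratedBy_realization_unique hyp hT hS⟩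
  · have h2 : EllipticSystem.IsPositiveFamily S₂
        ↔ EllipticSystem.CoupledOnlyByNonposPotential F V :=
      ⟨EllipticSystem.coupled_of_isPositiveFamily hyp hS₂,
        fun hc => EllipticSystem.isPositiveFamily_of_coupled hyp hc hS₂⟩
    refine ⟨h2, fun p _ hp Sp hSp => ⟨fun h => h2.1 (h.of_consistent (by simp) hSp.symm),
      fun hc => (h2.2 hc).of_consistent hp hSp⟩⟩
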